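/- **Volume-preserving slow map.** Let $l,j\ge 0$, $\mathbb T=\mathbb R/\mathbb Z$, let $M\subseteq\mathbb R^j$ be open, and let $\omega_0\in\mathbb R^l$ be Diophantine: for some $c,\mu>0$, $|m\cdot\omega_0-k|\ge c|m|^{-\mu}$ for all $m\in\mathbb Z^l\setminus\{0\}$ and $k\in\mathbb Z$ ($|m|$ the maximum norm). Consider the slow–fast map $$f_\kappa:\quad \theta'=\theta+\omega_0+\kappa F^{(1)}(\theta,J;\kappa),\qquad J'=J+\kappa G^{(1)}(\theta,J;\kappa),\qquad (\theta,J)\in\mathbb T^l\times M,$$ where $F^{(1)},G^{(1)}$ (with values in $\mathbb R^l$, $\mathbb R^j$) are real analytic in $(\theta,J,\kappa)$ on a neighbourhood of $\mathbb T^l\times M\times\{0\}$. Suppose $f_\kappa$ is volume-preserving: for every compact $K\subset M$, $\det Df_\kappa=1$ on $\mathbb T^l\times K$ for all sufficiently small $|\kappa|$. Then for every $n\ge 0$ there are functions $F^{(m)},G^{(m)}$ ($2\le m\le n+1$) and $T^{(m)},S^{(m)}$ ($1\le m\le n$) of $(\psi,I;\kappa)$, with $F^{(m)},T^{(m)}$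 taking values in $\mathbb R^l$ and $G^{(m)},S^{(m)}$ in $\mathbb R^j$, all real analytic on neighbourhoods of $\mathbb T^l\times M\times\{0\}$, with the following properties. Put, for $1\le m\le n$, $$\bar F^{(m)}(I)=\int_{\mathbb T^l}F^{(m)}(\psi,I;0)\,d\psi,\qquad \bar G^{(m)}(I)=\int_{\mathbb T^l}G^{(m)}(\psi,I;0)\,d\psi$$ (these are analytic on $M$), and for $0\le m\le n$ let $f^{(m)}_\kappa$ be the map $$\psi'=\psi+\omega_0+\sum_{i=1}^{m}\kappa^i\bar F^{(i)}(I)+\kappa^{m+1}F^{(m+1)}(\psi,I;\kappa),\qquad I'=I+\sum_{i=1}^{m}\kappa^i\bar G^{(i)}(I)+\kappa^{m+1}G^{(m+1)}(\psi,I;\kappa),$$ so that $f^{(0)}_\kappa=f_\kappa$. 1. For $1\le m\le n$ the decoupling transformation $\Phi^{(m)}_\kappa(\psi,I)=(\psi+\kappa^mT^{(m)}(\psi,I;\kappa),\,I+\kappa^mS^{(m)}(\psi,I;\kappa))$ is volume-preserving and conjugates $f^{(m-1)}_\kappa$ to $f^{(m)}_\kappa$, locally uniformly in $M$: for every compact $K\subset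 M$ there are an open $U$ with $K\subseteq U\subseteq M$ and a $\kappa_0>0$ such that, for $|\kappa|<\kappa_0$, $\Phi^{(m)}_\kappa$ is an analytic diffeomorphism of $\mathbb T^l\times U$ onto an open subset of $\mathbb T^l\times M$ containing $\mathbb T^l\times K$, has $\det D\Phi^{(m)}_\kappa=1$ on $\mathbb T^l\times U$, both $\Phi^{(m)}_\kappa$ and $f^{(m)}_\kappa$ map $\mathbb T^l\times K$ into $\mathbb T^l\times U$, and $f^{(m-1)}_\kappa\circ\Phi^{(m)}_\kappa=\Phi^{(m)}_\kappa\circ f^{(m)}_\kappa$ on $\mathbb T^l\times K$. 2. The truncated averaged slow map $\bar I'=\bar I+\sum_{i=1}^n\kappa^i\bar G^{(i)}(\bar I)$ is volume-preserving on $M$ up to order $n$: its Jacobian determinant is $1+O(\kappa^{n+1})$ as $\kappa\to0$, uniformly on compact subsets of $M$. -/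

import Mathlib

open Set MeasureTheory

noncomputable section

/-- The universal cover `ℝˡ × ℝʲ` of the phase space `𝕋ˡ × ℝʲ`; the torus is `𝕋 = ℝ / ℤ`.
Points are pairs (fast angles, slow variables).  Maps of `𝕋ˡ × M` are represented by their lifts. -/
abbrev Phase (l j : ℕ) : Type := (Fin l → ℝ) × (Fin j → ℝ)

/-- The (lift of the) set `𝕋ˡ × U`. -/
def overTorus (l : ℕ) {j : ℕ} (U : Set (Fin j → ℝ)) : Set (Phase l j) := univ ×ˢ U

/-- The Diophantine frequency vectors `𝒟(c, μ)`, with the maximum norm on `ℤˡ`. -/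
def diophantineSet (l : ℕ) (c μ : ℝ) : Set (Fin l → ℝ) :=
  {ω | ∀ (m : Fin l → ℤ) (n : ℤ), m ≠ 0 → c * ‖m‖ ^ (-μ) ≤ |(∑ i, (m i : ℝ) * ω i) - (n : ℝ)|}

/-- `X (θ, J; κ)` is real analytic jointly in all its arguments, and `ℤˡ`-periodic in `θ`, on a
neighbourhood of `𝕋ˡ × M × {0}`: every compact `K ⊆ M` has an open neighbourhood `U ⊆ M` such that
this holds on `𝕋ˡ × U × (-κ₀, κ₀)` for some `κ₀ > 0`. -/
def IsAnalyticFamily {l j : ℕ} {E : Type*} [NormedAddCommGroup E] [NormedSpace ℝ E]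
    (M : Set (Fin j → ℝ)) (X : Phase l j × ℝ → E) : Prop :=
  ∀ K ⊆ M, IsCompact K → ∃ U : Set (Fin j → ℝ), IsOpen U ∧ K ⊆ U ∧ U ⊆ M ∧ ∃ κ₀ > 0,
    AnalyticOnNhd ℝ X (overTorus l U ×ˢ Ioo (-κ₀) κ₀) ∧
    ∀ (k : Fin l → ℤ), ∀ θ, ∀ J ∈ U, ∀ κ ∈ Ioo (-κ₀) κ₀,
      X ((θ + (fun i => (k i : ℝ)), J), κ) = X ((θ, J), κ)

/-- Jacobian determinant identically one on `s`. -/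
def IsVolumePreservingOn {l j : ℕ} (f : Phase l j → Phase l j) (s : Set (Phase l j)) : Prop :=
  ∀ p ∈ s, (fderiv ℝ f p).det = 1

/-- The slow-fast map `θ' = θ + ω₀ + κ F(θ, J; κ)`, `J' = J + κ G(θ, J; κ)`. -/
def slowFastMap {l j : ℕ} (ω₀ : Fin l → ℝ) (F : Phase l j × ℝ → (Fin l → ℝ))
    (G : Phase l j × ℝ → (Fin j → ℝ)) (κ : ℝ) (p : Phase l j) : Phase l j :=
  (p.1 + ω₀ + κ • F (p, κ), p.2 + κ • G (p, κ))

/-- The average over the fast angles at `κ = 0`: `∫_{𝕋ˡ} X(θ, J; 0) dθ`. -/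
def torusAverage {l j : ℕ} (X : Phase l j × ℝ → Phase l j) (J : Fin j → ℝ) : Phase l j :=
  ∫ θ in Icc (0 : Fin l → ℝ) 1, X ((θ, J), 0)

/-- The map whose fast-angle dependence has been removed up to order `m`.  With
`R i = (F⁽ⁱ⁾, G⁽ⁱ⁾)` and with averages `(F̄⁽ⁱ⁾, Ḡ⁽ⁱ⁾)` it reads
`ψ' = ψ + ω₀ + ∑_{i=1}^m κⁱ F̄⁽ⁱ⁾(I) + κ^{m+1} F⁽ᵐ⁺¹⁾(ψ, I; κ)`,
`I' = I + ∑_{i=1}^m κⁱ Ḡ⁽ⁱ⁾(I) + κ^{m+1} G⁽ᵐ⁺¹⁾(ψ, I; κ)`. -/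
def decoupledMap {l j : ℕ} (ω₀ : Fin l → ℝ) (R : ℕ → Phase l j × ℝ → Phase l j) (m : ℕ) (κ : ℝ)
    (p : Phase l j) : Phase l j :=
  (p.1 + ω₀ + ∑ i ∈ Finset.Icc 1 m, κ ^ i • (torusAverage (R i) p.2).1
      + κ ^ (m + 1) • (R (m + 1) (p, κ)).1,
    p.2 + ∑ i ∈ Finset.Icc 1 m, κ ^ i • (torusAverage (R i) p.2).2
      + κ ^ (m + 1) • (R (m + 1) (p, κ)).2)

/-- The truncated averaged slow map `Ī' = Ī + ∑_{i=1}^n κⁱ Ḡ⁽ⁱ⁾(Ī)`. -/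
def averagedSlowMap {l j : ℕ} (R : ℕ → Phase l j × ℝ → Phase l j) (n : ℕ) (κ : ℝ)
    (I : Fin j → ℝ) : Fin j → ℝ :=
  I + ∑ i ∈ Finset.Icc 1 n, κ ^ i • (torusAverage (R i) I).2

/-- The near-identity map `(ψ, I) ↦ (ψ + κᵐ T(ψ, I; κ), I + κᵐ S(ψ, I; κ))`, with `V = (T, S)`. -/
def nearIdentity {l j : ℕ} (m : ℕ) (V : Phase l j × ℝ → Phase l j) (κ : ℝ) (p : Phase l j) :
    Phase l j :=
  (p.1 + κ ^ m • (V (p, κ)).1, p.2 + κ ^ m • (V (p, κ)).2)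

/-- `Φ κ` is, for small `κ`, a volume-preserving diffeomorphism with `f κ ∘ Φ κ = Φ κ ∘ g κ`.
As none of these maps need preserve `𝕋ˡ × M`, this is meant locally uniformly in `M`: every
compact `K ⊆ M` has an open neighbourhood `U ⊆ M` and a `κ₀ > 0` such that, for `|κ| < κ₀`, `Φ κ`
is analytic and injective with Jacobian determinant one on `𝕋ˡ × U` (hence an analytic
diffeomorphism onto its open image), that image lies in `𝕋ˡ × M` and covers `𝕋ˡ × K` (so that
`h = (Φ κ)⁻¹` is defined there), and the conjugacy holds on `𝕋ˡ × K`, the points involved staying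
in `𝕋ˡ × U`. -/
def IsVolumePreservingConjugacy {l j : ℕ} (M : Set (Fin j → ℝ))
    (Φ f g : ℝ → Phase l j → Phase l j) : Prop :=
  ∀ K ⊆ M, IsCompact K → ∃ U : Set (Fin j → ℝ), IsOpen U ∧ K ⊆ U ∧ U ⊆ M ∧ ∃ κ₀ > 0,
    ∀ κ : ℝ, |κ| < κ₀ →
      AnalyticOnNhd ℝ (Φ κ) (overTorus l U) ∧
      InjOn (Φ κ) (overTorus l U) ∧
      IsVolumePreservingOn (Φ κ) (overTorus l U) ∧
      MapsTo (Φ κ) (overTorus l U) (overTorus l M) ∧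
      overTorus l K ⊆ Φ κ '' overTorus l U ∧
      ∀ p ∈ overTorus l K,
        Φ κ p ∈ overTorus l U ∧ g κ p ∈ overTorus l U ∧ f κ (Φ κ p) = Φ κ (g κ p)

/-- The family `s κ` of maps on `M` is volume-preserving up to order `n`: its Jacobian determinant
is `1 + O(κ^{n+1})`, uniformly on compact subsets of `M`. -/
def IsVolumePreservingUpTo {j : ℕ} (M : Set (Fin j → ℝ)) (n : ℕ)
    (s : ℝ → (Fin j → ℝ) → (Fin j → ℝ)) : Prop :=
  ∀ K ⊆ M, IsCompact K → ∃ C : ℝ, ∃ κ₀ > 0, ∀ κ : ℝ, |κ| < κ₀ → ∀ I ∈ K,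
    |(fderiv ℝ (s κ) I).det - 1| ≤ C * |κ| ^ (n + 1)

end

/-! Suppose the map already has the form p ↦ p + (ω₀, 0) + A(I, κ) + κᵐ X(p, κ), with A independent
of the angles (`driftMap`). A change of variables p + κᵐ V₀(p) + … replaces the term of order κᵐ by
X(·, 0) + V₀ - V₀(· + ω₀). Averaging it therefore means solving the cohomological equation V₀(· +
ω₀) - V₀ = X(·, 0) - X̄.

Volume preservation allows V₀ to be divergence-free. The Jacobian determinant is det B + κᵐ div X(·,
0) + o(κᵐ), where B depends only on (I, κ). Since it equals 1, div X(·, 0) does not depend on the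
angles (`traceCLM_fderiv_eq_of_det_driftMap`). The solution V₀ is an angular convolution of Δʳ X(·,
0) with a fixed continuous kernel: r Laplacians outweigh the small divisors
(`exists_cohomological_kernel`). This formula makes V₀ real analytic in all variables without
complex strips, because it is an integral of an analytic function of the parameters. It also gives
div V₀ = 0, since Δʳ annihilates div X(·, 0) (`exists_divergenceFree_solution`).

The transformation Φ is the flow of V₀ at time κᵐ, so it preserves volume exactly by Liouville's
theorem (`eventually_det_fderiv_flowMap`). The flow is analytic by the implicit function theorem in
C([0,1], E), applied to the integral equation (`AnalyticAt.exists_local_flow`). The conjugated map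
again preserves volume, and Hadamard quotients show that its remainder is κᵐ⁺¹ times an analytic
family (`IsDivergenceFreeFlow.exists_conj`). Induction on m concludes (`exists_decoupling_step`,
`exists_decoupling`).

For the averaged slow map, consider the nth map. The derivative of its angle-independent part is
block triangular with the identity in the fast block, so its determinant is that of the slow map. It
differs from 1 by O(κⁿ⁺¹), because determinants are locally Lipschitz (`isBigO_det_fderiv_sub_one`).

Everything is proved on the universal cover near each point of 𝕋ˡ × M × {0}. Exact equivariance
under integer translations reduces the angles to a compact cube, and compactness then gives locally
uniform statements (`exists_forall_overTorus`). -/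

noncomputable section

open Filter Topology Metric
open scoped ContDiff

/-! ### Analytic superposition operators on spaces of continuous functions. -/

section Superposition

variable {T E F : Type*} [TopologicalSpace T] [CompactSpace T]
  [NormedAddCommGroup E] [NormedSpace ℝ E] [NormedAddCommGroup F] [NormedSpace ℝ F]

/-- The pointwise application of a continuous multilinear map to continuous functions. -/
def ContinuousMultilinearMap.superposition (T : Type*) [TopologicalSpace T] [CompactSpace T] {n : ℕ}
    (a : E [×n]→L[ℝ] F) : C(T, E) [×n]→L[ℝ] C(T, F) :=
  MultilinearMap.mkContinuous
    { toFun := fun ys => ⟨fun t => a fun i => ys i t, by fun_prop⟩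
      map_update_add' := by
        intro _ ys i y z
        ext t
        have h (w : C(T, E)) : (fun k => Function.update ys i w k t)
            = Function.update (fun k => ys k t) i (w t) := by
          ext k; by_cases hk : k = i
          · subst hk; simp
          · simp [hk]
        convert a.map_update_add (fun k => ys k t) i (y t) (z t) using 1
        · exact congrArg a (by convert h (y + z); rfl)
        · refine congrArg₂ (· + ·) (congrArg a ?_) (congrArg a ?_)
          · convert h y
          · convert h z
      map_update_smul' := by
        intro _ ys i c y
        ext t
        have h (w : C(T, E)) : (fun k => Function.update ys i w k t)
            = Function.update (fun k => ys k t) i (w t) := by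
          ext k; by_cases hk : k = i
          · subst hk; simp
          · simp [hk]
        convert a.map_update_smul (fun k => ys k t) i c (y t) using 1
        · exact congrArg a (by convert h (c • y); rfl)
        · refine congrArg (c • ·) (congrArg a ?_)
          convert h y }
    ‖a‖ (by
      intro ys
      refine (ContinuousMap.norm_le _ (by positivity)).2 fun t => (a.le_opNorm _).trans ?_
      gcongr with i
      exact (ys i).norm_coe_le_norm t)

/-- This bound gives the superposed power series at least the radius of convergence of the original
one. -/
theorem ContinuousMultilinearMap.norm_superposition_le {n : ℕ} (a : E [×n]→L[ℝ] F) :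
    ‖a.superposition T‖ ≤ ‖a‖ :=
  MultilinearMap.mkContinuous_norm_le _ (norm_nonneg a) _

/-- Superposition with an analytic function is analytic near the constant curves. -/
theorem AnalyticAt.exists_superposition.{u} [CompleteSpace F] {h : E → F} {e₀ : E}
    (hh : AnalyticAt ℝ h e₀) :
    ∃ r > 0, ∀ (T : Type u) [TopologicalSpace T] [CompactSpace T], ∃ N : C(T, E) → C(T, F),
      AnalyticOnNhd ℝ N (ball (ContinuousMap.const T e₀) r) ∧
      ∀ y ∈ ball (ContinuousMap.const T e₀) r, ∀ t, N y t = h (y t) := by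
  obtain ⟨p, R, hp⟩ := hh
  obtain ⟨r, hr, hrR⟩ := ENNReal.lt_iff_exists_nnreal_btwn.1 hp.r_pos
  refine ⟨r, by exact_mod_cast hr, fun T _ _ => ?_⟩
  let P : FormalMultilinearSeries ℝ C(T, E) C(T, F) := fun n => (p n).superposition T
  have hR : R ≤ P.radius := hp.r_le.trans
    (FormalMultilinearSeries.radius_le_of_le fun n => (p n).norm_superposition_le)
  have hP : HasFPowerSeriesOnBall (fun y => P.sum (y - ContinuousMap.const T e₀)) P
      (ContinuousMap.const T e₀) R := by
    have := ((P.hasFPowerSeriesOnBall (hp.r_pos.trans_le hR)).mono hp.r_pos hR).comp_sub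
      (ContinuousMap.const T e₀)
    rwa [zero_add] at this
  have hsub (y : C(T, E)) (hy : y ∈ ball (ContinuousMap.const T e₀) (r : ℝ)) :
      y ∈ Metric.eball (ContinuousMap.const T e₀) R := by
    rw [Metric.mem_eball, edist_nndist]
    refine lt_trans ?_ hrR
    exact_mod_cast (mem_ball.1 hy)
  refine ⟨_, fun y hy => hP.analyticOnNhd y (hsub y hy), fun y hy t => ?_⟩
  have hd : y - ContinuousMap.const T e₀ ∈ Metric.eball (0 : C(T, E)) P.radius := by
    have := Metric.eball_subset_eball hR (hsub y hy)
    rw [Metric.mem_eball] at this ⊢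
    rwa [edist_zero_right, ← edist_eq_enorm_sub]
  have h1 := (ContinuousMap.evalCLM ℝ t).hasSum (P.hasSum hd)
  have hyt : y t - e₀ ∈ Metric.eball (0 : E) R := by
    have h2 : dist (y t) e₀ ≤ dist y (ContinuousMap.const T e₀) :=
      ContinuousMap.dist_apply_le_dist (f := y) (g := ContinuousMap.const T e₀) t
    rw [Metric.mem_eball, edist_zero_right, ← edist_eq_enorm_sub]
    refine lt_of_le_of_lt ?_ (Metric.mem_eball.1 (hsub y hy))
    rw [edist_dist, edist_dist]
    exact ENNReal.ofReal_le_ofReal h2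
  have h2 := hp.hasSum hyt
  rw [add_sub_cancel] at h2
  exact h1.unique h2

end Superposition

/-! ### Integrals depending analytically on a parameter. -/

section ParametricIntegral

variable {X P F : Type*} [NormedAddCommGroup X] [NormedSpace ℝ X] [MeasurableSpace X] [BorelSpace X]
  [SecondCountableTopology X] [NormedAddCommGroup P] [NormedSpace ℝ P] [NormedAddCommGroup F]
  [NormedSpace ℝ F] {ν : Measure X} {K : Set X} {g : X → ℝ} {h : X × P → F} {p₀ : P}

/-- Weighted integration as a continuous linear functional on the continuous functions. -/
theorem exists_clm_integral {T : Type*} [TopologicalSpace T] [CompactSpace T] [MeasurableSpace T]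
    [OpensMeasurableSpace T] [SecondCountableTopology T] [TopologicalSpace.PseudoMetrizableSpace T]
    {ν : Measure T} {g : T → ℝ} (hg : Integrable g ν) :
    ∃ I : C(T, F) →L[ℝ] F, ∀ φ : C(T, F), Integrable (fun x => g x • φ x) ν ∧
      I φ = ∫ x, g x • φ x ∂ν := by
  have hi (φ : C(T, F)) : Integrable (fun x => g x • φ x) ν :=
    hg.smul_of_top_left <| memLp_top_of_bound φ.continuous.aestronglyMeasurable ‖φ‖
      (Eventually.of_forall φ.norm_coe_le_norm)
  refine ⟨LinearMap.mkContinuous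
    { toFun := fun φ => ∫ x, g x • φ x ∂ν
      map_add' := fun φ ψ => by
        simp only [ContinuousMap.add_apply, smul_add]
        exact integral_add (hi φ) (hi ψ)
      map_smul' := fun c φ => by
        simp only [ContinuousMap.smul_apply, RingHom.id_apply, smul_comm _ c]
        exact integral_smul c _ } (∫ x, ‖g x‖ ∂ν) fun φ => ?_, fun φ => ⟨hi φ, rfl⟩⟩
  refine (norm_integral_le_integral_norm _).trans ?_
  rw [← integral_mul_const]
  refine integral_mono (hi φ).norm (hg.norm.mul_const _) fun x => ?_
  simp only [norm_smul]
  gcongr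
  exact φ.norm_coe_le_norm x

/-- Near x₀ the integral is a bounded linear functional of the superposition of `h` with the curve x
↦ (x, p), which is affine in p. Allowing every measurable `t ⊆ s` makes it possible to cut a finite
cover of `K` into disjoint pieces and add the results. -/
theorem exists_nhds_analyticAt_setIntegral [CompleteSpace F] (hK : IsCompact K)
    (hg : IntegrableOn g K ν) {x₀ : X} (hh : AnalyticAt ℝ h (x₀, p₀)) :
    ∃ s ∈ 𝓝 x₀, MeasurableSet s ∧ ∀ t ⊆ s, MeasurableSet t →
      (∀ᶠ p in 𝓝 p₀, IntegrableOn (fun x => g x • h (x, p)) (t ∩ K) ν) ∧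
      AnalyticAt ℝ (fun p => ∫ x in t ∩ K, g x • h (x, p) ∂ν) p₀ := by
  -- The radius is available before the compact space is chosen, so the latter may be cut out by the
  -- ball of radius `r / 2`.
  obtain ⟨r, hr, H⟩ := hh.exists_superposition
  have hTc : IsCompact (closedBall x₀ (r / 2) ∩ K) := hK.inter_left isClosed_closedBall
  have hTm : MeasurableSet (closedBall x₀ (r / 2) ∩ K) := hTc.measurableSet
  let T := ↥(closedBall x₀ (r / 2) ∩ K)
  have : CompactSpace T := isCompact_iff_compactSpace.1 hTc
  obtain ⟨N, hN, hNh⟩ := H T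
  refine ⟨closedBall x₀ (r / 2), closedBall_mem_nhds _ (by positivity),
    measurableSet_closedBall, fun t ht htm => ?_⟩
  have hset : closedBall x₀ (r / 2) ∩ K ∩ t = t ∩ K := by
    ext x
    simp only [mem_inter_iff]
    exact ⟨fun hx => ⟨hx.2, hx.1.2⟩, fun hx => ⟨⟨ht hx.1, hx.2⟩, hx.1⟩⟩
  have hgT : Integrable (fun x : T => t.indicator g x) (Measure.comap Subtype.val ν) := by
    have h1 : IntegrableOn (t.indicator g) (closedBall x₀ (r / 2) ∩ K) ν :=
      (hg.mono_set inter_subset_right).indicator htm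
    exact (integrableOn_iff_comap_subtypeVal hTm).1 h1
  obtain ⟨I, hI⟩ := exists_clm_integral (F := F) hgT
  let L : P →L[ℝ] C(T, X × P) := LinearMap.mkContinuous
    { toFun := fun p => ContinuousMap.const T (0, p)
      map_add' := fun p q => by ext <;> simp
      map_smul' := fun c p => by ext <;> simp } 1 fun p => by
        rw [one_mul]
        refine (ContinuousMap.norm_le _ (norm_nonneg p)).2 fun x => ?_
        simp [Prod.norm_def]
  let y₀ : C(T, X × P) := ⟨fun x => ((x : X), 0), by fun_prop⟩
  have hL (p : P) (x : T) : (y₀ + L p) x = ((x : X), p) := by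
    change ((x : X), (0 : P)) + ((0 : X), p) = _
    simp
  have hball : ∀ p ∈ ball p₀ r, y₀ + L p ∈ ball (ContinuousMap.const T (x₀, p₀)) r := by
    intro p hp
    have hm : max (r / 2) (dist p p₀) < r := max_lt (by linarith) hp
    rw [mem_ball]
    refine lt_of_le_of_lt ((ContinuousMap.dist_le (by positivity)).2 fun x => ?_) hm
    rw [hL, ContinuousMap.const_apply, Prod.dist_eq]
    exact max_le_max x.2.1 le_rfl
  have key : ∀ p ∈ ball p₀ r, IntegrableOn (fun x => g x • h (x, p)) (t ∩ K) ν ∧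
      I (N (y₀ + L p)) = ∫ x in t ∩ K, g x • h (x, p) ∂ν := by
    intro p hp
    obtain ⟨h1, h2⟩ := hI (N (y₀ + L p))
    have h3 : (fun x : T => t.indicator g x • N (y₀ + L p) x)
        = fun x : T => t.indicator (fun x => g x • h (x, p)) x := by
      ext x
      rw [hNh _ (hball p hp), hL]
      by_cases hx : (x : X) ∈ t <;> simp [hx]
    rw [h3] at h1 h2
    constructor
    · have h4 := (integrableOn_iff_comap_subtypeVal
        (f := t.indicator fun x => g x • h (x, p)) hTm).2 h1
      rwa [integrableOn_indicator_iff htm, inter_comm, hset] at h4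
    · rw [h2, integral_subtype_comap hTm, setIntegral_indicator htm, hset]
  refine ⟨eventually_of_mem (ball_mem_nhds p₀ hr) fun p hp => (key p hp).1, ?_⟩
  have hA : AnalyticAt ℝ (fun p => I (N (y₀ + L p))) p₀ := by
    refine (I.analyticAt _).comp (AnalyticAt.fun_comp (hN _ (hball p₀ (mem_ball_self hr))) ?_)
    exact analyticAt_const.add (L.analyticAt _)
  exact hA.congr (eventually_of_mem (ball_mem_nhds p₀ hr) fun p hp => (key p hp).2)

/-- Integration over a compact set preserves analyticity in the parameter. -/
theorem analyticAt_setIntegral_of_isCompact [CompleteSpace F] (hK : IsCompact K)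
    (hg : IntegrableOn g K ν) (hh : ∀ x ∈ K, AnalyticAt ℝ h (x, p₀)) :
    AnalyticAt ℝ (fun p => ∫ x in K, g x • h (x, p) ∂ν) p₀ := by
  have H : ∃ s, K ⊆ s ∧ MeasurableSet s ∧ ∀ t ⊆ s, MeasurableSet t →
      (∀ᶠ p in 𝓝 p₀, IntegrableOn (fun x => g x • h (x, p)) (t ∩ K) ν) ∧
      AnalyticAt ℝ (fun p => ∫ x in t ∩ K, g x • h (x, p) ∂ν) p₀ := by
    refine hK.induction_on (p := fun u => ∃ s, u ⊆ s ∧ MeasurableSet s ∧ ∀ t ⊆ s, MeasurableSet t →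
      (∀ᶠ p in 𝓝 p₀, IntegrableOn (fun x => g x • h (x, p)) (t ∩ K) ν) ∧
      AnalyticAt ℝ (fun p => ∫ x in t ∩ K, g x • h (x, p) ∂ν) p₀) ?_ ?_ ?_ ?_
    · refine ⟨∅, subset_rfl, MeasurableSet.empty, fun t ht _ => ?_⟩
      rw [subset_empty_iff.1 ht]
      simpa using analyticAt_const
    · rintro u v huv ⟨s, hs, h1, h2⟩
      exact ⟨s, huv.trans hs, h1, h2⟩
    · rintro u v ⟨s, hs, hsm, h1⟩ ⟨s', hs', hsm', h2⟩
      refine ⟨s ∪ s', union_subset_union hs hs', hsm.union hsm', fun t ht htm => ?_⟩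
      obtain ⟨a1, b1⟩ := h1 (t ∩ s) inter_subset_right (htm.inter hsm)
      obtain ⟨a2, b2⟩ := h2 (t \ s) (fun x hx => (ht hx.1).resolve_left hx.2) (htm.diff hsm)
      have hu : t ∩ K = (t ∩ s ∩ K) ∪ (t \ s ∩ K) := by
        rw [← union_inter_distrib_right, inter_union_sdiff]
      constructor
      · filter_upwards [a1, a2] with p q1 q2
        rw [hu]
        exact q1.union q2
      · refine (b1.add b2).congr ?_
        filter_upwards [a1, a2] with p q1 q2
        rw [hu, setIntegral_union _ ((htm.diff hsm).inter hK.measurableSet) q1 q2]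
        · rfl
        · exact (disjoint_sdiff_right.mono_left inter_subset_right).mono inter_subset_left
            inter_subset_left
    · intro x hx
      obtain ⟨s, hs, hsm, H⟩ := exists_nhds_analyticAt_setIntegral hK hg (hh x hx)
      exact ⟨s, mem_nhdsWithin_of_mem_nhds hs, s, subset_rfl, hsm, H⟩
  obtain ⟨s, hs, -, H⟩ := H
  simpa using (H K hs hK.measurableSet).2

/-- Differentiation under the integral sign over a compact set. -/
theorem hasFDerivAt_setIntegral_of_isCompact [CompleteSpace F] (hK : IsCompact K)
    (hg : IntegrableOn g K ν) (hh : ∀ x ∈ K, AnalyticAt ℝ h (x, p₀)) :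
    HasFDerivAt (fun p => ∫ x in K, g x • h (x, p) ∂ν)
      (∫ x in K, g x • (fderiv ℝ h (x, p₀)).comp (ContinuousLinearMap.inr ℝ X P) ∂ν) p₀ := by
  -- Compactness gives one derivative bound for all `x ∈ K` and all p near `p₀`, which supplies the
  -- dominating function.
  have hK' : ∃ C, ∀ᶠ p in 𝓝 p₀, ∀ x ∈ K, AnalyticAt ℝ h (x, p) ∧ ‖fderiv ℝ h (x, p)‖ ≤ C := by
    refine hK.induction_on (p := fun u => ∃ C, ∀ᶠ p in 𝓝 p₀, ∀ x ∈ u,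
      AnalyticAt ℝ h (x, p) ∧ ‖fderiv ℝ h (x, p)‖ ≤ C) ⟨0, by simp⟩ ?_ ?_ ?_
    · rintro u v huv ⟨C, hC⟩
      exact ⟨C, hC.mono fun p hp x hx => hp x (huv hx)⟩
    · rintro u v ⟨C, hC⟩ ⟨C', hC'⟩
      refine ⟨max C C', ?_⟩
      filter_upwards [hC, hC'] with p h1 h2
      rintro x (hx | hx)
      · exact ⟨(h1 x hx).1, (h1 x hx).2.trans (le_max_left _ _)⟩
      · exact ⟨(h2 x hx).1, (h2 x hx).2.trans (le_max_right _ _)⟩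
    · intro x hx
      have h1 := (hh x hx).eventually_analyticAt
      have h2 : ∀ᶠ q in 𝓝 (x, p₀), ‖fderiv ℝ h q‖ ≤ ‖fderiv ℝ h (x, p₀)‖ + 1 :=
        ((hh x hx).fderiv.continuousAt.norm.eventually_lt_const (lt_add_one _)).mono
          fun q hq => hq.le
      have h3 := h1.and h2
      rw [nhds_prod_eq] at h3
      obtain ⟨pa, ha, pb, hb, H⟩ := eventually_prod_iff.1 h3
      exact ⟨{x | pa x}, mem_nhdsWithin_of_mem_nhds ha, _, hb.mono fun p hp x hx => H hx hp⟩
  obtain ⟨C, hC⟩ := hK'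
  have hcont (p : P) (hp : ∀ x ∈ K, AnalyticAt ℝ h (x, p)) :
      ContinuousOn (fun x => h (x, p)) K := fun x hx =>
    ((hp x hx).continuousAt.comp (f := fun x => (x, p)) (by fun_prop)).continuousWithinAt
  have hcont' (p : P) (hp : ∀ x ∈ K, AnalyticAt ℝ h (x, p)) :
      ContinuousOn (fun x => (fderiv ℝ h (x, p)).comp (ContinuousLinearMap.inr ℝ X P)) K :=
    fun x hx => ((ContinuousAt.comp (f := fun x => (x, p)) (x := x)
      (hp x hx).fderiv.continuousAt (by fun_prop)).clm_comp continuousAt_const).continuousWithinAt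
  refine hasFDerivAt_integral_of_dominated_of_fderiv_le (s := {p | ∀ x ∈ K, AnalyticAt ℝ h (x, p) ∧
      ‖fderiv ℝ h (x, p)‖ ≤ C}) (bound := fun x => ‖g x‖ * (C * ‖ContinuousLinearMap.inr ℝ X P‖))
    (F' := fun p x => g x • (fderiv ℝ h (x, p)).comp (ContinuousLinearMap.inr ℝ X P))
    hC ?_ ?_ ?_ ?_ ?_ ?_
  · filter_upwards [hC] with p hp
    exact hg.aestronglyMeasurable.smul
      ((hcont p fun x hx => (hp x hx).1).aestronglyMeasurable hK.measurableSet)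
  · exact hg.smul_continuousOn (hcont p₀ hh) hK
  · exact hg.aestronglyMeasurable.smul
      ((hcont' p₀ hh).aestronglyMeasurable hK.measurableSet)
  · filter_upwards [ae_restrict_mem hK.measurableSet] with x hx p hp
    rw [norm_smul]
    gcongr
    refine (ContinuousLinearMap.opNorm_comp_le _ _).trans ?_
    gcongr
    exact (hp x hx).2
  · exact hg.norm.mul_const _
  · filter_upwards [ae_restrict_mem hK.measurableSet] with x hx p hp
    have h1 := (hp x hx).1.differentiableAt.hasFDerivAt
    have h2 : HasFDerivAt (fun p : P => (x, p)) (ContinuousLinearMap.inr ℝ X P) p :=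
      (hasFDerivAt_const x p).prodMk (hasFDerivAt_id p)
    exact (h1.comp p h2).const_smul (g x)

end ParametricIntegral

/-! ### Hadamard quotients: dividing analytically by κ. -/

section SlopeQuotient

variable {P F : Type*} [NormedAddCommGroup P] [NormedSpace ℝ P] [NormedAddCommGroup F]
  [NormedSpace ℝ F]

/-- Hadamard's quotient `(Z (p, κ) - Z (p, 0)) / κ`, as an integral. -/
def slopeQuotient (Z : P × ℝ → F) (q : P × ℝ) : F :=
  ∫ t in Icc (0 : ℝ) 1, fderiv ℝ Z (q.1, t * q.2) (0, 1)

/-- The integral form is what makes the quotient analytic across κ = 0. -/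
theorem analyticAt_slopeQuotient [CompleteSpace F] {Z : P × ℝ → F} {p₀ : P}
    (hZ : AnalyticAt ℝ Z (p₀, 0)) : AnalyticAt ℝ (slopeQuotient Z) (p₀, 0) := by
  have h := analyticAt_setIntegral_of_isCompact (ν := volume) (K := Icc (0 : ℝ) 1)
    (g := fun _ => 1) (h := fun x : ℝ × (P × ℝ) => fderiv ℝ Z (x.2.1, x.1 * x.2.2) (0, 1))
    (p₀ := (p₀, 0)) isCompact_Icc (by simp) fun t _ => by
      have h1 : AnalyticAt ℝ (fun x : ℝ × (P × ℝ) => fderiv ℝ Z (x.2.1, x.1 * x.2.2))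
          (t, (p₀, 0)) := by
        refine AnalyticAt.fun_comp (g := fderiv ℝ Z) (by simpa using hZ.fderiv) ?_
        exact (ContDiff.contDiffAt (n := ω) (by fun_prop)).analyticAt
      exact ((ContinuousLinearMap.apply ℝ F ((0 : P), (1 : ℝ))).analyticAt _).fun_comp h1
  simpa only [one_smul] using! h

theorem eventually_eq_add_smul_slopeQuotient [CompleteSpace F] {Z : P × ℝ → F} {p₀ : P}
    (hZ : AnalyticAt ℝ Z (p₀, 0)) :
    ∀ᶠ q : P × ℝ in 𝓝 (p₀, 0), Z q = Z (q.1, 0) + q.2 • slopeQuotient Z q := by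
  obtain ⟨r, hr, H⟩ := Metric.eventually_nhds_iff_ball.1 hZ.eventually_analyticAt
  filter_upwards [ball_mem_nhds _ hr] with q hq
  have hq' : ∀ t ∈ Icc (0 : ℝ) 1, (q.1, t * q.2) ∈ ball (p₀, (0 : ℝ)) r := by
    intro t ht
    rw [mem_ball, Prod.dist_eq, max_lt_iff] at hq ⊢
    refine ⟨hq.1, lt_of_le_of_lt ?_ hq.2⟩
    simp only [dist_zero_right, norm_mul, Real.norm_of_nonneg ht.1]
    exact mul_le_of_le_one_left (norm_nonneg _) ht.2
  have hd : ∀ t ∈ uIcc (0 : ℝ) 1, HasDerivAt (fun t : ℝ => Z (q.1, t * q.2))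
      (fderiv ℝ Z (q.1, t * q.2) (0, q.2)) t := by
    intro t ht
    rw [uIcc_of_le zero_le_one] at ht
    have h1 : HasDerivAt (fun t : ℝ => (q.1, t * q.2)) (0, q.2) t :=
      (hasDerivAt_const t q.1).prodMk (by simpa using (hasDerivAt_id t).mul_const q.2)
    exact (H _ (hq' t ht)).differentiableAt.hasFDerivAt.comp_hasDerivAt t h1
  have hc : ContinuousOn (fun t : ℝ => fderiv ℝ Z (q.1, t * q.2) (0, q.2)) (uIcc (0 : ℝ) 1) := by
    intro t ht
    rw [uIcc_of_le zero_le_one] at ht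
    exact ((ContinuousAt.comp (f := fun t : ℝ => (q.1, t * q.2)) (x := t)
      (H _ (hq' t ht)).fderiv.continuousAt (by fun_prop)).clm_apply
      continuousAt_const).continuousWithinAt
  have h := intervalIntegral.integral_eq_sub_of_hasDerivAt hd hc.intervalIntegrable
  rw [intervalIntegral.integral_of_le zero_le_one, ← integral_Icc_eq_integral_Ioc] at h
  simp only [one_mul, zero_mul] at h
  rw [slopeQuotient, ← integral_smul]
  have h2 (t : ℝ) : q.2 • fderiv ℝ Z (q.1, t * q.2) (0, 1)
      = fderiv ℝ Z (q.1, t * q.2) (0, q.2) := by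
    rw [← map_smul]; simp
  simp only [h2, h]
  abel

theorem slopeQuotient_zero [CompleteSpace F] (Z : P × ℝ → F) (p : P) :
    slopeQuotient Z (p, 0) = fderiv ℝ Z (p, 0) (0, 1) := by
  simp [slopeQuotient]

end SlopeQuotient

/-! ### Existence and analyticity of local flows. -/

section LocalFlow

open scoped unitInterval

variable {E : Type*} [NormedAddCommGroup E] [NormedSpace ℝ E]

/-- Constant functions, as a continuous linear map. -/
def constCLM (T E : Type*) [TopologicalSpace T] [CompactSpace T] [NormedAddCommGroup E]
    [NormedSpace ℝ E] : E →L[ℝ] C(T, E) :=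
  LinearMap.mkContinuous
    { toFun := fun p => ContinuousMap.const T p
      map_add' := fun p q => by ext; simp
      map_smul' := fun c p => by ext; simp } 1 fun p => by
        rw [one_mul]
        exact (ContinuousMap.norm_le _ (norm_nonneg p)).2 fun x => le_rfl

@[simp] theorem constCLM_apply {T : Type*} [TopologicalSpace T] [CompactSpace T] (p : E) :
    constCLM T E p = ContinuousMap.const T p := rfl

/-- The primitive vanishing at `0`, as an operator on continuous functions on `[0, 1]`. -/
def volterra (E : Type*) [NormedAddCommGroup E] [NormedSpace ℝ E] : C(I, E) →L[ℝ] C(I, E) :=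
  have hi (y : C(I, E)) (a b : ℝ) :
      IntervalIntegrable (fun s => y (projIcc 0 1 zero_le_one s)) volume a b :=
    (y.continuous.comp continuous_projIcc).intervalIntegrable a b
  LinearMap.mkContinuous
    { toFun := fun y => ⟨fun t => ∫ s in (0 : ℝ)..t, y (projIcc 0 1 zero_le_one s),
        (intervalIntegral.continuous_primitive (hi y) 0).comp continuous_subtype_val⟩
      map_add' := fun y z => by
        ext t
        exact intervalIntegral.integral_add (hi y 0 t) (hi z 0 t)
      map_smul' := fun c y => by
        ext t
        exact intervalIntegral.integral_smul c _ } 1 fun y => by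
        rw [one_mul]
        refine (ContinuousMap.norm_le _ (norm_nonneg y)).2 fun t => ?_
        refine (intervalIntegral.norm_integral_le_of_norm_le_const
          fun s _ => y.norm_coe_le_norm _).trans ?_
        rw [sub_zero, abs_of_nonneg t.2.1]
        exact mul_le_of_le_one_right (norm_nonneg y) t.2.2

theorem volterra_apply (y : C(I, E)) (t : I) :
    volterra E y t = ∫ s in (0 : ℝ)..t, y (projIcc 0 1 zero_le_one s) := rfl

/-- The curve `t ↦ y (s t)`. -/
def rescale (s : I) (y : C(I, E)) : C(I, E) := y.comp ⟨fun t => s * t, by fun_prop⟩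

omit [NormedSpace ℝ E] in
theorem rescale_apply (s : I) (y : C(I, E)) (t : I) : rescale s y t = y (s * t) := rfl

/-- Change of variables: if y solves the integral equation with time factor τ, its rescaling by s
solves it with time factor sτ. -/
theorem smul_volterra_rescale (s : I) (y : C(I, E)) (t : I) :
    (s : ℝ) • volterra E (rescale s y) t = volterra E y (s * t) := by
  rw [volterra_apply, volterra_apply]
  have h := intervalIntegral.smul_integral_comp_mul_left (a := 0) (b := (t : ℝ))
    (fun x => y (projIcc 0 1 zero_le_one x)) (s : ℝ)
  rw [mul_zero] at h
  rw [Set.Icc.coe_mul, ← h]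
  congr 1
  refine intervalIntegral.integral_congr fun x hx => ?_
  rw [uIcc_of_le t.2.1] at hx
  have hx1 : x ∈ Icc (0 : ℝ) 1 := ⟨hx.1, hx.2.trans t.2.2⟩
  have hx2 : (s : ℝ) * x ∈ Icc (0 : ℝ) 1 :=
    ⟨mul_nonneg s.2.1 hx1.1, mul_le_one₀ s.2.2 hx1.1 hx1.2⟩
  simp only [rescale_apply]
  rw [projIcc_of_mem _ hx1, projIcc_of_mem _ hx2]
  rfl

omit [NormedSpace ℝ E] in
theorem dist_rescale_const_le (s : I) (y : C(I, E)) (e : E) :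
    dist (rescale s y) (ContinuousMap.const I e) ≤ dist y (ContinuousMap.const I e) :=
  (ContinuousMap.dist_le dist_nonneg).2 fun t =>
    ContinuousMap.dist_apply_le_dist (f := y) (g := ContinuousMap.const I e) (s * t)

/-- An analytic vector field has a local flow, analytic in time and initial value. -/
theorem AnalyticAt.exists_local_flow [CompleteSpace E] {V : E → E} {p₀ : E}
    (hV : AnalyticAt ℝ V p₀) :
    ∃ ψ : E × ℝ → E, AnalyticAt ℝ ψ (p₀, 0) ∧ ∃ r > 0, ∀ p ∈ ball p₀ r, ψ (p, 0) = p ∧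
      ∀ t ∈ Ioo (-r) r, HasDerivAt (fun s => ψ (p, s)) (V (ψ (p, t))) t := by
  obtain ⟨r₀, hr₀, H⟩ := hV.exists_superposition
  obtain ⟨N, hN, hNV⟩ := H I
  set c := ContinuousMap.const I p₀ with hc
  have hNc : AnalyticAt ℝ N c := hN c (mem_ball_self hr₀)
  -- Zeros of `Ψ` are the curves y(t) = p + τ ∫₀ᵗ V(y), that is, integral curves of length τ
  -- reparametrised by [0, 1]. At τ = 0 the derivative in y is the identity, so the implicit
  -- function theorem applies.
  let Ψ : (E × ℝ) × C(I, E) → C(I, E) := fun v =>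
    v.2 - constCLM I E v.1.1 - v.1.2 • volterra E (N v.2)
  let u : (E × ℝ) × C(I, E) := ((p₀, 0), c)
  have hN' : ContDiffAt ℝ ω (fun v : (E × ℝ) × C(I, E) => N v.2) u :=
    ContDiffAt.comp u (g := N) hNc.contDiffAt contDiffAt_snd
  have hΨ : ContDiffAt ℝ ω Ψ u := by
    refine ContDiffAt.sub (contDiff_snd.sub
      ((constCLM I E).contDiff.comp (contDiff_fst.comp contDiff_fst))).contDiffAt
      (ContDiffAt.smul (contDiff_snd.comp contDiff_fst).contDiffAt ?_)
    exact (volterra E).contDiff.contDiffAt.comp u hN'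
  have hderiv : fderiv ℝ Ψ u ∘L .inr ℝ (E × ℝ) C(I, E) = .id ℝ _ := by
    have h1 : HasFDerivAt (fun y => Ψ ((p₀, 0), y)) (fderiv ℝ Ψ u ∘L .inr ℝ (E × ℝ) C(I, E)) c :=
      (hΨ.differentiableAt (by simp)).hasFDerivAt.comp c
        ((hasFDerivAt_const ((p₀, (0 : ℝ))) c).prodMk (hasFDerivAt_id c))
    have h2 : HasFDerivAt (fun y => Ψ ((p₀, 0), y)) (.id ℝ _) c := by
      have : (fun y => Ψ ((p₀, 0), y)) = fun y => y - constCLM I E p₀ := by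
        ext y; simp [Ψ]
      rw [this]
      exact (hasFDerivAt_id c).sub_const _
    exact h1.unique h2
  have hinv : (fderiv ℝ Ψ u ∘L .inr ℝ (E × ℝ) C(I, E)).IsInvertible :=
    ⟨ContinuousLinearEquiv.refl ℝ _, by rw [hderiv]; rfl⟩
  have hω : (ω : ℕ∞ω) ≠ 0 := by simp
  let Y : E × ℝ → C(I, E) := hΨ.implicitFunction hω hinv
  have hΨu : Ψ u = 0 := by
    ext t
    simp [Ψ, u, hc]
  have hY0 : Y (p₀, 0) = c := hΨ.implicitFunction_apply_self hω hinv
  have hY : ContDiffAt ℝ ω Y (p₀, 0) := hΨ.contDiffAt_implicitFunction hω hinv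
  have hsol : ∀ᶠ q in 𝓝 (p₀, (0 : ℝ)), Ψ (q, Y q) = 0 :=
    (hΨ.eventually_apply_implicitFunction hω hinv).mono fun q hq => hq.trans hΨu
  have huniq : ∀ᶠ v in 𝓝 u, Ψ v = 0 → Y v.1 = v.2 :=
    (hΨ.eventually_apply_eq_iff_implicitFunction hω hinv).mono fun v hv h =>
      hv.1 (h.trans hΨu.symm)
  obtain ⟨δ, hδ, hδu⟩ := Metric.eventually_nhds_iff_ball.1 huniq
  let ψ : E × ℝ → E := fun q => Y q 1
  have hψ : AnalyticAt ℝ ψ (p₀, 0) :=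
    ((ContinuousMap.evalCLM ℝ (1 : I)).analyticAt _).fun_comp hY.analyticAt
  have hψ0 : ψ (p₀, 0) = p₀ := by simp [ψ, hY0, hc]
  have hev : ∀ᶠ q in 𝓝 (p₀, (0 : ℝ)), Ψ (q, Y q) = 0 ∧ Y q ∈ ball c (min δ r₀) ∧
      AnalyticAt ℝ ψ q ∧ AnalyticAt ℝ V (ψ q) := by
    refine hsol.and ((hY.continuousAt.eventually_mem ?_).and
      (hψ.eventually_analyticAt.and (hψ.continuousAt.eventually (p := AnalyticAt ℝ V) ?_)))
    · rw [hY0]; exact ball_mem_nhds _ (lt_min hδ hr₀)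
    · rw [hψ0]; exact hV.eventually_analyticAt
  obtain ⟨r₁, hr₁, hev⟩ := Metric.eventually_nhds_iff_ball.1 hev
  have hmin : 0 < min r₁ δ := lt_min hr₁ hδ
  -- `ψ` only records the endpoint of the curve `Y q`. Local uniqueness identifies the rescaled
  -- curve with the solution for the shorter time, so the endpoints for varying time trace out the
  -- whole curve.
  have hscale : ∀ q ∈ ball (p₀, (0 : ℝ)) (min r₁ δ), ∀ s : I, ψ (q.1, s * q.2) = Y q s := by
    intro q hq s
    obtain ⟨h1, h2, -, -⟩ := hev q (ball_subset_ball (min_le_left _ _) hq)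
    have hqδ := ball_subset_ball (min_le_right _ _) hq
    have hb : rescale s (Y q) ∈ ball c (min δ r₀) :=
      lt_of_le_of_lt (dist_rescale_const_le s (Y q) p₀) h2
    have hv : ((q.1, (s : ℝ) * q.2), rescale s (Y q)) ∈ ball u δ := by
      rw [mem_ball, Prod.dist_eq, max_lt_iff] at hqδ ⊢
      refine ⟨?_, ball_subset_ball (min_le_left _ _) hb⟩
      rw [Prod.dist_eq, max_lt_iff]
      refine ⟨hqδ.1, lt_of_le_of_lt ?_ hqδ.2⟩
      simp only [u, dist_zero_right, norm_mul, Real.norm_of_nonneg s.2.1]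
      exact mul_le_of_le_one_left (norm_nonneg _) s.2.2
    have hNr : N (rescale s (Y q)) = rescale s (N (Y q)) := by
      ext t
      rw [hNV _ (ball_subset_ball (min_le_right _ _) hb), rescale_apply, rescale_apply,
        hNV _ (ball_subset_ball (min_le_right _ _) h2)]
    have hz : Ψ ((q.1, (s : ℝ) * q.2), rescale s (Y q)) = 0 := by
      ext t
      have h3 := DFunLike.congr_fun h1 (s * t)
      simp only [Ψ, ContinuousMap.sub_apply, ContinuousMap.smul_apply, constCLM_apply,
        ContinuousMap.const_apply, ContinuousMap.zero_apply] at h3 ⊢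
      rw [hNr, rescale_apply, mul_comm (s : ℝ), mul_smul, smul_volterra_rescale, h3]
    have := hδu _ hv hz
    simp only [ψ]
    rw [this, rescale_apply, mul_one]
  have hint : ∀ q ∈ ball (p₀, (0 : ℝ)) (min r₁ δ),
      ψ q = q.1 + ∫ t in (0 : ℝ)..q.2, V (ψ (q.1, t)) := by
    intro q hq
    obtain ⟨h1, h2, -, -⟩ := hev q (ball_subset_ball (min_le_left _ _) hq)
    have h3 := DFunLike.congr_fun h1 1
    simp only [Ψ, ContinuousMap.sub_apply, ContinuousMap.smul_apply, constCLM_apply,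
        ContinuousMap.const_apply, ContinuousMap.zero_apply, volterra_apply] at h3
    have h4 := intervalIntegral.smul_integral_comp_mul_right (a := 0) (b := 1)
      (fun t => V (ψ (q.1, t))) q.2
    rw [zero_mul, one_mul] at h4
    rw [← h4]
    have h5 : ∫ x in (0 : ℝ)..1, V (ψ (q.1, x * q.2))
        = ∫ s in (0 : ℝ)..(1 : I), N (Y q) (projIcc 0 1 zero_le_one s) := by
      rw [Set.Icc.coe_one]
      refine intervalIntegral.integral_congr fun x hx => ?_
      rw [uIcc_of_le zero_le_one] at hx
      rw [projIcc_of_mem _ hx, hNV _ (ball_subset_ball (min_le_right _ _) h2),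
        ← hscale q hq ⟨x, hx⟩]
    rw [h5]
    rw [sub_sub, sub_eq_zero] at h3
    exact h3
  refine ⟨ψ, hψ, min r₁ δ, hmin, fun p hp => ?_⟩
  have hmem : ∀ t ∈ Ioo (-(min r₁ δ)) (min r₁ δ), (p, t) ∈ ball (p₀, (0 : ℝ)) (min r₁ δ) := by
    intro t ht
    rw [mem_ball, Prod.dist_eq, max_lt_iff]
    exact ⟨hp, by rwa [dist_zero_right, Real.norm_eq_abs, abs_lt]⟩
  refine ⟨?_, fun t ht => ?_⟩
  · rw [hint _ (hmem 0 ⟨by linarith, hmin⟩)]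
    simp
  have hcont : ContinuousOn (fun s => V (ψ (p, s))) (Ioo (-(min r₁ δ)) (min r₁ δ)) := by
    intro s hs
    obtain ⟨-, -, h3, h4⟩ := hev _ (ball_subset_ball (min_le_left _ _) (hmem s hs))
    exact (ContinuousAt.comp (f := fun s => ψ (p, s)) h4.continuousAt
      (ContinuousAt.comp (f := fun s => (p, s)) h3.continuousAt
        (by fun_prop))).continuousWithinAt
  have hsub : uIcc 0 t ⊆ Ioo (-(min r₁ δ)) (min r₁ δ) :=
    ordConnected_Ioo.uIcc_subset ⟨by linarith, hmin⟩ ht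
  have h1 := intervalIntegral.integral_hasDerivAt_right
    (hcont.mono hsub).intervalIntegrable
    (hcont.stronglyMeasurableAtFilter isOpen_Ioo t ht)
    (hcont.continuousAt (Ioo_mem_nhds ht.1 ht.2))
  refine (h1.const_add p).congr_of_eventuallyEq ?_
  filter_upwards [Ioo_mem_nhds ht.1 ht.2] with s hs
  exact hint _ (hmem s hs)

end LocalFlow

/-! ### Derivative of the determinant. -/

section Determinant

variable {E : Type*} [NormedAddCommGroup E] [NormedSpace ℝ E] [FiniteDimensional ℝ E]

/-- The trace, as a continuous linear functional. -/
def traceCLM (E : Type*) [NormedAddCommGroup E] [NormedSpace ℝ E] [FiniteDimensional ℝ E] :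
    (E →L[ℝ] E) →L[ℝ] ℝ :=
  LinearMap.toContinuousLinearMap ((LinearMap.trace ℝ E).comp (ContinuousLinearMap.coeLM ℝ))

theorem traceCLM_apply (A : E →L[ℝ] E) : traceCLM E A = LinearMap.trace ℝ E (A : E →ₗ[ℝ] E) := rfl

theorem contDiff_det {n : ℕ∞ω} : ContDiff ℝ n (fun A : E →L[ℝ] E => A.det) := by
  let b := Module.finBasis ℝ E
  have h (A : E →L[ℝ] E) : A.det = (LinearMap.toMatrix b b (A : E →ₗ[ℝ] E)).det :=
    (LinearMap.det_toMatrix b _).symm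
  simp only [h, Matrix.det_apply]
  refine ContDiff.sum fun σ _ => ContDiff.const_smul _ (contDiff_prod fun i _ => ?_)
  let e : (E →L[ℝ] E) →ₗ[ℝ] ℝ :=
    { toFun := fun A => LinearMap.toMatrix b b (A : E →ₗ[ℝ] E) (σ i) i
      map_add' := fun A B => by simp
      map_smul' := fun c A => by simp }
  exact (LinearMap.toContinuousLinearMap e).contDiff

/-- The determinant is polynomial, hence strictly differentiable. Its derivative is read off along
lines from det(1 + tM) = 1 + t tr M + O(t²). -/
theorem hasStrictFDerivAt_det_id :
    HasStrictFDerivAt (fun A : E →L[ℝ] E => A.det) (traceCLM E) (.id ℝ E) := by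
  have h := (contDiff_det (E := E) (n := 1)).contDiffAt.hasStrictFDerivAt (x := .id ℝ E)
    one_ne_zero
  suffices H : traceCLM E = fderiv ℝ (fun A : E →L[ℝ] E => A.det) (.id ℝ E) by rwa [H]
  refine DFunLike.ext _ _ fun A => ?_
  have h1 : HasDerivAt (fun t : ℝ => (ContinuousLinearMap.id ℝ E + t • A).det)
      (fderiv ℝ (fun A : E →L[ℝ] E => A.det) (.id ℝ E) A) 0 := by
    have h2 : HasDerivAt (fun t : ℝ => ContinuousLinearMap.id ℝ E + t • A) A 0 := by
      simpa using ((hasDerivAt_id (0 : ℝ)).smul_const A).const_add (ContinuousLinearMap.id ℝ E)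
    have h3 := h.hasFDerivAt
    rw [show ContinuousLinearMap.id ℝ E = ContinuousLinearMap.id ℝ E + (0 : ℝ) • A by simp] at h3
    simpa using! h3.comp_hasDerivAt (0 : ℝ) h2
  let b := Module.finBasis ℝ E
  let M := LinearMap.toMatrix b b (A : E →ₗ[ℝ] E)
  have h4 (t : ℝ) : (ContinuousLinearMap.id ℝ E + t • A).det = (1 + t • M).det := by
    rw [ContinuousLinearMap.det, ← LinearMap.det_toMatrix b]
    congr 1
    simp [M]
  have h5 : HasDerivAt (fun t : ℝ => (1 + t • M).det) M.trace 0 := by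
    rw [funext fun t : ℝ => Matrix.det_one_add_smul t M]
    set q := ((1 + (Polynomial.X : Polynomial ℝ) • M.map Polynomial.C).det.divX.divX)
    have h6 := (((hasDerivAt_id (0 : ℝ)).const_mul M.trace).const_add 1).add
      ((q.hasDerivAt (0 : ℝ)).mul ((hasDerivAt_id (0 : ℝ)).pow 2))
    simpa using! h6
  simp only [h4] at h1
  rw [traceCLM_apply, LinearMap.trace_eq_matrix_trace ℝ b]
  exact h5.unique h1

/-- Factoring A(s) = (A(s) A(t)⁻¹) A(t) moves the computation to the identity. -/
theorem HasDerivAt.clm_det {A : ℝ → E →L[ℝ] E} {B : E →L[ℝ] E} {t : ℝ}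
    (hA : HasDerivAt A (B.comp (A t)) t) (h0 : (A t).det ≠ 0) :
    HasDerivAt (fun s => (A s).det) (traceCLM E B * (A t).det) t := by
  let e : E ≃L[ℝ] E := (A t).toContinuousLinearEquivOfDetNeZero h0
  have he : (e : E →L[ℝ] E) = A t := by ext; simp [e]
  have h1 : HasDerivAt (fun s => (A s).comp (e.symm : E →L[ℝ] E)) B t := by
    have := hA.clm_comp (hasDerivAt_const t (e.symm : E →L[ℝ] E))
    convert this using 1
    rw [ContinuousLinearMap.comp_assoc, ← he]
    ext; simp
  have hid : (A t).comp (e.symm : E →L[ℝ] E) = .id ℝ E := by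
    rw [← he]; ext; simp
  have h2 := (hid ▸ hasStrictFDerivAt_det_id (E := E).hasFDerivAt).comp_hasDerivAt t h1
  have h3 := h2.mul_const (A t).det
  refine h3.congr_of_eventuallyEq (Eventually.of_forall fun s => ?_)
  have : A s = ((A s).comp (e.symm : E →L[ℝ] E)).comp (A t) := by
    rw [← he]; ext; simp
  exact (congrArg ContinuousLinearMap.det this).trans (LinearMap.det_comp _ _)

end Determinant

/-! ### Flows on open sets and Liouville's theorem. -/

section Flow

variable {E : Type*} [NormedAddCommGroup E] [NormedSpace ℝ E] {V : E → E} {Ω : Set E} {p p₀ x y : E}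
  {ε : ℝ}

/-- An integral curve of `V` in `Ω` leads from `p` to `x` in time `ε`. -/
def FlowsTo (V : E → E) (Ω : Set E) (p : E) (ε : ℝ) (x : E) : Prop :=
  ∃ γ : ℝ → E, γ 0 = p ∧ γ ε = x ∧ ∀ t ∈ uIcc 0 ε, γ t ∈ Ω ∧ HasDerivAt γ (V (γ t)) t

theorem FlowsTo.mem_right (h : FlowsTo V Ω p ε x) : x ∈ Ω := by
  obtain ⟨γ, -, rfl, h⟩ := h
  exact (h ε right_mem_uIcc).1

theorem FlowsTo.symm (h : FlowsTo V Ω p ε x) : FlowsTo V Ω x (-ε) p := by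
  obtain ⟨γ, h0, h1, h⟩ := h
  refine ⟨fun t => γ (t + ε), by simp [h1], by simp [h0], fun t ht => ?_⟩
  have ht' : t + ε ∈ uIcc 0 ε := by
    have := (mem_image_of_mem (· + ε) ht)
    rw [image_add_const_uIcc] at this
    simpa [uIcc_comm] using this
  obtain ⟨h2, h3⟩ := h _ ht'
  exact ⟨h2, by simpa using h3.comp_add_const t ε⟩

theorem FlowsTo.add (h : FlowsTo V Ω p ε x) {v : E} (hΩ : ∀ q ∈ Ω, q + v ∈ Ω)
    (hV : ∀ q, V (q + v) = V q) : FlowsTo V Ω (p + v) ε (x + v) := by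
  obtain ⟨γ, h0, h1, h⟩ := h
  refine ⟨fun t => γ t + v, by simp [h0], by simp [h1], fun t ht => ⟨hΩ _ (h t ht).1, ?_⟩⟩
  rw [hV]
  exact (h t ht).2.add_const v

variable [CompleteSpace E]

/-- The two curves together form a compact set on which the locally Lipschitz field is Lipschitz, so
uniqueness for ODEs applies, forwards or backwards according to the sign of ε. -/
theorem FlowsTo.unique (hV : AnalyticOnNhd ℝ V Ω) (h : FlowsTo V Ω p ε x)
    (h' : FlowsTo V Ω p ε y) : x = y := by
  obtain ⟨γ, h0, h1, h⟩ := h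
  obtain ⟨γ', h0', h1', h'⟩ := h'
  have hc : ContinuousOn γ (uIcc 0 ε) := fun t ht => (h t ht).2.continuousAt.continuousWithinAt
  have hc' : ContinuousOn γ' (uIcc 0 ε) := fun t ht => (h' t ht).2.continuousAt.continuousWithinAt
  set K := γ '' uIcc 0 ε ∪ γ' '' uIcc 0 ε
  have hK : IsCompact K := (isCompact_uIcc.image_of_continuousOn hc).union
    (isCompact_uIcc.image_of_continuousOn hc')
  have hL : LocallyLipschitzOn K V := by
    intro q hq
    have hqΩ : q ∈ Ω := by
      rcases hq with ⟨t, ht, rfl⟩ | ⟨t, ht, rfl⟩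
      exacts [(h t ht).1, (h' t ht).1]
    obtain ⟨C, s, hs, H⟩ := ((hV q hqΩ).contDiffAt (n := 1)).exists_lipschitzOnWith
    exact ⟨C, s, mem_nhdsWithin_of_mem_nhds hs, H⟩
  obtain ⟨C, hC⟩ := hL.exists_lipschitzOnWith_of_compact hK
  have e1 : ∀ t ∈ uIcc 0 ε, γ t ∈ K := fun t ht => Or.inl (mem_image_of_mem _ ht)
  have e2 : ∀ t ∈ uIcc 0 ε, γ' t ∈ K := fun t ht => Or.inr (mem_image_of_mem _ ht)
  rw [← h1, ← h1']
  rcases le_total 0 ε with hε | hε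
  · rw [uIcc_of_le hε] at *
    exact ODE_solution_unique_of_mem_Icc_right (v := fun _ => V) (s := fun _ => K) (K := C)
      (fun _ _ => hC) hc (fun t ht => (h t (Ico_subset_Icc_self ht)).2.hasDerivWithinAt)
      (fun t ht => e1 t (Ico_subset_Icc_self ht)) hc'
      (fun t ht => (h' t (Ico_subset_Icc_self ht)).2.hasDerivWithinAt)
      (fun t ht => e2 t (Ico_subset_Icc_self ht)) (h0.trans h0'.symm) ⟨hε, le_rfl⟩
  · rw [uIcc_of_ge hε] at *
    exact ODE_solution_unique_of_mem_Icc_left (v := fun _ => V) (s := fun _ => K) (K := C)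
      (fun _ _ => hC) hc (fun t ht => (h t (Ioc_subset_Icc_self ht)).2.hasDerivWithinAt)
      (fun t ht => e1 t (Ioc_subset_Icc_self ht)) hc'
      (fun t ht => (h' t (Ioc_subset_Icc_self ht)).2.hasDerivWithinAt)
      (fun t ht => e2 t (Ioc_subset_Icc_self ht)) (h0.trans h0'.symm) ⟨le_rfl, hε⟩

open Classical in
/-- The flow of `V` in `Ω`, extended by the identity where it is undefined. -/
def flowMap (V : E → E) (Ω : Set E) (q : E × ℝ) : E :=
  if h : ∃ x, FlowsTo V Ω q.1 q.2 x then h.choose else q.1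

theorem flowMap_eq (hV : AnalyticOnNhd ℝ V Ω) (h : FlowsTo V Ω p ε x) : flowMap V Ω (p, ε) = x := by
  have hx : ∃ x, FlowsTo V Ω (p, ε).1 (p, ε).2 x := ⟨x, h⟩
  rw [flowMap, dif_pos hx]
  exact hx.choose_spec.unique hV h

omit [CompleteSpace E] in
theorem flowMap_zero (V : E → E) (Ω : Set E) (p : E) : flowMap V Ω (p, 0) = p := by
  rw [flowMap]
  split_ifs with h
  · obtain ⟨γ, h0, h1, -⟩ := h.choose_spec
    exact h1.symm.trans h0
  · rfl

/-- Translation carries integral curves to integral curves in both directions, so both sides take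
the default value together. The identity thus holds at every point, as the exact periodicity
required later demands. -/
theorem flowMap_add (hV : AnalyticOnNhd ℝ V Ω) {v : E} (hΩ : ∀ q, q + v ∈ Ω ↔ q ∈ Ω)
    (hVv : ∀ q, V (q + v) = V q) (p : E) (ε : ℝ) :
    flowMap V Ω (p + v, ε) = flowMap V Ω (p, ε) + v := by
  by_cases h : ∃ x, FlowsTo V Ω p ε x
  · obtain ⟨x, hx⟩ := h
    rw [flowMap_eq hV hx, flowMap_eq hV (hx.add (fun q hq => (hΩ q).2 hq) hVv)]
  · have h' : ¬ ∃ x, FlowsTo V Ω (p + v) ε x := by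
      rintro ⟨x, hx⟩
      refine h ⟨x + -v, ?_⟩
      have := hx.add (v := -v) (fun q hq => (hΩ _).1 (by simpa using hq))
        (fun q => by rw [← hVv]; simp)
      simpa using this
    rw [flowMap, flowMap, dif_neg h, dif_neg h']

theorem flowMap_flowMap_neg (hV : AnalyticOnNhd ℝ V Ω) (h : FlowsTo V Ω p ε x) :
    flowMap V Ω (flowMap V Ω (p, ε), -ε) = p := by
  rw [flowMap_eq hV h, flowMap_eq hV h.symm]

/-- By uniqueness `flowMap` agrees near (p₀, 0) with the analytic local flow, whose curves stay in
`Ω` for short times. -/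
theorem flowMap_local (hΩ : IsOpen Ω) (hV : AnalyticOnNhd ℝ V Ω) (hp₀ : p₀ ∈ Ω) :
    AnalyticAt ℝ (flowMap V Ω) (p₀, 0) ∧ ∀ᶠ q : E × ℝ in 𝓝 (p₀, 0),
      FlowsTo V Ω q.1 q.2 (flowMap V Ω q) ∧
      HasDerivAt (fun s => flowMap V Ω (q.1, s)) (V (flowMap V Ω q)) q.2 := by
  obtain ⟨ψ, hψ, r, hr, H⟩ := (hV p₀ hp₀).exists_local_flow
  have hψ0 : ψ (p₀, 0) = p₀ := (H p₀ (mem_ball_self hr)).1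
  have hmem : ∀ᶠ q in 𝓝 (p₀, (0 : ℝ)), ψ q ∈ Ω :=
    hψ.continuousAt.eventually_mem (hΩ.mem_nhds (by rwa [hψ0]))
  obtain ⟨r', hr', H'⟩ := Metric.eventually_nhds_iff_ball.1 hmem
  have hF : ∀ᶠ q : E × ℝ in 𝓝 (p₀, 0), FlowsTo V Ω q.1 q.2 (ψ q) ∧
      HasDerivAt (fun s => ψ (q.1, s)) (V (ψ q)) q.2 := by
    filter_upwards [ball_mem_nhds _ (lt_min hr hr')] with q hq
    rw [mem_ball, Prod.dist_eq, max_lt_iff, dist_zero_right, Real.norm_eq_abs] at hq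
    obtain ⟨hq1, hq2⟩ := hq
    have hq1' := hq1.trans_le (min_le_left _ _)
    have hd : ∀ t : ℝ, |t| ≤ |q.2| → HasDerivAt (fun s => ψ (q.1, s)) (V (ψ (q.1, t))) t :=
      fun t ht => (H q.1 hq1').2 t (abs_lt.1 (ht.trans_lt (hq2.trans_le (min_le_left _ _))))
    refine ⟨⟨fun s => ψ (q.1, s), (H q.1 hq1').1, rfl, fun t ht => ?_⟩, hd _ le_rfl⟩
    have ht' : |t| ≤ |q.2| := by simpa using abs_sub_left_of_mem_uIcc ht
    refine ⟨H' _ ?_, hd t ht'⟩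
    rw [mem_ball, Prod.dist_eq, max_lt_iff, dist_zero_right, Real.norm_eq_abs]
    exact ⟨hq1.trans_le (min_le_right _ _), ht'.trans_lt (hq2.trans_le (min_le_right _ _))⟩
  have heq : flowMap V Ω =ᶠ[𝓝 (p₀, 0)] ψ := hF.mono fun q hq => flowMap_eq hV hq.1
  refine ⟨hψ.congr heq.symm, ?_⟩
  filter_upwards [hF, heq.eventuallyEq_nhds] with q hq hq'
  rw [hq'.eq_of_nhds]
  refine ⟨hq.1, hq.2.congr_of_eventuallyEq ?_⟩
  exact (Continuous.tendsto' (f := fun s => (q.1, s)) (by fun_prop) q.2 q rfl).eventually hq'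

theorem fderiv_flowMap_zero (hΩ : IsOpen Ω) (hV : AnalyticOnNhd ℝ V Ω) (hp₀ : p₀ ∈ Ω) :
    fderiv ℝ (flowMap V Ω) (p₀, 0) (0, 1) = V p₀ := by
  obtain ⟨h1, h2⟩ := flowMap_local hΩ hV hp₀
  have h3 := h2.self_of_nhds.2
  have h4 : HasDerivAt (fun s : ℝ => (p₀, s)) (0, 1) 0 :=
    (hasDerivAt_const 0 p₀).prodMk (hasDerivAt_id 0)
  have h5 := HasFDerivAt.comp_hasDerivAt (0 : ℝ) h1.differentiableAt.hasFDerivAt h4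
  rw [flowMap_zero] at h3
  exact h5.unique h3

omit [CompleteSpace E] in
theorem hasFDerivAt_comp_prodMk_left {q : E × ℝ} {F : Type*} [NormedAddCommGroup F] [NormedSpace ℝ F]
    {f : E × ℝ → F} (h : DifferentiableAt ℝ f q) :
    HasFDerivAt (fun p => f (p, q.2)) ((fderiv ℝ f q).comp (.inl ℝ E ℝ)) q.1 :=
  HasFDerivAt.comp (g := f) q.1 h.hasFDerivAt
    ((hasFDerivAt_id q.1).prodMk (hasFDerivAt_const q.2 q.1))

/-- Liouville's theorem: the flow of a divergence-free field is volume-preserving. -/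
theorem eventually_det_fderiv_flowMap [FiniteDimensional ℝ E] (hΩ : IsOpen Ω)
    (hV : AnalyticOnNhd ℝ V Ω) (hp₀ : p₀ ∈ Ω) (htr : ∀ p ∈ Ω, traceCLM E (fderiv ℝ V p) = 0) :
    ∀ᶠ q : E × ℝ in 𝓝 (p₀, 0), (fderiv ℝ (fun p => flowMap V Ω (p, q.2)) q.1).det = 1 := by
  obtain ⟨h1, h2⟩ := flowMap_local hΩ hV hp₀
  set φ := flowMap V Ω
  let A : E × ℝ → E →L[ℝ] E := fun q => (fderiv ℝ φ q).comp (.inl ℝ E ℝ)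
  have hA0 : ∀ p ∈ Ω, A (p, 0) = .id ℝ E := by
    intro p hp
    have h3 := hasFDerivAt_comp_prodMk_left (flowMap_local hΩ hV hp).1.differentiableAt
    simp only [flowMap_zero] at h3
    exact h3.unique (hasFDerivAt_id p)
  have hAdet : ContinuousAt (fun q => (A q).det) (p₀, 0) :=
    (contDiff_det (n := 0)).continuous.continuousAt.comp
      (h1.fderiv.continuousAt.clm_comp continuousAt_const)
  have hdet1 : (ContinuousLinearMap.id ℝ E).det = 1 := LinearMap.det_id
  have hne : ∀ᶠ q in 𝓝 (p₀, (0 : ℝ)), (A q).det ≠ 0 := by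
    refine hAdet.eventually_ne ?_
    rw [hA0 p₀ hp₀, hdet1]
    exact one_ne_zero
  have hΩ' : ∀ᶠ q : E × ℝ in 𝓝 (p₀, 0), q.1 ∈ Ω :=
    continuousAt_fst.eventually_mem (hΩ.mem_nhds hp₀)
  obtain ⟨r, hr, H⟩ := Metric.eventually_nhds_iff_ball.1
    (h1.eventually_analyticAt.and (h2.and (hne.and hΩ')))
  filter_upwards [ball_mem_nhds _ hr] with q hq
  obtain ⟨hq1, hq2, hq3, hq4⟩ := H q hq
  rw [(hasFDerivAt_comp_prodMk_left hq1.differentiableAt).fderiv]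
  rw [mem_ball, Prod.dist_eq, max_lt_iff, dist_zero_right, Real.norm_eq_abs, abs_lt] at hq
  have hmem : ∀ t ∈ Ioo (-r) r, (q.1, t) ∈ ball (p₀, (0 : ℝ)) r := by
    intro t ht
    rw [mem_ball, Prod.dist_eq, max_lt_iff, dist_zero_right, Real.norm_eq_abs, abs_lt]
    exact ⟨hq.1, ht⟩
  have hd : ∀ t ∈ Ioo (-r) r, HasDerivAt (fun s => (A (q.1, s)).det) 0 t := by
    intro t ht
    obtain ⟨k1, k2, k3, -⟩ := H _ (hmem t ht)
    have hVd := (hV _ k2.1.mem_right).differentiableAt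
    have e1 : (fun q' => fderiv ℝ φ q' (0, 1)) =ᶠ[𝓝 (q.1, t)] fun q' => V (φ q') := by
      filter_upwards [isOpen_ball.mem_nhds (hmem t ht)] with q' hq'
      obtain ⟨m1, m2, -, -⟩ := H q' hq'
      have m3 : HasDerivAt (fun s => φ (q'.1, s)) (fderiv ℝ φ q' (0, 1)) q'.2 :=
        (show HasFDerivAt φ (fderiv ℝ φ q') (q'.1, q'.2) from
          m1.differentiableAt.hasFDerivAt).comp_hasDerivAt q'.2
            ((hasDerivAt_const q'.2 q'.1).prodMk (hasDerivAt_id' q'.2))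
      exact m3.unique m2.2
    have e2 : HasFDerivAt (fun q' => V (φ q'))
        ((fderiv ℝ V (φ (q.1, t))).comp (fderiv ℝ φ (q.1, t))) (q.1, t) :=
      hVd.hasFDerivAt.comp (q.1, t) k1.differentiableAt.hasFDerivAt
    have e3 := k1.fderiv.differentiableAt.hasFDerivAt
    have e4 := (e3.clm_apply (hasFDerivAt_const ((0 : E), (1 : ℝ)) (q.1, t))).unique
      (e2.congr_of_eventuallyEq e1)
    have hsymm : IsSymmSndFDerivAt ℝ φ (q.1, t) :=
      (k1.contDiffAt (n := 2)).isSymmSndFDerivAt (by simp)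
    -- Differentiating ∂ₜφ = V ∘ φ in space and exchanging derivatives gives the variational
    -- equation A' = DV(φ) A. Hence (det A)' = tr DV(φ) · det A = 0.
    have hA : HasDerivAt (fun s => A (q.1, s))
        ((fderiv ℝ V (φ (q.1, t))).comp (A (q.1, t))) t := by
      have e5 : HasDerivAt (fun s => fderiv ℝ φ (q.1, s))
          (fderiv ℝ (fderiv ℝ φ) (q.1, t) (0, 1)) t :=
        e3.comp_hasDerivAt t ((hasDerivAt_const t q.1).prodMk (hasDerivAt_id' t))
      convert e5.clm_comp (hasDerivAt_const t (ContinuousLinearMap.inl ℝ E ℝ)) using 1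
      ext v
      have e6 := DFunLike.congr_fun e4 (v, 0)
      simp only [ContinuousLinearMap.comp_apply, ContinuousLinearMap.comp_zero, zero_add, add_zero,
        ContinuousLinearMap.flip_apply, ContinuousLinearMap.inl_apply, A] at e6 ⊢
      rw [← e6]
      exact hsymm.eq _ _
    have := hA.clm_det k3
    rwa [htr _ k2.1.mem_right, zero_mul] at this
  have hconst := isOpen_Ioo.is_const_of_deriv_eq_zero isPreconnected_Ioo
    (fun t ht => (hd t ht).differentiableAt.differentiableWithinAt)
    (fun t ht => (hd t ht).deriv) hq.2 (show (0 : ℝ) ∈ Ioo (-r) r from ⟨by linarith, hr⟩)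
  have hfin : (A q).det = (A (q.1, 0)).det := hconst
  rw [hA0 _ hq4, hdet1] at hfin
  exact hfin

end Flow

/-! ### Laplacians in a chosen family of directions. -/

section AxisLaplacian

variable {ι E F G : Type*} [Fintype ι] [NormedAddCommGroup E] [NormedSpace ℝ E]
  [NormedAddCommGroup F] [NormedSpace ℝ F] [NormedAddCommGroup G] [NormedSpace ℝ G]
  {Ω : Set E} {X Y : E → F}

theorem lineDeriv_eqOn_fderiv (hX : AnalyticOnNhd ℝ X Ω) (v : E) :
    EqOn (fun q => lineDeriv ℝ X q v) (fun q => fderiv ℝ X q v) Ω :=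
  fun q hq => (hX q hq).differentiableAt.lineDeriv_eq_fderiv

theorem lineDeriv_eqOn (hΩ : IsOpen Ω) (h : EqOn X Y Ω) (v : E) :
    EqOn (fun q => lineDeriv ℝ X q v) (fun q => lineDeriv ℝ Y q v) Ω := fun q hq => by
  have hq' : X =ᶠ[𝓝 q] Y := eventually_of_mem (hΩ.mem_nhds hq) fun _ hx => h hx
  exact hq'.lineDeriv_eq

theorem AnalyticOnNhd.lineDeriv [CompleteSpace F] (hΩ : IsOpen Ω) (hX : AnalyticOnNhd ℝ X Ω)
    (v : E) : AnalyticOnNhd ℝ (fun q => lineDeriv ℝ X q v) Ω := by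
  have h : AnalyticOnNhd ℝ (fun q => fderiv ℝ X q v) Ω := fun q hq =>
    ((ContinuousLinearMap.apply ℝ F v).analyticAt _).fun_comp (hX q hq).fderiv
  exact h.congr hΩ (lineDeriv_eqOn_fderiv hX v).symm

theorem lineDeriv_clm_comp (hX : AnalyticOnNhd ℝ X Ω) (L : F →L[ℝ] G) (v : E) :
    EqOn (fun q => lineDeriv ℝ (fun x => L (X x)) q v) (fun q => L (lineDeriv ℝ X q v)) Ω := by
  intro q hq
  have h1 := (hX q hq).differentiableAt
  have h2 : HasFDerivAt (fun x => L (X x)) (L.comp (fderiv ℝ X q)) q :=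
    L.hasFDerivAt.comp q h1.hasFDerivAt
  simp only [h1.lineDeriv_eq_fderiv, h2.differentiableAt.lineDeriv_eq_fderiv, h2.fderiv]
  rfl

/-- No differentiability is needed: a line derivative sees only the values along the line. -/
theorem lineDeriv_add_right {v w : E} (h : ∀ q, X (q + v) = X q) (q : E) :
    lineDeriv ℝ X (q + v) w = lineDeriv ℝ X q w := by
  simp only [_root_.lineDeriv]
  congr 1
  ext t
  rw [add_right_comm, h]

/-- The sum of the second derivatives in the directions `e i`. -/
def axisLaplacian (e : ι → E) (X : E → F) (p : E) : F :=
  ∑ i, lineDeriv ℝ (fun q => lineDeriv ℝ X q (e i)) p (e i)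

variable (e : ι → E)

theorem axisLaplacian_eqOn (hΩ : IsOpen Ω) (h : EqOn X Y Ω) :
    EqOn (axisLaplacian e X) (axisLaplacian e Y) Ω := fun _ hq =>
  Finset.sum_congr rfl fun i _ => lineDeriv_eqOn hΩ (lineDeriv_eqOn hΩ h (e i)) (e i) hq

theorem AnalyticOnNhd.axisLaplacian [CompleteSpace F] (hΩ : IsOpen Ω) (hX : AnalyticOnNhd ℝ X Ω) :
    AnalyticOnNhd ℝ (axisLaplacian e X) Ω :=
  fun q hq => Finset.analyticAt_fun_sum _ fun i _ =>
    (hX.lineDeriv hΩ (e i)).lineDeriv hΩ (e i) q hq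

theorem AnalyticOnNhd.axisLaplacian_iterate [CompleteSpace F] (hΩ : IsOpen Ω)
    (hX : AnalyticOnNhd ℝ X Ω) (r : ℕ) : AnalyticOnNhd ℝ ((_root_.axisLaplacian e)^[r] X) Ω := by
  induction r with
  | zero => exact hX
  | succ r ih =>
    simp only [Function.iterate_succ_apply']
    exact ih.axisLaplacian e hΩ

theorem axisLaplacian_clm_comp [CompleteSpace F] (hΩ : IsOpen Ω) (hX : AnalyticOnNhd ℝ X Ω)
    (L : F →L[ℝ] G) :
    EqOn (axisLaplacian e fun x => L (X x)) (fun q => L (axisLaplacian e X q)) Ω := by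
  intro q hq
  simp only [axisLaplacian, map_sum]
  refine Finset.sum_congr rfl fun i _ => ?_
  exact (lineDeriv_eqOn hΩ (lineDeriv_clm_comp hX L (e i)) (e i) hq).trans
    (lineDeriv_clm_comp (hX.lineDeriv hΩ (e i)) L (e i) hq)

theorem axisLaplacian_iterate_clm_comp [CompleteSpace F] (hΩ : IsOpen Ω)
    (hX : AnalyticOnNhd ℝ X Ω) (L : F →L[ℝ] G) (r : ℕ) :
    EqOn ((axisLaplacian e)^[r] fun x => L (X x)) (fun q => L ((axisLaplacian e)^[r] X q)) Ω := by
  induction r with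
  | zero => exact fun _ _ => rfl
  | succ r ih =>
    simp only [Function.iterate_succ_apply']
    exact (axisLaplacian_eqOn e hΩ ih).trans
      (axisLaplacian_clm_comp e hΩ (hX.axisLaplacian_iterate e hΩ r) L)

theorem axisLaplacian_iterate_add_right {v : E} (h : ∀ q, X (q + v) = X q) (r : ℕ) (q : E) :
    (axisLaplacian e)^[r] X (q + v) = (axisLaplacian e)^[r] X q := by
  induction r generalizing q with
  | zero => exact h q
  | succ r ih =>
    simp only [Function.iterate_succ_apply', axisLaplacian]
    exact Finset.sum_congr rfl fun i _ =>
      lineDeriv_add_right (fun q => lineDeriv_add_right ih q) q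

end AxisLaplacian

/-! ### Fourier series of periodic functions on the cover. -/

section Torus

variable {l : ℕ} {F : Type*}

/-- Invariance under the integer translations. -/
def IsTorusPeriodic (u : (Fin l → ℝ) → F) : Prop :=
  ∀ (k : Fin l → ℤ) (θ : Fin l → ℝ), u (θ + fun i => (k i : ℝ)) = u θ

/-- The covering of the torus. -/
def torusMk (θ : Fin l → ℝ) : UnitAddTorus (Fin l) := fun i => (θ i : UnitAddCircle)

theorem isOpenQuotientMap_torusMk : IsOpenQuotientMap (torusMk (l := l)) :=
  IsOpenQuotientMap.piMap fun _ => QuotientAddGroup.isOpenQuotientMap_mk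

theorem IsTorusPeriodic.eq_of_torusMk_eq {u : (Fin l → ℝ) → F} (hu : IsTorusPeriodic u)
    {θ θ' : Fin l → ℝ} (h : torusMk θ = torusMk θ') : u θ = u θ' := by
  have h1 (i : Fin l) : ∃ n : ℤ, θ' i = θ i + n := by
    obtain ⟨n, hn⟩ := AddSubgroup.mem_zmultiples_iff.1 (QuotientAddGroup.eq.1 (congrFun h i))
    exact ⟨n, by rw [zsmul_one] at hn; linarith⟩
  choose k hk using h1
  rw [← hu k θ]
  congr 1
  ext i
  simp [hk]

theorem IsTorusPeriodic.exists_factor {u : (Fin l → ℝ) → F} (hu : IsTorusPeriodic u) :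
    ∃ U : UnitAddTorus (Fin l) → F, ∀ θ, U (torusMk θ) = u θ :=
  ⟨fun x => u (Function.surjInv isOpenQuotientMap_torusMk.surjective x), fun _ =>
    hu.eq_of_torusMk_eq (Function.surjInv_eq isOpenQuotientMap_torusMk.surjective _)⟩

variable [NormedAddCommGroup F] [NormedSpace ℝ F]

local instance : MeasureSpace UnitAddCircle := ⟨AddCircle.haarAddCircle⟩

theorem setOf_forall_mem_Ioc_ae_eq_Icc (a : Fin l → ℝ) :
    {x : Fin l → ℝ | ∀ i, x i ∈ Ioc (a i) (a i + 1)} =ᵐ[volume] Icc a (a + 1) := by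
  have : {x : Fin l → ℝ | ∀ i, x i ∈ Ioc (a i) (a i + 1)} = univ.pi fun i => Ioc (a i) ((a + 1) i) := by
    ext x; simp
  rw [this]
  exact Measure.univ_pi_Ioc_ae_eq_Icc

theorem IsTorusPeriodic.setIntegral_Icc_eq {u : (Fin l → ℝ) → F} (hu : IsTorusPeriodic u)
    (a : Fin l → ℝ) : ∫ θ in Icc a (a + 1), u θ = ∫ θ in Icc 0 1, u θ := by
  obtain ⟨U, hU⟩ := hu.exists_factor
  have h (a : Fin l → ℝ) : ∫ θ in Icc a (a + 1), u θ = ∫ x, U x := by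
    rw [UnitAddTorus.integral_preimage U a, setIntegral_congr_set (setOf_forall_mem_Ioc_ae_eq_Icc a)]
    simp only [← hU]
    rfl
  have h0 := h 0
  rw [zero_add] at h0
  rw [h, h0]

theorem IsTorusPeriodic.setIntegral_comp_add_right {u : (Fin l → ℝ) → F} (hu : IsTorusPeriodic u)
    (a : Fin l → ℝ) : ∫ θ in Icc 0 1, u (θ + a) = ∫ θ in Icc 0 1, u θ := by
  have h := (measurePreserving_add_right (volume : Measure (Fin l → ℝ)) a).setIntegral_preimage_emb
    (measurableEmbedding_addRight a) u (Icc a (a + 1))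
  rw [hu.setIntegral_Icc_eq] at h
  rw [← h]
  congr 2
  ext x
  simp [mem_Icc, add_comm]

/-- The character `e^{2πi k·θ}`. -/
def torusChar (k : Fin l → ℤ) (θ : Fin l → ℝ) : ℂ :=
  Complex.exp (Complex.I * ((2 * Real.pi * ∑ i, (k i : ℝ) * θ i : ℝ) : ℂ))

theorem torusChar_add (k : Fin l → ℤ) (θ a : Fin l → ℝ) :
    torusChar k (θ + a) = torusChar k θ * torusChar k a := by
  simp only [torusChar, ← Complex.exp_add, Pi.add_apply, mul_add, Finset.sum_add_distrib]
  push_cast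
  ring_nf

theorem torusChar_neg_mul_self (k : Fin l → ℤ) (θ : Fin l → ℝ) :
    torusChar (-k) θ * torusChar k θ = 1 := by
  simp only [torusChar, ← Complex.exp_add]
  convert Complex.exp_zero
  simp

theorem torusChar_zero_left (θ : Fin l → ℝ) : torusChar 0 θ = 1 := by
  simp [torusChar]

theorem norm_torusChar (k : Fin l → ℤ) (θ : Fin l → ℝ) : ‖torusChar k θ‖ = 1 :=
  Complex.norm_exp_I_mul_ofReal _

theorem contDiff_torusChar (k : Fin l → ℤ) : ContDiff ℝ ω (torusChar k) := by
  unfold torusChar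
  refine Complex.contDiff_exp.comp ?_
  refine contDiff_const.mul (Complex.ofRealCLM.contDiff.comp (ContDiff.mul contDiff_const ?_))
  fun_prop

theorem torusChar_eq_mFourier (k : Fin l → ℤ) (θ : Fin l → ℝ) :
    torusChar k θ = UnitAddTorus.mFourier k (torusMk θ) := by
  simp only [torusChar, UnitAddTorus.mFourier, torusMk, ContinuousMap.coe_mk, fourier_coe_apply,
    ← Complex.exp_sum]
  congr 1
  push_cast
  rw [Finset.mul_sum, Finset.mul_sum]
  refine Finset.sum_congr rfl fun i _ => ?_
  ring

theorem isTorusPeriodic_torusChar (k : Fin l → ℤ) : IsTorusPeriodic (torusChar k) := by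
  intro n θ
  rw [torusChar_eq_mFourier, torusChar_eq_mFourier]
  congr 1
  ext i
  simp [torusMk]

/-- The Fourier coefficient of a function on the torus. -/
def torusCoeff (w : (Fin l → ℝ) → ℂ) (k : Fin l → ℤ) : ℂ :=
  ∫ θ in Icc 0 1, torusChar (-k) θ * w θ

theorem hasSum_torusCoeff {w : (Fin l → ℝ) → ℂ} (hw : IsTorusPeriodic w) (hc : Continuous w)
    (hs : Summable (torusCoeff w)) (θ : Fin l → ℝ) :
    HasSum (fun k => torusCoeff w k * torusChar k θ) (w θ) := by
  obtain ⟨U, hU⟩ := hw.exists_factor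
  have hUc : Continuous U := isOpenQuotientMap_torusMk.isQuotientMap.continuous_iff.2 <| by
    convert hc using 1; ext θ; exact hU θ
  have hcoef : UnitAddTorus.mFourierCoeff U = torusCoeff w := by
    ext k
    rw [UnitAddTorus.mFourierCoeff_eq_integral U k 0, torusCoeff,
      setIntegral_congr_set (setOf_forall_mem_Ioc_ae_eq_Icc 0), zero_add]
    simp only [torusChar_eq_mFourier, ← hU, smul_eq_mul]
    rfl
  have h := UnitAddTorus.hasSum_mFourier_series_apply_of_summable (f := ⟨U, hUc⟩)
    (by simpa only [ContinuousMap.coe_mk, hcoef] using hs) (torusMk θ)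
  simpa only [ContinuousMap.coe_mk, hcoef, hU, smul_eq_mul, ← torusChar_eq_mFourier] using h

theorem torusCoeff_comp_add_right {w : (Fin l → ℝ) → ℂ} (hw : IsTorusPeriodic w)
    (k : Fin l → ℤ) (a : Fin l → ℝ) :
    ∫ θ in Icc 0 1, torusChar (-k) θ * w (θ + a) = torusChar k a * torusCoeff w k := by
  have hp : IsTorusPeriodic fun θ => torusChar (-k) θ * w θ := fun n θ => by
    simp only [isTorusPeriodic_torusChar (-k) n θ, hw n θ]
  rw [torusCoeff, ← hp.setIntegral_comp_add_right a, ← integral_const_mul]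
  refine integral_congr_ae (Eventually.of_forall fun θ => ?_)
  simp only
  rw [torusChar_add]
  linear_combination -(torusChar (-k) θ * w (θ + a)) * torusChar_neg_mul_self k a

theorem hasDerivAt_torusChar_smul (k : Fin l → ℤ) (v : Fin l → ℝ) :
    HasDerivAt (fun t : ℝ => torusChar k (t • v))
      (Complex.I * ((2 * Real.pi * ∑ i, (k i : ℝ) * v i : ℝ) : ℂ)) 0 := by
  set c : ℂ := Complex.I * ((2 * Real.pi * ∑ i, (k i : ℝ) * v i : ℝ) : ℂ)
  have h (t : ℝ) : torusChar k (t • v) = Complex.exp (c * t) := by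
    simp only [torusChar, c]
    congr 1
    rw [mul_assoc Complex.I, ← Complex.ofReal_mul]
    congr 2
    simp only [Pi.smul_apply, smul_eq_mul, Finset.mul_sum, Finset.sum_mul]
    exact Finset.sum_congr rfl fun i _ => by ring
  have h1 : HasDerivAt (fun z : ℂ => Complex.exp (c * z)) c ((0 : ℝ) : ℂ) := by
    simpa using ((hasDerivAt_id (0 : ℂ)).const_mul c).cexp
  simpa only [h] using h1.comp_ofReal

/-- Obtained by differentiating at t = 0 the effect of the translation by t • v on the coefficient,
instead of integrating by parts. -/
theorem torusCoeff_lineDeriv {w : (Fin l → ℝ) → ℂ} (hw : IsTorusPeriodic w)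
    (ha : AnalyticOnNhd ℝ w univ) (k : Fin l → ℤ) (v : Fin l → ℝ) :
    torusCoeff (fun θ => lineDeriv ℝ w θ v) k
      = Complex.I * ((2 * Real.pi * ∑ i, (k i : ℝ) * v i : ℝ) : ℂ) * torusCoeff w k := by
  have hwd : ContDiff ℝ ω w := contDiff_iff_contDiffAt.2 fun x => (ha x trivial).contDiffAt
  let h : (Fin l → ℝ) × ℝ → ℂ := fun x => torusChar (-k) x.1 * w (x.1 + x.2 • v)
  have hh : ContDiff ℝ ω h := ((contDiff_torusChar (-k)).comp contDiff_fst).mul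
    (hwd.comp (contDiff_fst.add (contDiff_snd.smul contDiff_const)))
  have h1 := (hasFDerivAt_setIntegral_of_isCompact (ν := volume) (K := Icc (0 : Fin l → ℝ) 1)
    (g := fun _ => 1) (h := h) (p₀ := 0) isCompact_Icc
    (integrableOn_const (by simp [isCompact_Icc.measure_lt_top.ne]) (by simp))
    (fun x _ => (hh.contDiffAt).analyticAt)).hasDerivAt
  have h2 := (hasDerivAt_torusChar_smul k v).mul_const (torusCoeff w k)
  have h3 : (fun p : ℝ => ∫ x in Icc (0 : Fin l → ℝ) 1, (1 : ℝ) • h (x, p))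
      = fun t => torusChar k (t • v) * torusCoeff w k := by
    ext t
    simp only [one_smul, h, torusCoeff_comp_add_right hw]
  rw [h3] at h1
  rw [← h1.unique h2]
  have hci : IntegrableOn (fun x => (1 : ℝ) • (fderiv ℝ h (x, 0)).comp
      (ContinuousLinearMap.inr ℝ (Fin l → ℝ) ℝ)) (Icc 0 1) := by
    refine Continuous.integrableOn_Icc ?_
    simp only [one_smul]
    exact ((hh.continuous_fderiv (by simp)).comp (by fun_prop : Continuous fun x : Fin l → ℝ =>
      (x, (0 : ℝ)))).clm_comp continuous_const
  rw [ContinuousLinearMap.integral_apply hci, torusCoeff]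
  refine integral_congr_ae (Eventually.of_forall fun θ => ?_)
  have h4 : HasFDerivAt w (fderiv ℝ w θ) (θ + (0 : ℝ) • v) := by
    simpa using (ha θ trivial).differentiableAt.hasFDerivAt
  have h5 : HasDerivAt (fun t : ℝ => h (θ, t)) (torusChar (-k) θ * fderiv ℝ w θ v) 0 := by
    have h6 : HasDerivAt (fun t : ℝ => θ + t • v) v 0 := by
      simpa using ((hasDerivAt_id (0 : ℝ)).smul_const v).const_add θ
    change HasDerivAt (fun t : ℝ => torusChar (-k) θ * w (θ + t • v)) _ 0
    exact (HasFDerivAt.comp_hasDerivAt (0 : ℝ) h4 h6).const_mul _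
  have h7 : HasDerivAt (fun t : ℝ => h (θ, t)) (fderiv ℝ h (θ, 0) (0, 1)) 0 :=
    (hh.differentiable (by simp) (θ, 0)).hasFDerivAt.comp_hasDerivAt (0 : ℝ)
      ((hasDerivAt_const (0 : ℝ) θ).prodMk (hasDerivAt_id' (0 : ℝ)))
  simp only [(ha θ trivial).differentiableAt.lineDeriv_eq_fderiv]
  rw [h5.unique h7]
  simp

end Torus

/-! ### Small divisors and the cohomological equation. -/

section Kernel

variable {l : ℕ}

/-- The coordinate directions of `ℝˡ`. -/
def coordDir (l : ℕ) (i : Fin l) : Fin l → ℝ := Pi.single i 1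

/-- The symbol of the Laplacian. -/
def laplaceSymbol (k : Fin l → ℤ) : ℂ := ((-∑ i, (2 * Real.pi * (k i : ℝ)) ^ 2 : ℝ) : ℂ)

theorem norm_sq_le_norm_laplaceSymbol (k : Fin l → ℤ) : ‖k‖ ^ 2 ≤ ‖laplaceSymbol k‖ := by
  rw [laplaceSymbol, Complex.norm_real, norm_neg, Real.norm_of_nonneg (by positivity)]
  have h : ‖k‖ ≤ √(∑ i, (2 * Real.pi * (k i : ℝ)) ^ 2) := by
    refine (pi_norm_le_iff_of_nonneg (Real.sqrt_nonneg _)).2 fun i => Real.le_sqrt_of_sq_le ?_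
    rw [Int.norm_eq_abs, sq_abs]
    calc (k i : ℝ) ^ 2 ≤ (2 * Real.pi * (k i : ℝ)) ^ 2 := by
          rw [mul_pow]
          refine le_mul_of_one_le_left (sq_nonneg _) (one_le_pow₀ ?_)
          linarith [Real.pi_gt_three]
      _ ≤ _ := Finset.single_le_sum (f := fun i => (2 * Real.pi * (k i : ℝ)) ^ 2)
          (fun i _ => sq_nonneg _) (Finset.mem_univ i)
  calc ‖k‖ ^ 2 ≤ √(∑ i, (2 * Real.pi * (k i : ℝ)) ^ 2) ^ 2 := by gcongr
    _ = _ := Real.sq_sqrt (by positivity)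

theorem IsTorusPeriodic.lineDeriv {F : Type*} [NormedAddCommGroup F] [NormedSpace ℝ F]
    {u : (Fin l → ℝ) → F} (hu : IsTorusPeriodic u) (v : Fin l → ℝ) :
    IsTorusPeriodic fun θ => lineDeriv ℝ u θ v :=
  fun k => lineDeriv_add_right (hu k)

theorem IsTorusPeriodic.axisLaplacian_iterate {F : Type*} [NormedAddCommGroup F] [NormedSpace ℝ F]
    {u : (Fin l → ℝ) → F} (hu : IsTorusPeriodic u) (r : ℕ) :
    IsTorusPeriodic ((axisLaplacian (coordDir l))^[r] u) :=
  fun k => axisLaplacian_iterate_add_right _ (hu k) r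

theorem torusCoeff_axisLaplacian {w : (Fin l → ℝ) → ℂ} (hw : IsTorusPeriodic w)
    (ha : AnalyticOnNhd ℝ w univ) (k : Fin l → ℤ) :
    torusCoeff (axisLaplacian (coordDir l) w) k = laplaceSymbol k * torusCoeff w k := by
  have ha1 (v) : AnalyticOnNhd ℝ (fun θ => lineDeriv ℝ w θ v) univ := ha.lineDeriv isOpen_univ v
  have h1 (i : Fin l) : torusCoeff (fun θ => lineDeriv ℝ (fun θ => lineDeriv ℝ w θ (coordDir l i)) θ
      (coordDir l i)) k = -((2 * Real.pi * (k i : ℝ) : ℝ) : ℂ) ^ 2 * torusCoeff w k := by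
    rw [torusCoeff_lineDeriv (hw.lineDeriv _) (ha1 _), torusCoeff_lineDeriv hw ha]
    have : ∑ j, (k j : ℝ) * coordDir l i j = k i := by simp [coordDir, Pi.single_apply]
    rw [this, ← mul_assoc]
    congr 1
    linear_combination ((2 * Real.pi * (k i : ℝ) : ℝ) : ℂ) ^ 2 * Complex.I_mul_I
  have h2 (i : Fin l) : IntegrableOn (fun θ => torusChar (-k) θ *
      lineDeriv ℝ (fun θ => lineDeriv ℝ w θ (coordDir l i)) θ (coordDir l i)) (Icc 0 1) := by
    refine ContinuousOn.integrableOn_Icc (ContinuousOn.mul ?_ ?_)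
    · exact (contDiff_torusChar (-k)).continuous.continuousOn
    · exact ((ha1 _).lineDeriv isOpen_univ _).continuousOn.mono (subset_univ _)
  have h3 : torusCoeff (axisLaplacian (coordDir l) w) k = ∑ i, torusCoeff (fun θ =>
      lineDeriv ℝ (fun θ => lineDeriv ℝ w θ (coordDir l i)) θ (coordDir l i)) k := by
    simp only [torusCoeff, axisLaplacian, Finset.mul_sum]
    exact integral_finsetSum _ fun i _ => h2 i
  rw [h3]
  simp only [h1, ← Finset.sum_mul, laplaceSymbol]
  push_cast
  rw [Finset.sum_neg_distrib]

theorem torusCoeff_axisLaplacian_iterate {w : (Fin l → ℝ) → ℂ} (hw : IsTorusPeriodic w)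
    (ha : AnalyticOnNhd ℝ w univ) (r : ℕ) (k : Fin l → ℤ) :
    torusCoeff ((axisLaplacian (coordDir l))^[r] w) k = laplaceSymbol k ^ r * torusCoeff w k := by
  induction r with
  | zero => simp
  | succ r ih =>
    rw [Function.iterate_succ_apply', torusCoeff_axisLaplacian (hw.axisLaplacian_iterate r)
      (ha.axisLaplacian_iterate _ isOpen_univ r), ih, pow_succ', mul_assoc]

theorem norm_torusCoeff_le {w : (Fin l → ℝ) → ℂ} (k : Fin l → ℤ) :
    ‖torusCoeff w k‖ ≤ ∫ θ in Icc 0 1, ‖w θ‖ := by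
  refine (norm_integral_le_integral_norm _).trans (le_of_eq ?_)
  simp only [norm_mul, norm_torusChar, one_mul]

/-- The integer vectors embed isometrically in the lattice spanned by the standard basis, where
summability depends only on the rank. -/
theorem summable_norm_rpow_int {ρ : ℝ} (hρ : ρ < -l) : Summable fun k : Fin l → ℤ => ‖k‖ ^ ρ := by
  let L := Submodule.span ℤ (Set.range (Pi.basisFun ℝ (Fin l)))
  have hL (k : Fin l → ℤ) : (fun i => (k i : ℝ)) ∈ L :=
    (Module.Basis.mem_span_iff_repr_mem ℤ (Pi.basisFun ℝ (Fin l)) _).2 fun i => ⟨k i, by simp⟩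
  let f : (Fin l → ℤ) → L := fun k => ⟨fun i => (k i : ℝ), hL k⟩
  have hf : Function.Injective f := fun k k' h => by
    ext i
    exact Int.cast_injective (α := ℝ) (congrFun (congrArg Subtype.val h) i)
  have hn (k : Fin l → ℤ) : ‖f k‖ = ‖k‖ := by
    change ‖fun i => (k i : ℝ)‖ = ‖k‖
    simp [Pi.norm_def, nnnorm, Int.norm_eq_abs, Real.norm_eq_abs]
  have hs := (ZLattice.summable_norm_rpow L ρ (by
    rw [ZLattice.rank ℝ L]; simpa using hρ)).comp_injective hf
  simpa only [Function.comp_def, hn] using hs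

/-- With y the signed distance of k·ω₀ to the nearest integer, |e^{2πiy} - 1| = 2|sin πy| ≥ 4|y|,
because |y| ≤ 1/2. -/
theorem le_norm_torusChar_sub_one {c μ : ℝ} {ω₀ : Fin l → ℝ}
    (hω : ω₀ ∈ diophantineSet l c μ) {k : Fin l → ℤ} (hk : k ≠ 0) :
    c * ‖k‖ ^ (-μ) ≤ ‖torusChar k ω₀ - 1‖ := by
  set x := ∑ i, (k i : ℝ) * ω₀ i with hx
  set y := x - round x with hy
  have h1 : torusChar k ω₀ = Complex.exp (Complex.I * ((2 * Real.pi * y : ℝ) : ℂ)) := by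
    rw [torusChar, ← hx, Complex.exp_eq_exp_iff_exists_int]
    refine ⟨round x, ?_⟩
    rw [hy]
    push_cast
    ring
  have hy2 : |y| ≤ 1 / 2 := abs_sub_round x
  rw [h1, Complex.norm_exp_I_mul_ofReal_sub_one]
  have h2 : 2 / Real.pi * |Real.pi * y| ≤ |Real.sin (Real.pi * y)| := by
    refine Real.mul_abs_le_abs_sin ?_
    rw [abs_mul, abs_of_pos Real.pi_pos]
    nlinarith [Real.pi_pos]
  rw [abs_mul, abs_of_pos Real.pi_pos, ← mul_assoc, div_mul_cancel₀ _ Real.pi_ne_zero] at h2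
  rw [show 2 * Real.pi * y / 2 = Real.pi * y by ring, norm_mul, Real.norm_eq_abs, Real.norm_eq_abs,
    abs_of_pos (two_pos : (0 : ℝ) < 2)]
  have h3 : c * ‖k‖ ^ (-μ) ≤ |y| := hω k (round x) hk
  linarith [abs_nonneg y]

/-- For a Diophantine `ω₀`, the equation `v (θ + ω₀) - v θ = u θ - ∫ u` is solved by a convolution
of `Δʳ u` with a continuous kernel. -/
theorem exists_cohomological_kernel {c μ : ℝ} (hc : 0 < c) (hμ : 0 < μ) {ω₀ : Fin l → ℝ}
    (hω : ω₀ ∈ diophantineSet l c μ) :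
    ∃ r : ℕ, 0 < r ∧ ∃ g : (Fin l → ℝ) → ℝ, Continuous g ∧ ∀ u : (Fin l → ℝ) → ℝ,
      IsTorusPeriodic u → AnalyticOnNhd ℝ u univ → ∀ s,
      (∫ θ in Icc 0 1, g θ * (axisLaplacian (coordDir l))^[r] u (θ + (s + ω₀)))
        - (∫ θ in Icc 0 1, g θ * (axisLaplacian (coordDir l))^[r] u (θ + s))
        = u s - ∫ θ in Icc 0 1, u θ := by
  -- This makes -2r + μ < -l, so the kernel coefficients, of size ‖k‖^(-2r + μ), are summable.
  -- Positivity of r is kept so that Δʳ kills constants.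
  obtain ⟨r, hr⟩ := exists_nat_gt (μ + l + 1)
  have hr0 : 0 < r := by
    have : (0 : ℝ) < r := by linarith [(Nat.cast_nonneg l : (0 : ℝ) ≤ l)]
    exact_mod_cast this
  -- Division by the symbol of Δʳ and by the small divisor. The zero mode is dropped: it is the
  -- mean, which remains on the right-hand side.
  let a : (Fin l → ℤ) → ℂ := fun k =>
    if k = 0 then 0 else (laplaceSymbol k ^ r * (torusChar k ω₀ - 1))⁻¹
  have hpos {k : Fin l → ℤ} (hk : k ≠ 0) : 0 < ‖k‖ := norm_pos_iff.2 hk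
  have hσ {k : Fin l → ℤ} (hk : k ≠ 0) : laplaceSymbol k ≠ 0 := by
    rw [← norm_pos_iff]
    exact lt_of_lt_of_le (pow_pos (hpos hk) 2) (norm_sq_le_norm_laplaceSymbol k)
  have hχ {k : Fin l → ℤ} (hk : k ≠ 0) : torusChar k ω₀ - 1 ≠ 0 := by
    rw [← norm_pos_iff]
    exact lt_of_lt_of_le (mul_pos hc (Real.rpow_pos_of_pos (hpos hk) _))
      (le_norm_torusChar_sub_one hω hk)
  have hσr {k : Fin l → ℤ} (hk : k ≠ 0) : ‖(laplaceSymbol k ^ r)⁻¹‖ ≤ ‖k‖ ^ (-(2 * r : ℝ)) := by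
    rw [norm_inv, norm_pow, Real.rpow_neg (norm_nonneg k)]
    have : ‖k‖ ^ (2 * r : ℝ) = (‖k‖ ^ 2) ^ r := by
      rw [← pow_mul, ← Real.rpow_natCast]; push_cast; rfl
    rw [this]
    have := hpos hk
    gcongr
    exact norm_sq_le_norm_laplaceSymbol k
  have hσs : Summable fun k : Fin l → ℤ => ‖(laplaceSymbol k ^ r)⁻¹‖ := by
    refine (summable_norm_rpow_int (l := l) (ρ := -(2 * r : ℝ)) ?_).of_norm_bounded_eventually ?_
    · have : (0 : ℝ) ≤ r := Nat.cast_nonneg r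
      linarith
    · refine (finite_singleton (0 : Fin l → ℤ)).subset fun k hk => ?_
      by_contra hk0
      exact hk ((norm_norm _).trans_le (hσr hk0))
  have ha : Summable fun k => ‖a k‖ := by
    refine ((summable_norm_rpow_int (l := l) (ρ := -(2 * r : ℝ) + μ) ?_).mul_left
      c⁻¹).of_norm_bounded fun k => ?_
    · have : (0 : ℝ) ≤ r := Nat.cast_nonneg r
      linarith
    · rw [norm_norm]
      by_cases hk : k = 0
      · simp only [a, hk, if_true, norm_zero]; positivity
      · simp only [a, hk, if_false]
        rw [mul_inv, norm_mul, Real.rpow_add (hpos hk), mul_left_comm]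
        refine mul_le_mul (hσr hk) ?_ (norm_nonneg _) (by positivity)
        rw [norm_inv, inv_le_comm₀ (norm_pos_iff.2 (hχ hk))
          (mul_pos (inv_pos.2 hc) (Real.rpow_pos_of_pos (hpos hk) _)), mul_inv, inv_inv,
          ← Real.rpow_neg (norm_nonneg k)]
        exact le_norm_torusChar_sub_one hω hk
  -- The characters carry -k because the kernel is paired with w(θ + s) rather than w(s - θ).
  let gC : (Fin l → ℝ) → ℂ := fun θ => ∑' k, a k * torusChar (-k) θ
  have hnorm (k : Fin l → ℤ) (θ : Fin l → ℝ) : ‖a k * torusChar (-k) θ‖ = ‖a k‖ := by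
    rw [norm_mul, norm_torusChar, mul_one]
  have hgC : Continuous gC := continuous_tsum
    (fun k => continuous_const.mul (contDiff_torusChar (-k)).continuous) ha
    fun k θ => (hnorm k θ).le
  have hconv {w : (Fin l → ℝ) → ℂ} (hw : IsTorusPeriodic w) (hwc : Continuous w) (s : Fin l → ℝ) :
      HasSum (fun k => a k * (torusChar k s * torusCoeff w k))
        (∫ θ in Icc 0 1, gC θ * w (θ + s)) := by
    have hint (k : Fin l → ℤ) : IntegrableOn (fun θ => a k * torusChar (-k) θ * w (θ + s))
        (Icc 0 1) := by
      refine Continuous.integrableOn_Icc ?_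
      exact (continuous_const.mul (contDiff_torusChar (-k)).continuous).mul (by fun_prop)
    have h := hasSum_integral_of_summable_integral_norm hint (by
      simp only [norm_mul, norm_torusChar, mul_one]
      simp only [integral_const_mul]
      exact ha.mul_right _)
    have e1 (k : Fin l → ℤ) : ∫ θ in Icc 0 1, a k * torusChar (-k) θ * w (θ + s)
        = a k * (torusChar k s * torusCoeff w k) := by
      rw [← torusCoeff_comp_add_right hw, ← integral_const_mul]
      simp only [mul_assoc]
    have e2 (θ : Fin l → ℝ) : ∑' k, a k * torusChar (-k) θ * w (θ + s) = gC θ * w (θ + s) :=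
      tsum_mul_right
    simpa only [e1, e2] using h
  -- For real u the identity may be proved with the complex kernel, and then real parts are taken.
  refine ⟨r, hr0, fun θ => (gC θ).re, Complex.continuous_re.comp hgC, fun u hu hua s => ?_⟩
  let w : (Fin l → ℝ) → ℂ := fun θ => Complex.ofRealCLM (u θ)
  have hw : IsTorusPeriodic w := fun k θ => by simp only [w, hu k θ]
  have hwa : AnalyticOnNhd ℝ w univ := fun θ hθ =>
    (Complex.ofRealCLM.analyticAt _).fun_comp (hua θ hθ)
  have hwc : Continuous w := continuousOn_univ.1 hwa.continuousOn
  set W := (axisLaplacian (coordDir l))^[r] w with hW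
  have hWp : IsTorusPeriodic W := hw.axisLaplacian_iterate r
  have hWc : Continuous W :=
    continuousOn_univ.1 (hwa.axisLaplacian_iterate _ isOpen_univ r).continuousOn
  have hcoef : ∀ k, torusCoeff W k = laplaceSymbol k ^ r * torusCoeff w k :=
    torusCoeff_axisLaplacian_iterate hw hwa r
  have hsum : Summable (torusCoeff w) := by
    refine (hσs.mul_right (∫ θ in Icc 0 1, ‖W θ‖)).of_norm_bounded_eventually ?_
    refine (finite_singleton (0 : Fin l → ℤ)).subset fun k hk => ?_
    by_contra hk0
    refine hk (show ‖torusCoeff w k‖ ≤ ‖(laplaceSymbol k ^ r)⁻¹‖ * ∫ θ in Icc 0 1, ‖W θ‖ from ?_)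
    have h1 : torusCoeff w k = (laplaceSymbol k ^ r)⁻¹ * torusCoeff W k := by
      rw [hcoef, inv_mul_cancel_left₀ (pow_ne_zero _ (hσ hk0))]
    rw [h1, norm_mul]
    gcongr
    exact norm_torusCoeff_le k
  have h1 := hasSum_torusCoeff hw hwc hsum s
  have h2 := (hconv hWp hWc (s + ω₀)).sub (hconv hWp hWc s)
  have h3 : HasSum (fun k : Fin l → ℤ => if k = 0 then torusCoeff w 0 else 0) (torusCoeff w 0) :=
    hasSum_ite_eq 0 _
  -- For k ≠ 0 the symbol and the divisor cancel, which leaves the Fourier series of w with its mean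
  -- removed.
  have h4 : (fun k => a k * (torusChar k (s + ω₀) * torusCoeff W k)
      - a k * (torusChar k s * torusCoeff W k))
      = fun k => torusCoeff w k * torusChar k s - if k = 0 then torusCoeff w 0 else 0 := by
    ext k
    by_cases hk : k = 0
    · subst hk
      simp [a, torusChar_zero_left]
    · have e1 := hσ hk
      have e2 := hχ hk
      simp only [a, hk, if_false, hcoef, torusChar_add]
      field_simp
      ring
  rw [h4] at h2
  have h5 := h2.unique (h1.sub h3)
  have hWr : ∀ θ, W θ = (((axisLaplacian (coordDir l))^[r] u θ : ℝ) : ℂ) := fun θ =>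
    axisLaplacian_iterate_clm_comp _ isOpen_univ hua Complex.ofRealCLM r trivial
  have hre (b : Fin l → ℝ) : (∫ θ in Icc 0 1, gC θ * W (θ + b)).re
      = ∫ θ in Icc 0 1, (gC θ).re * (axisLaplacian (coordDir l))^[r] u (θ + b) := by
    have hi : IntegrableOn (fun θ => gC θ * W (θ + b)) (Icc 0 1) :=
      Continuous.integrableOn_Icc (hgC.mul (by fun_prop))
    have := Complex.reCLM.integral_comp_comm hi
    simp only [Complex.reCLM_apply] at this
    rw [← this]
    refine integral_congr_ae (Eventually.of_forall fun θ => ?_)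
    simp [hWr]
  have h0 : (torusCoeff w 0).re = ∫ θ in Icc 0 1, u θ := by
    simp only [torusCoeff, neg_zero, torusChar_zero_left, one_mul, w, Complex.ofRealCLM_apply]
    rw [integral_complex_ofReal, Complex.ofReal_re]
  have h6 := congrArg Complex.re h5
  simp only [Complex.sub_re, hre, h0] at h6
  simpa [w] using h6

end Kernel

/-! ### Divergence commutes with the Laplacian. -/

section Divergence

variable {ι E : Type*} [Fintype ι] [NormedAddCommGroup E] [NormedSpace ℝ E] [FiniteDimensional ℝ E]
  {Ω : Set E} {X : E → E}

/-- Divergence commutes with directional derivatives. -/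
theorem traceCLM_fderiv_lineDeriv (hΩ : IsOpen Ω) (hX : AnalyticOnNhd ℝ X Ω) (v : E) :
    EqOn (fun q => traceCLM E (fderiv ℝ (fun p => lineDeriv ℝ X p v) q))
      (fun q => lineDeriv ℝ (fun p => traceCLM E (fderiv ℝ X p)) q v) Ω := by
  intro q hq
  have : CompleteSpace E := FiniteDimensional.complete ℝ E
  have h1 : (fun p => lineDeriv ℝ X p v) =ᶠ[𝓝 q] fun p => fderiv ℝ X p v :=
    eventually_of_mem (hΩ.mem_nhds hq) fun p hp => lineDeriv_eqOn_fderiv hX v hp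
  have h2 := (hX q hq).fderiv.differentiableAt.hasFDerivAt
  have hsymm : IsSymmSndFDerivAt ℝ X q := ((hX q hq).contDiffAt (n := 2)).isSymmSndFDerivAt (by simp)
  have h3 : fderiv ℝ (fun p => fderiv ℝ X p v) q = fderiv ℝ (fderiv ℝ X) q v := by
    rw [(h2.clm_apply (hasFDerivAt_const v q)).fderiv]
    ext w
    simpa using hsymm.eq w v
  have h4 : HasFDerivAt (fun p => traceCLM E (fderiv ℝ X p))
      ((traceCLM E).comp (fderiv ℝ (fderiv ℝ X) q)) q := (traceCLM E).hasFDerivAt.comp q h2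
  simp only [h1.fderiv_eq, h3, h4.differentiableAt.lineDeriv_eq_fderiv, h4.fderiv]
  rfl

theorem traceCLM_fderiv_axisLaplacian (e : ι → E) (hΩ : IsOpen Ω) (hX : AnalyticOnNhd ℝ X Ω) :
    EqOn (fun q => traceCLM E (fderiv ℝ (axisLaplacian e X) q))
      (axisLaplacian e fun p => traceCLM E (fderiv ℝ X p)) Ω := by
  intro q hq
  have : CompleteSpace E := FiniteDimensional.complete ℝ E
  have h1 : fderiv ℝ (axisLaplacian e X) q
      = ∑ i, fderiv ℝ (fun p => lineDeriv ℝ (fun p => lineDeriv ℝ X p (e i)) p (e i)) q := by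
    unfold axisLaplacian
    exact fderiv_fun_sum fun i _ =>
      ((hX.lineDeriv hΩ (e i)).lineDeriv hΩ (e i) q hq).differentiableAt
  simp only [h1, map_sum, axisLaplacian]
  refine Finset.sum_congr rfl fun i _ => ?_
  exact (traceCLM_fderiv_lineDeriv hΩ (hX.lineDeriv hΩ (e i)) (e i) hq).trans
    (lineDeriv_eqOn hΩ (traceCLM_fderiv_lineDeriv hΩ hX (e i)) (e i) hq)

theorem traceCLM_fderiv_axisLaplacian_iterate (e : ι → E) (hΩ : IsOpen Ω)
    (hX : AnalyticOnNhd ℝ X Ω) (r : ℕ) :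
    EqOn (fun q => traceCLM E (fderiv ℝ ((axisLaplacian e)^[r] X) q))
      ((axisLaplacian e)^[r] fun p => traceCLM E (fderiv ℝ X p)) Ω := by
  have : CompleteSpace E := FiniteDimensional.complete ℝ E
  induction r with
  | zero => exact fun _ _ => rfl
  | succ r ih =>
    simp only [Function.iterate_succ_apply']
    exact (traceCLM_fderiv_axisLaplacian e hΩ (hX.axisLaplacian_iterate e hΩ r)).trans
      (axisLaplacian_eqOn e hΩ ih)

theorem axisLaplacian_iterate_const {E F : Type*} [NormedAddCommGroup E] [NormedSpace ℝ E]
    [NormedAddCommGroup F] [NormedSpace ℝ F] (e : ι → E) (c : F) {r : ℕ} (hr : 0 < r) :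
    (axisLaplacian e)^[r] (fun _ : E => c) = 0 := by
  have h (c : F) : axisLaplacian e (fun _ : E => c) = fun _ => 0 := by
    ext p
    simp [axisLaplacian, lineDeriv]
  induction r, hr using Nat.le_induction with
  | base => exact h c
  | succ r _ ih =>
    rw [Function.iterate_succ_apply', ih]
    exact h 0

end Divergence

/-! ### Deck transformations, local uniformity and divergence-free solutions. -/

section PhaseSpace

variable {l j : ℕ} {M : Set (Fin j → ℝ)}

theorem isOpen_overTorus (hM : IsOpen M) : IsOpen (overTorus l M) := isOpen_univ.prod hM

theorem mem_overTorus {p : Phase l j} : p ∈ overTorus l M ↔ p.2 ∈ M := by simp [overTorus]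

/-- The deck transformations of the covering of `𝕋ˡ × ℝʲ`. -/
def latticeShift (j : ℕ) (k : Fin l → ℤ) : Phase l j := (fun i => (k i : ℝ), 0)

theorem add_latticeShift_mem_overTorus {p : Phase l j} (k : Fin l → ℤ) :
    p + latticeShift j k ∈ overTorus l M ↔ p ∈ overTorus l M := by
  simp [mem_overTorus, latticeShift]

theorem latticeShift_neg (k : Fin l → ℤ) : latticeShift j (-k) = -latticeShift j k := by
  ext i <;> simp [latticeShift]

theorem exists_add_latticeShift_mem_Icc (p : Phase l j) :
    ∃ k : Fin l → ℤ, (p + latticeShift j k).1 ∈ Icc (0 : Fin l → ℝ) 1 := by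
  refine ⟨fun i => -⌊p.1 i⌋, fun i => ?_, fun i => ?_⟩
  · simp only [latticeShift, Prod.fst_add, Pi.add_apply, Pi.zero_apply]
    push_cast
    linarith [Int.floor_le (p.1 i)]
  · simp only [latticeShift, Prod.fst_add, Pi.add_apply, Pi.one_apply]
    push_cast
    linarith [Int.lt_floor_add_one (p.1 i)]

/-- A periodic property valid near each point of `𝕋ˡ × M × {0}` is valid locally uniformly. -/
theorem exists_forall_overTorus (hM : IsOpen M) {Q : Phase l j → ℝ → Prop}
    (hper : ∀ k p κ, Q p κ → Q (p + latticeShift j k) κ)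
    (hQ : ∀ p ∈ overTorus l M, ∀ᶠ q : Phase l j × ℝ in 𝓝 (p, 0), Q q.1 q.2)
    {K : Set (Fin j → ℝ)} (hK : IsCompact K) (hKM : K ⊆ M) :
    ∃ U : Set (Fin j → ℝ), IsOpen U ∧ K ⊆ U ∧ U ⊆ M ∧ ∃ κ₀ > 0, ∀ κ : ℝ, |κ| < κ₀ →
      ∀ p ∈ overTorus l U, Q p κ := by
  have hI : IsCompact (Icc (0 : Fin l → ℝ) 1) := isCompact_Icc
  have h1 : ∀ᶠ q : Phase l j × ℝ in 𝓝ˢ ((Icc (0 : Fin l → ℝ) 1 ×ˢ K) ×ˢ {0}), Q q.1 q.2 := by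
    rw [eventually_nhdsSet_iff_forall]
    rintro ⟨p, κ⟩ ⟨hp, hκ⟩
    obtain rfl : κ = 0 := hκ
    exact hQ p (mem_overTorus.2 (hKM hp.2))
  rw [(hI.prod hK).nhdsSet_prod_eq isCompact_singleton, hI.nhdsSet_prod_eq hK, nhdsSet_singleton,
    eventually_prod_iff] at h1
  obtain ⟨P, hP, P', hP', H⟩ := h1
  obtain ⟨P₁, hP₁, P₂, hP₂, H₁⟩ := eventually_prod_iff.1 hP
  obtain ⟨κ₀, hκ₀, H'⟩ := Metric.eventually_nhds_iff_ball.1 hP'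
  obtain ⟨U, hU, hKU, hUP⟩ := eventually_nhdsSet_iff_exists.1 hP₂
  refine ⟨U ∩ M, hU.inter hM, subset_inter hKU hKM, inter_subset_right, κ₀, hκ₀,
    fun κ hκ p hp => ?_⟩
  obtain ⟨k, hk⟩ := exists_add_latticeShift_mem_Icc p
  have h2 : Q (p + latticeShift j k) κ := by
    refine H (x := p + latticeShift j k) (H₁ (hP₁.self_of_nhdsSet _ hk) (hUP _ ?_)) (H' κ ?_)
    · simpa [latticeShift] using (mem_overTorus.1 hp).1
    · simpa using hκ
  have h3 := hper (-k) _ _ h2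
  rwa [latticeShift_neg, add_neg_cancel_right] at h3

/-- The chosen directions move only the angles, so the operator may be computed with `J` frozen. -/
theorem axisLaplacian_iterate_fiber {F : Type*} [NormedAddCommGroup F] [NormedSpace ℝ F]
    (X : Phase l j → F) (r : ℕ) (J : Fin j → ℝ) (θ : Fin l → ℝ) :
    (axisLaplacian fun i => ((coordDir l i, 0) : Phase l j))^[r] X (θ, J)
      = (axisLaplacian (coordDir l))^[r] (fun θ => X (θ, J)) θ := by
  have h (Y : Phase l j → F) (v θ : Fin l → ℝ) :
      lineDeriv ℝ Y (θ, J) ((v, 0) : Phase l j) = lineDeriv ℝ (fun θ => Y (θ, J)) θ v := by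
    simp [lineDeriv]
  induction r generalizing θ with
  | zero => rfl
  | succ r ih =>
    simp only [Function.iterate_succ_apply', axisLaplacian, h, ih]

/-- The averaged part of a field whose divergence does not depend on the angles is removed by a
divergence-free field. -/
theorem exists_divergenceFree_solution (hM : IsOpen M) {c μ : ℝ} (hc : 0 < c) (hμ : 0 < μ)
    {ω₀ : Fin l → ℝ} (hω : ω₀ ∈ diophantineSet l c μ) {X : Phase l j → Phase l j}
    (hX : AnalyticOnNhd ℝ X (overTorus l M)) (hper : ∀ k p, X (p + latticeShift j k) = X p)
    (hdiv : ∀ p ∈ overTorus l M, ∀ θ, traceCLM _ (fderiv ℝ X (θ, p.2)) = traceCLM _ (fderiv ℝ X p)) :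
    ∃ V : Phase l j → Phase l j, AnalyticOnNhd ℝ V (overTorus l M) ∧
      (∀ k p, V (p + latticeShift j k) = V p) ∧
      (∀ p ∈ overTorus l M, traceCLM _ (fderiv ℝ V p) = 0) ∧
      ∀ p ∈ overTorus l M, V (p + (ω₀, 0)) - V p
        = X p - ∫ θ in Icc (0 : Fin l → ℝ) 1, X (θ, p.2) := by
  have hΩ : IsOpen (overTorus l M) := isOpen_overTorus hM
  obtain ⟨r, hr, g, hg, H⟩ := exists_cohomological_kernel hc hμ hω
  set e : Fin l → Phase l j := fun i => (coordDir l i, 0) with he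
  set D : Phase l j → Phase l j := (axisLaplacian e)^[r] X with hD
  have hDa : AnalyticOnNhd ℝ D (overTorus l M) := hX.axisLaplacian_iterate e hΩ r
  have hDper (k : Fin l → ℤ) (p : Phase l j) : D (p + latticeShift j k) = D p :=
    axisLaplacian_iterate_add_right e (hper k) r p
  let τ : (Fin l → ℝ) × Phase l j →L[ℝ] Phase l j :=
    (.inl ℝ _ _ ∘L .fst ℝ _ _) + .snd ℝ _ _
  have hτ (θ : Fin l → ℝ) (p : Phase l j) : τ (θ, p) = (θ + p.1, p.2) := by
    simp [τ, Prod.ext_iff]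
  let h : (Fin l → ℝ) × Phase l j → Phase l j := fun x => D (τ x)
  have hmem (θ : Fin l → ℝ) {p : Phase l j} (hp : p ∈ overTorus l M) :
      (θ + p.1, p.2) ∈ overTorus l M := hp
  have hh {p : Phase l j} (hp : p ∈ overTorus l M) (θ : Fin l → ℝ) : AnalyticAt ℝ h (θ, p) := by
    refine AnalyticAt.fun_comp (g := D) ?_ (τ.analyticAt _)
    rw [hτ]
    exact hDa _ (hmem θ hp)
  have hgi : IntegrableOn g (Icc 0 1) := hg.integrableOn_Icc
  have hint {p : Phase l j} (hp : p ∈ overTorus l M) :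
      IntegrableOn (fun θ => g θ • h (θ, p)) (Icc 0 1) := by
    refine ContinuousOn.integrableOn_Icc (hg.continuousOn.smul fun θ _ => ?_)
    exact (ContinuousAt.comp (f := fun θ => (θ, p)) (hh hp θ).continuousAt
      (by fun_prop)).continuousWithinAt
  -- The kernel does not involve p: all dependence on p sits in the analytic factor, so continuity
  -- of `g` suffices for analyticity of `V`.
  let V : Phase l j → Phase l j := fun p => ∫ θ in Icc (0 : Fin l → ℝ) 1, g θ • h (θ, p)
  refine ⟨V, fun p hp => analyticAt_setIntegral_of_isCompact isCompact_Icc hgi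
    fun θ _ => hh hp θ, fun k p => ?_, fun p hp => ?_, fun p hp => ?_⟩
  · have h1 (θ : Fin l → ℝ) : h (θ, p + latticeShift j k) = h (θ, p) := by
      simp only [h]
      rw [← hDper k (τ (θ, p)), hτ, hτ]
      congr 1
      ext i <;> simp [latticeShift, add_assoc]
    simp only [V, h1]
  · have h1 := (hasFDerivAt_setIntegral_of_isCompact (ν := volume) isCompact_Icc hgi
      fun θ (_ : θ ∈ Icc (0 : Fin l → ℝ) 1) => hh hp θ).fderiv
    have h2 (θ : Fin l → ℝ) : (fderiv ℝ h (θ, p)).comp (.inr ℝ (Fin l → ℝ) (Phase l j))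
        = fderiv ℝ D (θ + p.1, p.2) := by
      have h3 : HasFDerivAt D (fderiv ℝ D (θ + p.1, p.2)) (τ (θ, p)) := by
        rw [hτ]
        exact (hDa _ (hmem θ hp)).differentiableAt.hasFDerivAt
      have h4 := h3.comp (θ, p) τ.hasFDerivAt
      have h5 : fderiv ℝ h (θ, p) = (fderiv ℝ D (θ + p.1, p.2)).comp τ := h4.fderiv
      rw [h5]
      refine ContinuousLinearMap.ext fun x => ?_
      change fderiv ℝ D _ (τ (0, x)) = _
      rw [hτ, zero_add]
    -- The divergence passes through Δʳ, and div X is constant on the fibre, so Δʳ annihilates it.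
    have h6 (θ : Fin l → ℝ) : traceCLM (Phase l j) (fderiv ℝ D (θ + p.1, p.2)) = 0 := by
      refine (traceCLM_fderiv_axisLaplacian_iterate e hΩ hX r (hmem θ hp)).trans ?_
      rw [he, axisLaplacian_iterate_fiber]
      have : (fun θ => traceCLM (Phase l j) (fderiv ℝ X (θ, p.2)))
          = fun _ => traceCLM (Phase l j) (fderiv ℝ X p) := funext (hdiv p hp)
      rw [this, axisLaplacian_iterate_const _ _ hr]
      rfl
    simp only [h2] at h1
    have hi : IntegrableOn (fun θ => g θ • fderiv ℝ D (θ + p.1, p.2)) (Icc 0 1) := by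
      refine ContinuousOn.integrableOn_Icc (hg.continuousOn.smul fun θ _ => ?_)
      exact (ContinuousAt.comp (f := fun θ => (θ + p.1, p.2)) (hDa _ (hmem θ hp)).fderiv.continuousAt
        (by fun_prop)).continuousWithinAt
    rw [h1, ← (traceCLM (Phase l j)).integral_comp_comm hi]
    simp [h6]
  -- Linear functionals reduce the vector equation to the scalar equation solved by the kernel.
  · refine (SeparatingDual.eq_iff_forall_dual_eq (R := ℝ)).2 fun L => ?_
    have hp' (θ : Fin l → ℝ) : (θ, p.2) ∈ overTorus l M := hp
    let u : (Fin l → ℝ) → ℝ := fun θ => L (X (θ, p.2))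
    have hua : AnalyticOnNhd ℝ u univ := fun θ _ => by
      refine (L.analyticAt _).fun_comp (AnalyticAt.fun_comp (hX _ (hp' θ)) ?_)
      exact analyticAt_id.prod analyticAt_const
    have hup : IsTorusPeriodic u := fun k θ => by
      have := hper k (θ, p.2)
      simp only [u, ← this]
      simp [latticeShift]
    have h1 (θ : Fin l → ℝ) : (axisLaplacian (coordDir l))^[r] u θ = L (D (θ, p.2)) :=
      (axisLaplacian_iterate_fiber (fun q => L (X q)) r p.2 θ).symm.trans
        (axisLaplacian_iterate_clm_comp e hΩ hX L r (hp' θ))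
    have h2 (s : Fin l → ℝ) : L (V (s, p.2))
        = ∫ θ in Icc 0 1, g θ * (axisLaplacian (coordDir l))^[r] u (θ + s) := by
      simp only [V]
      rw [← L.integral_comp_comm (hint (hp' s))]
      simp only [map_smul, h1, h, hτ, smul_eq_mul]
    have h3 : IntegrableOn (fun θ => X (θ, p.2)) (Icc 0 1) := by
      refine ContinuousOn.integrableOn_Icc fun θ _ => ?_
      exact (ContinuousAt.comp (f := fun θ => (θ, p.2)) (hX _ (hp' θ)).continuousAt
        (by fun_prop)).continuousWithinAt
    have h4 := H u hup hua p.1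
    rw [← h2, ← h2] at h4
    rw [map_sub, map_sub, ← L.integral_comp_comm h3]
    have h5 : p + (ω₀, 0) = (p.1 + ω₀, p.2) := by ext <;> simp
    rw [h5]
    exact h4

end PhaseSpace

/-! ### Exactly periodic analytic families. -/

section PeriodicAnalytic

variable {l j : ℕ} {M : Set (Fin j → ℝ)} {E : Type*} [NormedAddCommGroup E] [NormedSpace ℝ E]
  {X : Phase l j × ℝ → E}

/-- `X` is periodic in the angles, and analytic near `𝕋ˡ × M × {0}`. -/
structure IsPeriodicAnalytic (M : Set (Fin j → ℝ)) (X : Phase l j × ℝ → E) : Prop where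
  periodic : ∀ k p κ, X (p + latticeShift j k, κ) = X (p, κ)
  analyticAt : ∀ p ∈ overTorus l M, AnalyticAt ℝ X (p, 0)

theorem analyticAt_add_iff_of_periodic {F : Type*} [NormedAddCommGroup F] [NormedSpace ℝ F]
    {f : F → E} {v : F} (hf : ∀ x, f (x + v) = f x) {x : F} (h : AnalyticAt ℝ f x) :
    AnalyticAt ℝ f (x + v) := by
  have h1 : AnalyticAt ℝ (fun y => f (y - v)) (x + v) := by
    refine AnalyticAt.fun_comp (g := f) (f := fun y => y - v) (by simpa using h) ?_
    exact analyticAt_id.sub analyticAt_const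
  refine h1.congr (Eventually.of_forall fun y => ?_)
  simpa using (hf (y - v)).symm

theorem IsPeriodicAnalytic.isAnalyticFamily [CompleteSpace E] (hM : IsOpen M)
    (hX : IsPeriodicAnalytic M X) : IsAnalyticFamily M X := by
  intro K hKM hK
  obtain ⟨U, hU, hKU, hUM, κ₀, hκ₀, H⟩ := exists_forall_overTorus (l := l) hM
    (Q := fun p κ => AnalyticAt ℝ X (p, κ))
    (fun k p κ h => by
      have := analyticAt_add_iff_of_periodic (v := ((latticeShift j k, 0) : Phase l j × ℝ))
        (fun x => by
          have := hX.periodic k x.1 x.2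
          rwa [show x + (latticeShift j k, 0) = (x.1 + latticeShift j k, x.2) by ext <;> simp]) h
      simpa using this)
    (fun p hp => (hX.analyticAt p hp).eventually_analyticAt) hK hKM
  refine ⟨U, hU, hKU, hUM, κ₀, hκ₀, ?_, fun k θ J _ κ _ => ?_⟩
  · rintro ⟨p, κ⟩ ⟨hp, hκ⟩
    exact H κ (abs_lt.2 hκ) p hp
  · simpa [latticeShift] using hX.periodic k (θ, J) κ

theorem IsPeriodicAnalytic.analyticOnNhd_torusAverage {X : Phase l j × ℝ → Phase l j}
    (hX : IsPeriodicAnalytic M X) : AnalyticOnNhd ℝ (torusAverage X) M := by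
  intro J hJ
  have h := analyticAt_setIntegral_of_isCompact (ν := volume) (g := fun _ => (1 : ℝ))
    (K := Icc (0 : Fin l → ℝ) 1) (p₀ := J) (h := fun q : (Fin l → ℝ) × (Fin j → ℝ) => X (q, 0))
    isCompact_Icc (integrableOn_const isCompact_Icc.measure_lt_top.ne)
    (fun θ _ => AnalyticAt.fun_comp (g := X) (hX.analyticAt (θ, J) (mem_overTorus.2 hJ))
      (analyticAt_id.prod analyticAt_const))
  simpa only [one_smul] using! h

/-- The constant `w` disappears on differentiation. The case `w = v` serves equivariant flows, and
`w = 0` serves periodic families. -/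
theorem slopeQuotient_add {P F : Type*} [NormedAddCommGroup P] [NormedSpace ℝ P]
    [NormedAddCommGroup F] [NormedSpace ℝ F] {Z : P × ℝ → F} {v : P} {w : F}
    (hZ : ∀ p ε, Z (p + v, ε) = Z (p, ε) + w) (p : P) (ε : ℝ) :
    slopeQuotient Z (p + v, ε) = slopeQuotient Z (p, ε) := by
  have h (q : P × ℝ) : fderiv ℝ Z (q + (v, 0)) = fderiv ℝ Z q := by
    rw [← fderiv_comp_add_right, ← fderiv_add_const (f := Z) w]
    congr 1
    ext1 q
    rw [show q + (v, 0) = (q.1 + v, q.2) by ext <;> simp]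
    exact hZ q.1 q.2
  unfold slopeQuotient
  refine integral_congr_ae (Eventually.of_forall fun t => ?_)
  have := h (p, t * ε)
  simp only [Prod.mk_add_mk, add_zero] at this
  simp only [this]

end PeriodicAnalytic

/-! ### Consequence of volume preservation for the leading perturbation. -/

section DriftMap

variable {l j : ℕ} {M : Set (Fin j → ℝ)} {ω₀ : Fin l → ℝ} {A : (Fin j → ℝ) × ℝ → Phase l j} {m : ℕ}
  {X : Phase l j × ℝ → Phase l j}

/-- A perturbation of order `m` of the angle-independent map `p ↦ p + (ω₀, 0) + A (p.2, κ)`. -/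
def driftMap (ω₀ : Fin l → ℝ) (A : (Fin j → ℝ) × ℝ → Phase l j) (m : ℕ)
    (X : Phase l j × ℝ → Phase l j) (κ : ℝ) (p : Phase l j) : Phase l j :=
  p + (ω₀, 0) + A (p.2, κ) + κ ^ m • X (p, κ)

theorem driftMap_add (hX : IsPeriodicAnalytic M X) (k : Fin l → ℤ) (p : Phase l j) (κ : ℝ) :
    driftMap ω₀ A m X κ (p + latticeShift j k) = driftMap ω₀ A m X κ p + latticeShift j k := by
  have : (p + latticeShift j k).2 = p.2 := by simp [latticeShift]
  simp only [driftMap, hX.periodic, this]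
  abel

theorem analyticAt_drift_snd {p : Phase l j} {κ : ℝ} (hA : AnalyticAt ℝ A (p.2, κ)) :
    AnalyticAt ℝ (fun q : Phase l j × ℝ => A (q.1.2, q.2)) (p, κ) :=
  AnalyticAt.fun_comp (g := A) (f := fun q : Phase l j × ℝ => (q.1.2, q.2)) hA
    (ContDiff.contDiffAt (n := ω) (by fun_prop)).analyticAt

theorem analyticAt_driftMap {p : Phase l j} {κ : ℝ} (hA : AnalyticAt ℝ A (p.2, κ))
    (hX : AnalyticAt ℝ X (p, κ)) :
    AnalyticAt ℝ (fun q : Phase l j × ℝ => driftMap ω₀ A m X q.2 q.1) (p, κ) :=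
  ((analyticAt_fst.add analyticAt_const).add (analyticAt_drift_snd hA)).add
    ((analyticAt_snd.pow m).smul hX)

theorem driftMap_zero (hm : m ≠ 0) {p : Phase l j} (hA : A (p.2, 0) = 0) :
    driftMap ω₀ A m X 0 p = p + (ω₀, 0) := by
  simp [driftMap, hA, hm]

/-- If the maps `driftMap ω₀ A m X κ` are volume-preserving, the divergence of the leading term of
the perturbation does not depend on the angles. -/
theorem traceCLM_fderiv_eq_of_det_driftMap (hA : ∀ I ∈ M, AnalyticAt ℝ A (I, 0))
    (hA0 : ∀ I, A (I, 0) = 0) (hm : m ≠ 0) (hX : IsPeriodicAnalytic M X)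
    (hdet : ∀ p ∈ overTorus l M, ∀ᶠ q : Phase l j × ℝ in 𝓝 (p, 0),
      (fderiv ℝ (driftMap ω₀ A m X q.2) q.1).det = 1)
    {p p' : Phase l j} (hp : p ∈ overTorus l M) (hpp : p'.2 = p.2) :
    traceCLM _ (fderiv ℝ (fun q => X (q, 0)) p')
      = traceCLM _ (fderiv ℝ (fun q => X (q, 0)) p) := by
  let E := Phase l j
  -- `B` is taken at p but serves equally for p': A does not see the angles. Hence the limit below
  -- is the same for both points.
  let B : ℝ → E →L[ℝ] E := fun κ => .id ℝ E +
    (fderiv ℝ (fun q : E × ℝ => A (q.1.2, q.2)) (p, κ)).comp (.inl ℝ E ℝ)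
  let C : E → ℝ → E →L[ℝ] E := fun p κ => (fderiv ℝ X (p, κ)).comp (.inl ℝ E ℝ)
  have hI : p.2 ∈ M := mem_overTorus.1 hp
  have key (q : E) (hq : q.2 = p.2) :
      (∀ᶠ κ in 𝓝 (0 : ℝ), (B κ + κ ^ m • C q κ).det = 1) ∧ Tendsto (C q) (𝓝 0) (𝓝 (C q 0)) ∧
      fderiv ℝ (fun q => X (q, 0)) q = C q 0 := by
    have hqM : q ∈ overTorus l M := mem_overTorus.2 (hq ▸ hI)
    have hc : Tendsto (fun κ : ℝ => (q, κ)) (𝓝 0) (𝓝 (q, 0)) :=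
      Continuous.tendsto (by fun_prop) _
    have hXq := hX.analyticAt q hqM
    refine ⟨?_, ?_, ?_⟩
    · have hAq : AnalyticAt ℝ (fun q : E × ℝ => A (q.1.2, q.2)) (q, 0) :=
        analyticAt_drift_snd (by rw [hq]; exact hA _ hI)
      filter_upwards [hc.eventually (hdet q hqM), hc.eventually hXq.eventually_analyticAt,
        hc.eventually hAq.eventually_analyticAt] with κ h1 h2 h3
      have hAA : (fderiv ℝ (fun q : E × ℝ => A (q.1.2, q.2)) (q, κ))
          = fderiv ℝ (fun q : E × ℝ => A (q.1.2, q.2)) (p, κ) := by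
        have hf : (fun q : E × ℝ => A (q.1.2, q.2))
            = fun q' => (fun q : E × ℝ => A (q.1.2, q.2)) (q' + (p - q, 0)) := by
          ext1 q'
          have h6 : (q'.1 + (p - q)).2 = q'.1.2 := by
            change q'.1.2 + (p.2 - q.2) = q'.1.2
            rw [hq, sub_self, add_zero]
          change _ = A ((q'.1 + (p - q)).2, q'.2 + 0)
          rw [h6, add_zero]
        conv_lhs => rw [hf]
        refine (fderiv_comp_add_right (f := fun q : E × ℝ => A (q.1.2, q.2)) _).trans ?_
        simp
      rw [← h1]
      congr 1
      refine HasFDerivAt.fderiv ?_ |>.symm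
      have h4 := hasFDerivAt_comp_prodMk_left h2.differentiableAt
      have h5 := hasFDerivAt_comp_prodMk_left h3.differentiableAt
      rw [hAA] at h5
      exact (((hasFDerivAt_id q).add_const (ω₀, 0)).add h5).add (h4.const_smul (κ ^ m))
    · exact (hXq.fderiv.continuousAt.clm_comp continuousAt_const).tendsto.comp hc
    · exact (hasFDerivAt_comp_prodMk_left hXq.differentiableAt).fderiv
  have hB : Tendsto B (𝓝 0) (𝓝 (.id ℝ E)) := by
    have hAp : AnalyticAt ℝ (fun q : E × ℝ => A (q.1.2, q.2)) (p, 0) :=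
      analyticAt_drift_snd (hA _ hI)
    have h0 : (fderiv ℝ (fun q : E × ℝ => A (q.1.2, q.2)) (p, 0)).comp (.inl ℝ E ℝ) = 0 := by
      have h1 := hasFDerivAt_comp_prodMk_left hAp.differentiableAt
      simp only [hA0] at h1
      exact h1.unique (hasFDerivAt_const _ _)
    have hc : Tendsto (fun κ : ℝ => (p, κ)) (𝓝 0) (𝓝 (p, 0)) :=
      Continuous.tendsto (by fun_prop) _
    have := (hAp.fderiv.continuousAt.clm_comp
      (continuousAt_const (y := ContinuousLinearMap.inl ℝ E ℝ))).tendsto.comp hc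
    rw [h0] at this
    simpa using! this.const_add (ContinuousLinearMap.id ℝ E)
  have lim (q : E) (hq : q.2 = p.2) : Tendsto
      (fun κ : ℝ => (κ ^ m)⁻¹ * (1 - (B κ).det)) (𝓝[≠] 0) (𝓝 (traceCLM E (C q 0))) := by
    obtain ⟨k1, k2, -⟩ := key q hq
    have hpow : Tendsto (fun κ : ℝ => κ ^ m) (𝓝 0) (𝓝 0) := by
      simpa [hm] using (continuous_pow (M := ℝ) m).tendsto 0
    have t1 : Tendsto (fun κ => (B κ + κ ^ m • C q κ, B κ)) (𝓝 0)
        (𝓝 (ContinuousLinearMap.id ℝ E, ContinuousLinearMap.id ℝ E)) := by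
      refine Tendsto.prodMk_nhds ?_ hB
      simpa using hB.add (hpow.smul k2)
    -- Strict differentiability is essential: it compares det(B + κᵐC) with det B up to o(κᵐ),
    -- although B itself may differ from the identity by lower powers of κ.
    have t2 := (hasStrictFDerivAt_det_id (E := E)).isLittleO.comp_tendsto t1
    have t3 : (fun κ => κ ^ m • C q κ) =O[𝓝 0] fun κ : ℝ => κ ^ m := by
      simpa using (Asymptotics.isBigO_refl (fun κ : ℝ => κ ^ m) (𝓝 0)).smul (k2.isBigO_one ℝ)
    have t4 : (fun κ : ℝ => 1 - (B κ).det - κ ^ m * traceCLM E (C q κ)) =o[𝓝 0]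
        fun κ : ℝ => κ ^ m := by
      refine (t2.trans_isBigO ?_).congr' ?_ EventuallyEq.rfl
      · simpa [Function.comp_def] using! t3
      · filter_upwards [k1] with κ hκ
        simp [hκ]
    have t5 := (t4.tendsto_div_nhds_zero.mono_left nhdsWithin_le_nhds).add
      ((((traceCLM E).continuous.tendsto _).comp k2).mono_left
        (nhdsWithin_le_nhds (s := {0}ᶜ)))
    rw [zero_add] at t5
    refine t5.congr' ?_
    filter_upwards [self_mem_nhdsWithin] with κ hκ
    have : κ ^ m ≠ 0 := pow_ne_zero _ hκ
    simp only [Function.comp_apply]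
    field_simp
    ring
  rw [(key p' hpp).2.2, (key p rfl).2.2]
  exact tendsto_nhds_unique (lim p' hpp) (lim p rfl)

end DriftMap

/-! ### Conjugation by the flow at time κᵐ. -/

section TorusFlow

variable {l j : ℕ} {M : Set (Fin j → ℝ)} {ω₀ : Fin l → ℝ} {A : (Fin j → ℝ) × ℝ → Phase l j} {m : ℕ}
  {X : Phase l j × ℝ → Phase l j} {V₀ : Phase l j → Phase l j} {φ : Phase l j × ℝ → Phase l j}

/-- The properties used of the local flow `φ` on `𝕋ˡ × M` of a divergence-free field `V₀`. -/
structure IsDivergenceFreeFlow (M : Set (Fin j → ℝ)) (V₀ : Phase l j → Phase l j)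
    (φ : Phase l j × ℝ → Phase l j) : Prop where
  zero : ∀ p, φ (p, 0) = p
  add_latticeShift : ∀ k p ε, φ (p + latticeShift j k, ε) = φ (p, ε) + latticeShift j k
  analyticAt : ∀ p ∈ overTorus l M, AnalyticAt ℝ φ (p, 0)
  fderiv_zero : ∀ p ∈ overTorus l M, fderiv ℝ φ (p, 0) (0, 1) = V₀ p
  neg_right : ∀ p ∈ overTorus l M, ∀ᶠ q : Phase l j × ℝ in 𝓝 (p, 0), φ (φ q, -q.2) = q.1
  det_fderiv : ∀ p ∈ overTorus l M, ∀ᶠ q : Phase l j × ℝ in 𝓝 (p, 0),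
    (fderiv ℝ (fun p => φ (p, q.2)) q.1).det = 1

theorem isDivergenceFreeFlow_flowMap (hM : IsOpen M) (hV : AnalyticOnNhd ℝ V₀ (overTorus l M))
    (hper : ∀ k p, V₀ (p + latticeShift j k) = V₀ p)
    (htr : ∀ p ∈ overTorus l M, traceCLM _ (fderiv ℝ V₀ p) = 0) :
    IsDivergenceFreeFlow M V₀ (flowMap V₀ (overTorus l M)) where
  zero := flowMap_zero _ _
  add_latticeShift k := flowMap_add hV (fun _ => add_latticeShift_mem_overTorus k) (hper k)
  analyticAt _ hp := (flowMap_local (isOpen_overTorus hM) hV hp).1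
  fderiv_zero _ hp := fderiv_flowMap_zero (isOpen_overTorus hM) hV hp
  neg_right _ hp := (flowMap_local (isOpen_overTorus hM) hV hp).2.mono fun _ hq =>
    flowMap_flowMap_neg hV hq.1
  det_fderiv _ hp := eventually_det_fderiv_flowMap (isOpen_overTorus hM) hV hp htr

theorem tendsto_prodMk_pow {F : Type*} [TopologicalSpace F] (hm : m ≠ 0) (p : F) :
    Tendsto (fun q : F × ℝ => (q.1, q.2 ^ m)) (𝓝 (p, 0)) (𝓝 (p, 0)) :=
  Continuous.tendsto' (by fun_prop) _ _ (by simp [hm])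

namespace IsDivergenceFreeFlow

theorem tendsto (hφ : IsDivergenceFreeFlow M V₀ φ) {p : Phase l j} (hp : p ∈ overTorus l M) :
    Tendsto φ (𝓝 (p, 0)) (𝓝 p) := by
  simpa [hφ.zero] using (hφ.analyticAt p hp).continuousAt.tendsto

/-- This quotient is the pair (T, S) of the decoupling transformation: κᵐ times it is the
displacement of the flow at time κᵐ. -/
theorem isPeriodicAnalytic (hφ : IsDivergenceFreeFlow M V₀ φ) (hm : m ≠ 0) :
    IsPeriodicAnalytic M fun q : Phase l j × ℝ => slopeQuotient φ (q.1, q.2 ^ m) where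
  periodic k p κ := slopeQuotient_add (hφ.add_latticeShift k) p _
  analyticAt p hp := by
    refine AnalyticAt.fun_comp (g := slopeQuotient φ) ?_
      (ContDiff.contDiffAt (n := ω) (by fun_prop)).analyticAt
    simpa [hm] using analyticAt_slopeQuotient (hφ.analyticAt p hp)

theorem eventually_nearIdentity (hφ : IsDivergenceFreeFlow M V₀ φ) (hm : m ≠ 0) {p : Phase l j}
    (hp : p ∈ overTorus l M) : ∀ᶠ q : Phase l j × ℝ in 𝓝 (p, 0),
      nearIdentity m (fun q : Phase l j × ℝ => slopeQuotient φ (q.1, q.2 ^ m)) q.2 q.1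
        = φ (q.1, q.2 ^ m) := by
  filter_upwards [(tendsto_prodMk_pow hm p).eventually
    (eventually_eq_add_smul_slopeQuotient (hφ.analyticAt p hp))] with q hq
  rw [hq, hφ.zero]
  rfl

theorem fderiv_zero_apply (hφ : IsDivergenceFreeFlow M V₀ φ) {p : Phase l j}
    (hp : p ∈ overTorus l M) (v : Phase l j) (s : ℝ) :
    fderiv ℝ φ (p, 0) (v, s) = v + s • V₀ p := by
  have h := hasFDerivAt_comp_prodMk_left (hφ.analyticAt p hp).differentiableAt
  simp only [hφ.zero] at h
  have h1 := DFunLike.congr_fun (h.unique (hasFDerivAt_id p)) v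
  have h2 : ((v, s) : Phase l j × ℝ) = (v, 0) + s • (0, 1) := by simp
  rw [h2, map_add, map_smul, hφ.fderiv_zero p hp]
  congr 1

/-- The map `driftMap ω₀ A m X κ` in the coordinates given by the flow at time `κ ^ m`. -/
def conjMap (φ : Phase l j × ℝ → Phase l j) (f : ℝ → Phase l j → Phase l j) (m : ℕ) (κ : ℝ)
    (p : Phase l j) : Phase l j :=
  φ (f κ (φ (p, κ ^ m)), -κ ^ m)

/-- The time ε = κᵐ is first treated as a variable independent of κ. The deviation `H` from the old
drift vanishes at ε = 0, so a Hadamard quotient in ε extracts κᵐ. By the cohomological equation this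
quotient equals the average at κ = 0, and a second quotient, in κ, extracts one more power. -/
theorem exists_conj (hφ : IsDivergenceFreeFlow M V₀ φ) (hM : IsOpen M) (hm : m ≠ 0)
    (hA : ∀ I ∈ M, AnalyticAt ℝ A (I, 0)) (hA0 : ∀ I, A (I, 0) = 0) (hX : IsPeriodicAnalytic M X)
    (hV : ∀ p ∈ overTorus l M, V₀ (p + (ω₀, 0)) - V₀ p = X (p, 0) - torusAverage X p.2) :
    ∃ Y, IsPeriodicAnalytic M Y ∧ ∀ p ∈ overTorus l M, ∀ᶠ q : Phase l j × ℝ in 𝓝 (p, 0),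
      conjMap φ (driftMap ω₀ A m X) m q.2 q.1
        = driftMap ω₀ (fun x => A x + x.2 ^ m • torusAverage X x.1) (m + 1) Y q.2 q.1 := by
  let f : (Phase l j × ℝ) × ℝ → Phase l j := fun x =>
    φ (x.1.1, x.2) + (ω₀, 0) + A ((φ (x.1.1, x.2)).2, x.1.2) + x.2 • X (φ (x.1.1, x.2), x.1.2)
  let H : (Phase l j × ℝ) × ℝ → Phase l j := fun x =>
    φ (f x, -x.2) - x.1.1 - (ω₀, 0) - A (x.1.1.2, x.1.2)
  let Z : Phase l j × ℝ → Phase l j := fun q => slopeQuotient H (q, q.2 ^ m)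
  have hsnd (p : Phase l j) (k : Fin l → ℤ) : (p + latticeShift j k).2 = p.2 := by
    simp [latticeShift]
  have hfper (k : Fin l → ℤ) (p : Phase l j) (κ ε : ℝ) :
      f ((p + latticeShift j k, κ), ε) = f ((p, κ), ε) + latticeShift j k := by
    simp only [f, hφ.add_latticeShift, hsnd, hX.periodic]
    abel
  have hHper (k : Fin l → ℤ) (p : Phase l j) (κ ε : ℝ) :
      H ((p + latticeShift j k, κ), ε) = H ((p, κ), ε) := by
    simp only [H, hfper, hφ.add_latticeShift, hsnd]
    abel
  have hZper (k : Fin l → ℤ) (p : Phase l j) (κ : ℝ) : Z (p + latticeShift j k, κ) = Z (p, κ) := by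
    have := slopeQuotient_add (Z := H) (v := (latticeShift j k, 0)) (w := 0)
      (fun q ε => by
        rw [show q + (latticeShift j k, 0) = (q.1 + latticeShift j k, q.2) by ext <;> simp, add_zero]
        exact hHper k q.1 q.2 ε) (p, κ) (κ ^ m)
    rwa [Prod.mk_add_mk, add_zero] at this
  have hmem (p : Phase l j) (hp : p ∈ overTorus l M) : p + (ω₀, 0) ∈ overTorus l M := by
    simpa [mem_overTorus] using mem_overTorus.1 hp
  have hf0 (p : Phase l j) : f ((p, 0), 0) = p + (ω₀, 0) := by simp [f, hφ.zero, hA0]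
  have hHan (p : Phase l j) (hp : p ∈ overTorus l M) : AnalyticAt ℝ H ((p, 0), 0) := by
    have a1 : AnalyticAt ℝ (fun x : (Phase l j × ℝ) × ℝ => φ (x.1.1, x.2)) ((p, 0), 0) :=
      AnalyticAt.fun_comp (g := φ) (f := fun x : (Phase l j × ℝ) × ℝ => (x.1.1, x.2))
        (hφ.analyticAt p hp) (ContDiff.contDiffAt (n := ω) (by fun_prop)).analyticAt
    have a2 : AnalyticAt ℝ (fun x : (Phase l j × ℝ) × ℝ => x.1.2) ((p, 0), 0) :=
      (ContDiff.contDiffAt (n := ω) (by fun_prop)).analyticAt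
    have a3 : AnalyticAt ℝ (fun x : (Phase l j × ℝ) × ℝ => A ((φ (x.1.1, x.2)).2, x.1.2))
        ((p, 0), 0) := by
      refine AnalyticAt.fun_comp (g := A)
        (f := fun x : (Phase l j × ℝ) × ℝ => ((φ (x.1.1, x.2)).2, x.1.2)) ?_ ?_
      · simpa [hφ.zero] using hA _ (mem_overTorus.1 hp)
      · exact (analyticAt_snd.fun_comp a1).prod a2
    have a4 : AnalyticAt ℝ (fun x : (Phase l j × ℝ) × ℝ => X (φ (x.1.1, x.2), x.1.2))
        ((p, 0), 0) := by
      refine AnalyticAt.fun_comp (g := X)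
        (f := fun x : (Phase l j × ℝ) × ℝ => (φ (x.1.1, x.2), x.1.2)) ?_ (a1.prod a2)
      simpa [hφ.zero] using hX.analyticAt p hp
    have a5 : AnalyticAt ℝ f ((p, 0), 0) :=
      ((a1.add analyticAt_const).add a3).add (analyticAt_snd.smul a4)
    have a6 : AnalyticAt ℝ (fun x => φ (f x, -x.2)) ((p, 0), 0) := by
      refine AnalyticAt.fun_comp (g := φ) (f := fun x : (Phase l j × ℝ) × ℝ => (f x, -x.2)) ?_
        (a5.prod analyticAt_snd.neg)
      simpa [hf0] using hφ.analyticAt _ (hmem p hp)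
    have a7 : AnalyticAt ℝ (fun x : (Phase l j × ℝ) × ℝ => A (x.1.1.2, x.1.2)) ((p, 0), 0) :=
      AnalyticAt.fun_comp (g := A) (f := fun x : (Phase l j × ℝ) × ℝ => (x.1.1.2, x.1.2))
        (hA _ (mem_overTorus.1 hp)) (ContDiff.contDiffAt (n := ω) (by fun_prop)).analyticAt
    exact ((a6.sub (analyticAt_fst.fun_comp analyticAt_fst)).sub analyticAt_const).sub a7
  have hZan (p : Phase l j) (hp : p ∈ overTorus l M) : AnalyticAt ℝ Z (p, 0) := by
    refine AnalyticAt.fun_comp (g := slopeQuotient H) (f := fun q : Phase l j × ℝ => (q, q.2 ^ m))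
      ?_ (ContDiff.contDiffAt (n := ω) (by fun_prop)).analyticAt
    simpa [hm] using analyticAt_slopeQuotient (hHan p hp)
  -- The ε-derivative at κ = ε = 0 collects V₀(p) from the inner flow, X(p, 0) from the perturbation
  -- and -V₀(p + ω₀) from the outer flow. A drops out as it vanishes at κ = 0.
  have hZ0 (p : Phase l j) (hp : p ∈ overTorus l M) : Z (p, 0) = torusAverage X p.2 := by
    have d0 : HasDerivAt (fun ε : ℝ => (p, ε)) (0, 1) 0 :=
      (hasDerivAt_const 0 p).prodMk (hasDerivAt_id 0)
    have d1 : HasDerivAt (fun ε : ℝ => φ (p, ε)) (V₀ p) 0 := by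
      rw [← hφ.fderiv_zero p hp]
      exact (hφ.analyticAt p hp).differentiableAt.hasFDerivAt.comp_hasDerivAt (0 : ℝ) d0
    have d2 : HasDerivAt (fun ε : ℝ => X (φ (p, ε), 0))
        (fderiv ℝ X (p, 0) (V₀ p, 0)) 0 := by
      have : HasFDerivAt X (fderiv ℝ X (p, 0)) (φ (p, 0), 0) := by
        rw [hφ.zero]; exact (hX.analyticAt p hp).differentiableAt.hasFDerivAt
      exact this.comp_hasDerivAt (0 : ℝ) (f := fun ε : ℝ => (φ (p, ε), (0 : ℝ)))
        (d1.prodMk (hasDerivAt_const (0 : ℝ) (0 : ℝ)))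
    have d3 : HasDerivAt (fun ε : ℝ => f ((p, 0), ε)) (V₀ p + X (p, 0)) 0 := by
      have := (d1.add_const (ω₀, 0)).add ((hasDerivAt_id (0 : ℝ)).smul d2)
      simpa [f, hA0, hφ.zero] using! this
    have d4 : HasDerivAt (fun ε : ℝ => H ((p, 0), ε)) (V₀ p + X (p, 0) - V₀ (p + (ω₀, 0))) 0 := by
      have e1 : HasFDerivAt φ (fderiv ℝ φ (p + (ω₀, 0), 0)) (f ((p, 0), 0), -(0 : ℝ)) := by
        rw [hf0, neg_zero]
        exact (hφ.analyticAt _ (hmem p hp)).differentiableAt.hasFDerivAt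
      have e2 := e1.comp_hasDerivAt (0 : ℝ) (d3.prodMk (hasDerivAt_neg (0 : ℝ)))
      rw [hφ.fderiv_zero_apply (hmem p hp)] at e2
      have e3 : HasDerivAt (fun ε : ℝ => H ((p, 0), ε)) _ 0 :=
        ((e2.sub_const p).sub_const (ω₀, 0)).sub_const (A (p.2, 0))
      rwa [neg_one_smul, ← sub_eq_add_neg] at e3
    have d5 : HasDerivAt (fun ε : ℝ => H ((p, 0), ε)) (fderiv ℝ H ((p, 0), 0) (0, 1)) 0 :=
      (hHan p hp).differentiableAt.hasFDerivAt.comp_hasDerivAt (0 : ℝ)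
        ((hasDerivAt_const 0 _).prodMk (hasDerivAt_id 0))
    have d6 : Z (p, 0) = fderiv ℝ H ((p, 0), 0) (0, 1) := by
      simp only [Z, zero_pow hm, slopeQuotient_zero]
    rw [d6, d5.unique d4]
    have := hV p hp
    rw [sub_eq_sub_iff_add_eq_add] at this
    rw [sub_eq_iff_eq_add, add_comm (V₀ p), ← this]
    abel
  have hZ : IsPeriodicAnalytic M Z := ⟨hZper, hZan⟩
  refine ⟨slopeQuotient Z, ⟨fun k p κ => slopeQuotient_add (w := 0)
    (fun p κ => by rw [hZper, add_zero]) p κ, fun p hp => analyticAt_slopeQuotient (hZan p hp)⟩,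
    fun p hp => ?_⟩
  have t1 : Tendsto (fun q : Phase l j × ℝ => (q, q.2 ^ m)) (𝓝 (p, 0)) (𝓝 ((p, 0), 0)) :=
    Continuous.tendsto' (by fun_prop) _ _ (by simp [hm])
  have t2 : ∀ᶠ q : Phase l j × ℝ in 𝓝 (p, 0), q.1 ∈ overTorus l M :=
    continuousAt_fst.eventually_mem ((isOpen_overTorus hM).mem_nhds hp)
  filter_upwards [t1.eventually (eventually_eq_add_smul_slopeQuotient (hHan p hp)),
    eventually_eq_add_smul_slopeQuotient (hZan p hp), t2] with q h1 h2 h3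
  rw [hZ0 _ h3] at h2
  have hH0 : H (q, 0) = 0 := by
    simp only [H, f, hφ.zero, neg_zero, zero_smul]
    abel
  rw [hH0, zero_add, show slopeQuotient H (q, q.2 ^ m) = Z q from rfl, h2] at h1
  have h4 : conjMap φ (driftMap ω₀ A m X) m q.2 q.1
      = H (q, q.2 ^ m) + q.1 + (ω₀, 0) + A (q.1.2, q.2) := by
    simp only [H, f, conjMap, driftMap]
    abel
  rw [h4, h1, driftMap, smul_add, smul_smul, ← pow_succ]
  abel

end IsDivergenceFreeFlow

end TorusFlow

/-! ### From pointwise conjugacies to locally uniform ones, and the averaging step. -/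

section LocalConjugacy

variable {l j : ℕ} {M : Set (Fin j → ℝ)} {ω₀ : Fin l → ℝ} {A : (Fin j → ℝ) × ℝ → Phase l j} {m : ℕ}
  {X : Phase l j × ℝ → Phase l j} {V₀ : Phase l j → Phase l j} {φ : Phase l j × ℝ → Phase l j}
  {Φ Ψ f g : ℝ → Phase l j → Phase l j}

/-- `Φ κ` conjugates `f κ` to `g κ` near each point of `𝕋ˡ × M × {0}`, with inverse `Ψ κ`. -/
structure IsLocalConjugacy (M : Set (Fin j → ℝ)) (Φ Ψ f g : ℝ → Phase l j → Phase l j) :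
    Prop where
  shift : ∀ F ∈ ({Φ, Ψ, f, g} : Set (ℝ → Phase l j → Phase l j)), ∀ k κ p,
    F κ (p + latticeShift j k) = F κ p + latticeShift j k
  analyticAt : ∀ p ∈ overTorus l M, ∀ᶠ q : Phase l j × ℝ in 𝓝 (p, 0), AnalyticAt ℝ (Φ q.2) q.1
  det_fderiv : ∀ p ∈ overTorus l M, ∀ᶠ q : Phase l j × ℝ in 𝓝 (p, 0),
    (fderiv ℝ (Φ q.2) q.1).det = 1
  left_inv : ∀ p ∈ overTorus l M, ∀ᶠ q : Phase l j × ℝ in 𝓝 (p, 0), Ψ q.2 (Φ q.2 q.1) = q.1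
  right_inv : ∀ p ∈ overTorus l M, ∀ᶠ q : Phase l j × ℝ in 𝓝 (p, 0), Φ q.2 (Ψ q.2 q.1) = q.1
  tendsto : ∀ F ∈ ({Φ, Ψ, g} : Set (ℝ → Phase l j → Phase l j)), ∀ p ∈ overTorus l M,
    Tendsto (fun q : Phase l j × ℝ => (F q.2 q.1).2) (𝓝 (p, 0)) (𝓝 p.2)
  conj : ∀ p ∈ overTorus l M, ∀ᶠ q : Phase l j × ℝ in 𝓝 (p, 0),
    f q.2 (Φ q.2 q.1) = Φ q.2 (g q.2 q.1)

theorem IsLocalConjugacy.mono {M' : Set (Fin j → ℝ)} (h : IsLocalConjugacy M Φ Ψ f g)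
    (hM : M' ⊆ M) : IsLocalConjugacy M' Φ Ψ f g := by
  have H : overTorus l M' ⊆ overTorus l M := prod_mono_right hM
  exact ⟨h.1, fun p hp => h.2 p (H hp), fun p hp => h.3 p (H hp), fun p hp => h.4 p (H hp),
    fun p hp => h.5 p (H hp), fun F hF p hp => h.6 F hF p (H hp), fun p hp => h.7 p (H hp)⟩

theorem eq_comp_sub_add {E : Type*} [AddGroup E] {F : E → E} {v : E}
    (hF : ∀ p, F (p + v) = F p + v) : F = fun p => F (p - v) + v := by
  ext1 p
  rw [← hF, sub_add_cancel]

/-- Equivariance makes each required property periodic, so compactness applies. Injectivity and the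
covering of `K` come from the local inverse `Ψ`. -/
theorem IsLocalConjugacy.isVolumePreservingConjugacy (hM : IsOpen M)
    (h : IsLocalConjugacy M Φ Ψ f g) : IsVolumePreservingConjugacy M Φ f g := by
  have hΦ := h.shift Φ (by simp)
  have hΨ := h.shift Ψ (by simp)
  have hf := h.shift f (by simp)
  have hg := h.shift g (by simp)
  have hmem {F : ℝ → Phase l j → Phase l j} (hF : F ∈ ({Φ, Ψ, g} : Set _)) {U : Set (Fin j → ℝ)}
      (hU : IsOpen U) {p : Phase l j} (hp : p ∈ overTorus l M) (hpU : p ∈ overTorus l U) :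
      ∀ᶠ q : Phase l j × ℝ in 𝓝 (p, 0), F q.2 q.1 ∈ overTorus l U := by
    simp only [mem_overTorus] at hpU ⊢
    exact (h.tendsto F hF p hp).eventually (hU.mem_nhds hpU)
  intro K hKM hK
  obtain ⟨U, hU, hKU, hUM, κ₁, hκ₁, H₁⟩ := exists_forall_overTorus (l := l) hM
    (Q := fun p κ => AnalyticAt ℝ (Φ κ) p ∧ (fderiv ℝ (Φ κ) p).det = 1 ∧ Ψ κ (Φ κ p) = p ∧
      Φ κ p ∈ overTorus l M)
    (fun k p κ ⟨h1, h2, h3, h4⟩ => by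
      refine ⟨?_, ?_, by rw [hΦ, hΨ, h3], by rwa [hΦ, add_latticeShift_mem_overTorus]⟩
      · rw [eq_comp_sub_add (hΦ k κ)]
        refine (AnalyticAt.fun_comp (g := Φ κ) (f := fun y => y - latticeShift j k)
          (by simpa using h1) (analyticAt_id.sub analyticAt_const)).add analyticAt_const
      · rw [eq_comp_sub_add (hΦ k κ), fderiv_add_const, fderiv_comp_sub]
        simpa using h2)
    (fun p hp => (h.analyticAt p hp).and ((h.det_fderiv p hp).and ((h.left_inv p hp).and
      (hmem (by simp) hM hp hp)))) hK hKM
  -- The second compactness argument takes place inside `U`, so that images and preimages of points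
  -- over `K` land in the set already constructed.
  obtain ⟨U', -, hKU', -, κ₂, hκ₂, H₂⟩ := exists_forall_overTorus (l := l) hU
    (Q := fun p κ => Φ κ p ∈ overTorus l U ∧ g κ p ∈ overTorus l U ∧ Ψ κ p ∈ overTorus l U ∧
      Φ κ (Ψ κ p) = p ∧ f κ (Φ κ p) = Φ κ (g κ p))
    (fun k p κ ⟨h1, h2, h3, h4, h5⟩ => by
      simp only [hΦ, hΨ, hf, hg, h4, h5, add_latticeShift_mem_overTorus]
      exact ⟨h1, h2, h3, trivial, trivial⟩)
    (fun p hp => by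
      have hpM : p ∈ overTorus l M := mem_overTorus.2 (hUM (mem_overTorus.1 hp))
      exact (hmem (by simp) hU hpM hp).and ((hmem (by simp) hU hpM hp).and
        ((hmem (by simp) hU hpM hp).and ((h.right_inv p hpM).and (h.conj p hpM))))) hK hKU
  refine ⟨U, hU, hKU, hUM, min κ₁ κ₂, lt_min hκ₁ hκ₂, fun κ hκ => ?_⟩
  have H₁' := H₁ κ (hκ.trans_le (min_le_left _ _))
  have H₂' (p) (hp : p ∈ overTorus l K) := H₂ κ (hκ.trans_le (min_le_right _ _)) p
    (prod_mono_right hKU' hp)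
  refine ⟨fun p hp => (H₁' p hp).1, fun p hp q hq hpq => ?_, fun p hp => (H₁' p hp).2.1,
    fun p hp => (H₁' p hp).2.2.2, fun p hp => ⟨_, (H₂' p hp).2.2.1, (H₂' p hp).2.2.2.1⟩,
    fun p hp => ⟨(H₂' p hp).1, (H₂' p hp).2.1, (H₂' p hp).2.2.2.2⟩⟩
  rw [← (H₁' p hp).2.2.1, hpq, (H₁' q hq).2.2.1]

theorem nearIdentity_eq (m : ℕ) (V : Phase l j × ℝ → Phase l j) (κ : ℝ) (p : Phase l j) :
    nearIdentity m V κ p = p + κ ^ m • V (p, κ) := rfl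

/-- One step of the averaging procedure. -/
theorem exists_decoupling_step (hM : IsOpen M) {c μ : ℝ} (hc : 0 < c) (hμ : 0 < μ)
    (hω : ω₀ ∈ diophantineSet l c μ) (hm : m ≠ 0)
    (hA : ∀ I ∈ M, AnalyticAt ℝ A (I, 0)) (hA0 : ∀ I, A (I, 0) = 0) (hX : IsPeriodicAnalytic M X)
    (hdet : ∀ p ∈ overTorus l M, ∀ᶠ q : Phase l j × ℝ in 𝓝 (p, 0),
      (fderiv ℝ (driftMap ω₀ A m X q.2) q.1).det = 1) :
    ∃ V Y : Phase l j × ℝ → Phase l j, ∃ Ψ, IsPeriodicAnalytic M V ∧ IsPeriodicAnalytic M Y ∧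
      IsLocalConjugacy M (nearIdentity m V) Ψ (driftMap ω₀ A m X)
        (driftMap ω₀ (fun x => A x + x.2 ^ m • torusAverage X x.1) (m + 1) Y) ∧
      ∀ p ∈ overTorus l M, ∀ᶠ q : Phase l j × ℝ in 𝓝 (p, 0),
        (fderiv ℝ (driftMap ω₀ (fun x => A x + x.2 ^ m • torusAverage X x.1) (m + 1) Y q.2)
          q.1).det = 1 := by
  obtain ⟨V₀, hV₀, hVper, hVtr, hVeq⟩ := exists_divergenceFree_solution hM hc hμ hω
    (X := fun p => X (p, 0))
    (fun p hp => AnalyticAt.fun_comp (g := X) (hX.analyticAt p hp)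
      (analyticAt_id.prod analyticAt_const)) (fun k p => hX.periodic k p 0)
    (fun p hp θ => traceCLM_fderiv_eq_of_det_driftMap hA hA0 hm hX hdet hp rfl)
  have hφ := isDivergenceFreeFlow_flowMap hM hV₀ hVper hVtr
  set φ := flowMap V₀ (overTorus l M)
  obtain ⟨Y, hY, hconj⟩ := hφ.exists_conj hM hm hA hA0 hX hVeq
  set f := driftMap ω₀ A m X
  set g := driftMap ω₀ (fun x => A x + x.2 ^ m • torusAverage X x.1) (m + 1) Y
  set V : Phase l j × ℝ → Phase l j := fun q => slopeQuotient φ (q.1, q.2 ^ m)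
  have hV : IsPeriodicAnalytic M V := hφ.isPeriodicAnalytic hm
  have hNI {p : Phase l j} (hp : p ∈ overTorus l M) := hφ.eventually_nearIdentity hm hp
  have hpow (p : Phase l j) := tendsto_prodMk_pow hm p
  have tendsto_snd' (p : Phase l j) :
      Tendsto (fun q : Phase l j × ℝ => q.2) (𝓝 (p, 0)) (𝓝 0) := continuous_snd.tendsto _
  have hpow' (p : Phase l j) : Tendsto (fun q : Phase l j × ℝ => (q.1, -q.2 ^ m)) (𝓝 (p, 0))
    (𝓝 (p, 0)) := Continuous.tendsto' (by fun_prop) _ _ (by simp [hm])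
  have hmem {p : Phase l j} (hp : p ∈ overTorus l M) : p + (ω₀, 0) ∈ overTorus l M := by
    simpa [mem_overTorus] using mem_overTorus.1 hp
  have hA' : ∀ I ∈ M, AnalyticAt ℝ
      (fun x : (Fin j → ℝ) × ℝ => A x + x.2 ^ m • torusAverage X x.1) (I, 0) := fun I hI =>
    (hA I hI).add ((analyticAt_snd.pow m).smul
      (AnalyticAt.fun_comp (g := torusAverage X) (f := Prod.fst)
        (hX.analyticOnNhd_torusAverage I hI) analyticAt_fst))
  have hA0' (I : Fin j → ℝ) :
    (fun x : (Fin j → ℝ) × ℝ => A x + x.2 ^ m • torusAverage X x.1) (I, 0) = 0 := by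
    simp [hA0, hm]
  have hfan {p : Phase l j} (hp : p ∈ overTorus l M) :
      AnalyticAt ℝ (fun q : Phase l j × ℝ => f q.2 q.1) (p, 0) :=
    analyticAt_driftMap (hA _ (mem_overTorus.1 hp)) (hX.analyticAt p hp)
  have hgan {p : Phase l j} (hp : p ∈ overTorus l M) :
      AnalyticAt ℝ (fun q : Phase l j × ℝ => g q.2 q.1) (p, 0) :=
    analyticAt_driftMap (hA' _ (mem_overTorus.1 hp)) (hY.analyticAt p hp)
  have hft {p : Phase l j} (hp : p ∈ overTorus l M) :
      Tendsto (fun q : Phase l j × ℝ => f q.2 q.1) (𝓝 (p, 0)) (𝓝 (p + (ω₀, 0))) := by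
    have := (hfan hp).continuousAt.tendsto
    simpa only [f, driftMap_zero hm (hA0 _)] using! this
  have hgt {p : Phase l j} (hp : p ∈ overTorus l M) :
      Tendsto (fun q : Phase l j × ℝ => g q.2 q.1) (𝓝 (p, 0)) (𝓝 (p + (ω₀, 0))) := by
    have := (hgan hp).continuousAt.tendsto
    rwa [show g 0 p = _ from driftMap_zero (Nat.succ_ne_zero m) (hA0' p.2)] at this
  have hφt {p : Phase l j} (hp : p ∈ overTorus l M) :
      Tendsto (fun q : Phase l j × ℝ => (φ (q.1, q.2 ^ m), q.2)) (𝓝 (p, 0)) (𝓝 (p, 0)) :=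
    ((hφ.tendsto hp).comp (hpow p)).prodMk_nhds (tendsto_snd' p)
  have hΨt {p : Phase l j} (hp : p ∈ overTorus l M) :
      Tendsto (fun q : Phase l j × ℝ => (φ (q.1, -q.2 ^ m), q.2)) (𝓝 (p, 0)) (𝓝 (p, 0)) :=
    ((hφ.tendsto hp).comp (hpow' p)).prodMk_nhds (tendsto_snd' p)
  have hyt {p : Phase l j} (hp : p ∈ overTorus l M) :
      Tendsto (fun q : Phase l j × ℝ => (f q.2 (φ (q.1, q.2 ^ m)), -q.2 ^ m)) (𝓝 (p, 0))
        (𝓝 (p + (ω₀, 0), 0)) := by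
    refine ((hft hp).comp (hφt hp)).prodMk_nhds ?_
    exact (continuous_snd.tendsto _).comp (hpow' p)
  have hNI' {p : Phase l j} (hp : p ∈ overTorus l M) : ∀ᶠ q : Phase l j × ℝ in 𝓝 (p, 0),
      nearIdentity m V q.2 =ᶠ[𝓝 q.1] fun p => φ (p, q.2 ^ m) := by
    filter_upwards [(hNI hp).eventually_nhds] with q hq
    exact (Continuous.tendsto' (f := fun p => (p, q.2)) (by fun_prop) q.1 q rfl).eventually hq
  have hconj' {p : Phase l j} (hp : p ∈ overTorus l M) : ∀ᶠ q : Phase l j × ℝ in 𝓝 (p, 0),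
      g q.2 =ᶠ[𝓝 q.1] IsDivergenceFreeFlow.conjMap φ f m q.2 := by
    filter_upwards [(hconj p hp).eventually_nhds] with q hq
    exact ((Continuous.tendsto' (f := fun p => (p, q.2)) (by fun_prop) q.1 q rfl).eventually
      hq).mono fun _ h => h.symm
  refine ⟨V, Y, fun κ p => φ (p, -κ ^ m), hV, hY, ⟨?_, ?_, ?_, ?_, ?_, ?_, ?_⟩, ?_⟩
  · simp only [mem_insert_iff, mem_singleton_iff, forall_eq_or_imp, forall_eq]
    refine ⟨fun k κ p => ?_, fun k κ p => hφ.add_latticeShift k p _, fun k κ p => driftMap_add hX k p κ,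
      fun k κ p => driftMap_add hY k p κ⟩
    simp only [nearIdentity_eq, hV.periodic]
    abel
  · intro p hp
    filter_upwards [(hV.analyticAt p hp).eventually_analyticAt] with q hq
    have : AnalyticAt ℝ (fun x => V (x, q.2)) q.1 :=
      AnalyticAt.fun_comp (g := V) hq (analyticAt_id.prod analyticAt_const)
    exact analyticAt_id.add ((analyticAt_const (v := q.2 ^ m)).smul this)
  · intro p hp
    filter_upwards [hNI' hp, (hpow p).eventually (hφ.det_fderiv p hp)] with q h1 h2
    rwa [h1.fderiv_eq]
  · intro p hp
    filter_upwards [hNI hp, (hpow p).eventually (hφ.neg_right p hp)] with q h1 h2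
    rwa [h1]
  · intro p hp
    filter_upwards [(hΨt hp).eventually (hNI hp), (hpow' p).eventually (hφ.neg_right p hp)]
      with q h1 h2
    rw [h1]
    simpa using h2
  · simp only [mem_insert_iff, mem_singleton_iff, forall_eq_or_imp, forall_eq]
    refine ⟨fun p hp => ?_, fun p hp => ?_, fun p hp => ?_⟩
    · refine Tendsto.congr' ((hNI hp).mono fun q hq => (congrArg Prod.snd hq).symm) ?_
      exact (continuous_snd.tendsto p).comp ((hφ.tendsto hp).comp (hpow p))
    · exact (continuous_snd.tendsto p).comp ((hφ.tendsto hp).comp (hpow' p))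
    · simpa using! (continuous_snd.tendsto _).comp (hgt hp)
  · intro p hp
    -- The new map is the backward flow of f ∘ Φ. Applying Φ to it undoes the backward flow near p +
    -- (ω₀, 0).
    filter_upwards [hNI hp, ((hgt hp).prodMk_nhds (tendsto_snd' p)).eventually (hNI (hmem hp)),
      hconj p hp, (hyt hp).eventually (hφ.neg_right _ (hmem hp))] with q h1 h2 h3 h4
    rw [h1, h2, ← h3]
    simpa [IsDivergenceFreeFlow.conjMap] using h4.symm
  · intro p hp
    -- By the chain rule the Jacobian is a product of three factors equal to 1. This feeds the next
    -- step of the induction.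
    filter_upwards [hconj' hp, (hpow p).eventually (hφ.det_fderiv p hp), (hφt hp).eventually (hdet p hp),
      (hyt hp).eventually (hφ.det_fderiv _ (hmem hp)),
      (hpow p).eventually (hφ.analyticAt p hp).eventually_analyticAt,
      (hφt hp).eventually (hfan hp).eventually_analyticAt,
      (hyt hp).eventually (hφ.analyticAt _ (hmem hp)).eventually_analyticAt]
      with q h1 h2 h3 h4 h5 h6 h7
    have k1 := hasFDerivAt_comp_prodMk_left h5.differentiableAt
    have k2 := hasFDerivAt_comp_prodMk_left h6.differentiableAt
    have k3 := hasFDerivAt_comp_prodMk_left h7.differentiableAt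
    have k4 : HasFDerivAt (IsDivergenceFreeFlow.conjMap φ f m q.2) _ q.1 :=
      HasFDerivAt.comp (g := fun p => φ (p, -q.2 ^ m)) q.1 k3
        (HasFDerivAt.comp (g := f q.2) q.1 k2 k1)
    rw [h1.fderiv_eq, k4.fderiv]
    rw [k1.fderiv] at h2
    rw [k2.fderiv] at h3
    rw [k3.fderiv] at h4
    refine (LinearMap.det_comp _ _).trans ?_
    refine (congrArg₂ (· * ·) h4 ((LinearMap.det_comp _ _).trans (congrArg₂ (· * ·) h3 h2))).trans ?_
    norm_num

end LocalConjugacy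

/-! ### A block triangular determinant. -/

section BlockDeterminant

variable {E F : Type*} [NormedAddCommGroup E] [NormedSpace ℝ E] [FiniteDimensional ℝ E]
  [NormedAddCommGroup F] [NormedSpace ℝ F] [FiniteDimensional ℝ F]

/-- The matrix is block upper triangular, with the identity as fast block. -/
theorem det_id_add_comp_snd (a : F →L[ℝ] E × F) :
    (.id ℝ (E × F) + a.comp (.snd ℝ E F) : E × F →L[ℝ] E × F).det
      = (.id ℝ F + (ContinuousLinearMap.snd ℝ E F).comp a).det := by
  let b := Module.finBasis ℝ E
  let c := Module.finBasis ℝ F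
  have h : LinearMap.toMatrix (b.prod c) (b.prod c)
      ((.id ℝ (E × F) + a.comp (.snd ℝ E F) : E × F →L[ℝ] E × F) : E × F →ₗ[ℝ] E × F)
      = Matrix.fromBlocks 1 (LinearMap.toMatrix c b (((ContinuousLinearMap.fst ℝ E F).comp a :
          F →L[ℝ] E) : F →ₗ[ℝ] E)) 0
        (LinearMap.toMatrix c c ((.id ℝ F + (ContinuousLinearMap.snd ℝ E F).comp a :
          F →L[ℝ] F) : F →ₗ[ℝ] F)) := by
    ext (i | i) (k | k) <;> simp [LinearMap.toMatrix_apply, Matrix.one_apply, Finsupp.single_apply, eq_comm]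
  rw [ContinuousLinearMap.det, ← LinearMap.det_toMatrix (b.prod c), h,
    Matrix.det_fromBlocks_zero₂₁, Matrix.det_one, one_mul, LinearMap.det_toMatrix]

end BlockDeterminant

/-! ### Approximate volume preservation of the averaged slow map. -/

section Truncation

variable {l j : ℕ} {M : Set (Fin j → ℝ)} {ω₀ : Fin l → ℝ} {A : (Fin j → ℝ) × ℝ → Phase l j} {m : ℕ}
  {X : Phase l j × ℝ → Phase l j}

/-- The full derivative B + κᵐC has determinant 1 and the determinant is Lipschitz near B(I, 0), so
det B = 1 + O(κᵐ). By the block structure det B is the slow Jacobian. As B ignores the angles,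
testing at angle 0 is enough. -/
theorem isBigO_det_fderiv_sub_one (hm : m ≠ 0) (hA : ∀ I ∈ M, AnalyticAt ℝ A (I, 0))
    (hX : ∀ p ∈ overTorus l M, AnalyticAt ℝ X (p, 0))
    (hdet : ∀ p ∈ overTorus l M, ∀ᶠ q : Phase l j × ℝ in 𝓝 (p, 0),
      (fderiv ℝ (driftMap ω₀ A m X q.2) q.1).det = 1) {I : Fin j → ℝ} (hI : I ∈ M) :
    (fun q : (Fin j → ℝ) × ℝ => (fderiv ℝ (fun I => I + (A (I, q.2)).2) q.1).det - 1)
      =O[𝓝 (I, 0)] fun q => q.2 ^ m := by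
  let a : (Fin j → ℝ) × ℝ → (Fin j → ℝ) →L[ℝ] Phase l j := fun q =>
    (fderiv ℝ A q).comp (.inl ℝ (Fin j → ℝ) ℝ)
  let B : (Fin j → ℝ) × ℝ → Phase l j →L[ℝ] Phase l j := fun q =>
    .id ℝ (Phase l j) + (a q).comp (.snd ℝ _ _)
  let C : (Fin j → ℝ) × ℝ → Phase l j →L[ℝ] Phase l j := fun q =>
    (fderiv ℝ X ((0, q.1), q.2)).comp (.inl ℝ (Phase l j) ℝ)
  have hp : ((0, I) : Phase l j) ∈ overTorus l M := mem_overTorus.2 hI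
  have hι : Tendsto (fun q : (Fin j → ℝ) × ℝ => (((0, q.1), q.2) : Phase l j × ℝ)) (𝓝 (I, 0))
      (𝓝 ((0, I), 0)) :=
    Continuous.tendsto (by fun_prop) _
  have h1 : ∀ᶠ q : (Fin j → ℝ) × ℝ in 𝓝 (I, 0),
      (fderiv ℝ (fun I => I + (A (I, q.2)).2) q.1).det = (B q).det := by
    filter_upwards [(hA I hI).eventually_analyticAt] with q hq
    have d1 := hasFDerivAt_comp_prodMk_left hq.differentiableAt
    have d2 : HasFDerivAt (fun I => I + (A (I, q.2)).2)
        (.id ℝ _ + (ContinuousLinearMap.snd ℝ _ _).comp (a q)) q.1 :=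
      (hasFDerivAt_id q.1).add
        ((ContinuousLinearMap.snd ℝ (Fin l → ℝ) (Fin j → ℝ)).hasFDerivAt.comp q.1 d1)
    rw [d2.fderiv]
    exact (det_id_add_comp_snd (a q)).symm
  have h2 : ∀ᶠ q : (Fin j → ℝ) × ℝ in 𝓝 (I, 0), (B q + q.2 ^ m • C q).det = 1 := by
    filter_upwards [(hA I hI).eventually_analyticAt, hι.eventually (hX _ hp).eventually_analyticAt,
      hι.eventually (hdet _ hp)] with q hq hq' h
    rw [← h]
    congr 1
    refine (HasFDerivAt.fderiv ?_).symm
    have d1 := hasFDerivAt_comp_prodMk_left hq.differentiableAt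
    have d2 := hasFDerivAt_comp_prodMk_left hq'.differentiableAt
    have d3 : HasFDerivAt (fun p : Phase l j => A (p.2, q.2)) ((a q).comp (.snd ℝ _ _))
        ((0, q.1) : Phase l j) :=
      HasFDerivAt.comp (g := fun I => A (I, q.2)) _ d1 hasFDerivAt_snd
    exact (((hasFDerivAt_id _).add_const (ω₀, 0)).add d3).add (d2.const_smul (q.2 ^ m))
  have ha : ContinuousAt a (I, 0) := (hA I hI).fderiv.continuousAt.clm_comp continuousAt_const
  have hB : Tendsto B (𝓝 (I, 0)) (𝓝 (B (I, 0))) :=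
    (continuousAt_const.add (ha.clm_comp continuousAt_const)).tendsto
  have hC : Tendsto C (𝓝 (I, 0)) (𝓝 (C (I, 0))) :=
    (((hX _ hp).fderiv.continuousAt.clm_comp
      (continuousAt_const (y := ContinuousLinearMap.inl ℝ (Phase l j) ℝ))).tendsto).comp hι
  have hpow : Tendsto (fun q : (Fin j → ℝ) × ℝ => q.2 ^ m) (𝓝 (I, 0)) (𝓝 0) :=
    Continuous.tendsto' (by fun_prop) _ _ (by simp [hm])
  have h3 : Tendsto (fun q => (B q, B q + q.2 ^ m • C q)) (𝓝 (I, 0))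
      (𝓝 (B (I, 0), B (I, 0))) := by
    refine hB.prodMk_nhds ?_
    simpa using hB.add (hpow.smul hC)
  have h4 := ((contDiff_det (E := Phase l j) (n := 1)).contDiffAt.hasStrictFDerivAt
    (x := B (I, 0)) one_ne_zero).isBigO_sub.comp_tendsto h3
  have h5 : (fun q : (Fin j → ℝ) × ℝ => q.2 ^ m • C q) =O[𝓝 (I, 0)] fun q => q.2 ^ m := by
    simpa using (Asymptotics.isBigO_refl (fun q : (Fin j → ℝ) × ℝ => q.2 ^ m)
      (𝓝 (I, 0))).smul (hC.isBigO_one ℝ)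
  refine (h4.trans ?_).congr' ?_ EventuallyEq.rfl
  · simpa [Function.comp_def] using! h5
  · filter_upwards [h1, h2] with q e1 e2
    simp [e1, e2]

theorem isVolumePreservingUpTo_of_isBigO {n : ℕ} {s : ℝ → (Fin j → ℝ) → (Fin j → ℝ)}
    (h : ∀ I ∈ M, (fun q : (Fin j → ℝ) × ℝ => (fderiv ℝ (s q.2) q.1).det - 1)
      =O[𝓝 (I, 0)] fun q => q.2 ^ (n + 1)) : IsVolumePreservingUpTo M n s := by
  intro K hKM hK
  refine hK.induction_on (p := fun K => ∃ C : ℝ, ∃ κ₀ > 0, ∀ κ : ℝ, |κ| < κ₀ → ∀ I ∈ K,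
    |(fderiv ℝ (s κ) I).det - 1| ≤ C * |κ| ^ (n + 1)) ⟨0, 1, one_pos, by simp⟩ ?_ ?_ ?_
  · rintro S T hST ⟨C, κ₀, hκ₀, H⟩
    exact ⟨C, κ₀, hκ₀, fun κ hκ I hI => H κ hκ I (hST hI)⟩
  · rintro S T ⟨C, κ₀, hκ₀, H⟩ ⟨C', κ₀', hκ₀', H'⟩
    refine ⟨max C C', min κ₀ κ₀', lt_min hκ₀ hκ₀', fun κ hκ I hI => ?_⟩
    rcases hI with hI | hI
    · refine (H κ (hκ.trans_le (min_le_left _ _)) I hI).trans ?_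
      gcongr
      exact le_max_left _ _
    · refine (H' κ (hκ.trans_le (min_le_right _ _)) I hI).trans ?_
      gcongr
      exact le_max_right _ _
  · intro I hI
    obtain ⟨C, hC⟩ := (h I (hKM hI)).bound
    obtain ⟨ε, hε, H⟩ := Metric.eventually_nhds_iff_ball.1 hC
    refine ⟨ball I ε, mem_nhdsWithin_of_mem_nhds (ball_mem_nhds I hε), C, ε, hε,
      fun κ hκ I' hI' => ?_⟩
    have := H (I', κ) (by simpa [Prod.dist_eq] using ⟨hI', hκ⟩)
    simpa using this

end Truncation

/-! ### Replacing locally periodic data by exactly periodic data. -/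

section Periodisation

variable {l j : ℕ} {M : Set (Fin j → ℝ)} {E : Type*} [NormedAddCommGroup E] [NormedSpace ℝ E]
  {X : Phase l j × ℝ → E}

/-- The function with the values of `X` on the fundamental domain, extended periodically. -/
def periodise (X : Phase l j × ℝ → E) (q : Phase l j × ℝ) : E :=
  X ((fun i => Int.fract (q.1.1 i), q.1.2), q.2)

omit [NormedAddCommGroup E] [NormedSpace ℝ E] in
theorem periodise_add (X : Phase l j × ℝ → E) (k : Fin l → ℤ) (p : Phase l j) (κ : ℝ) :
    periodise X (p + latticeShift j k, κ) = periodise X (p, κ) := by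
  simp [periodise, latticeShift]

/-- An angle and its fractional part differ by the integer vector of floors, so local periodicity
forces agreement, also across the faces of the fundamental cube. -/
theorem IsAnalyticFamily.exists_periodise_eq (hX : IsAnalyticFamily M X) {K : Set (Fin j → ℝ)}
    (hK : IsCompact K) (hKM : K ⊆ M) : ∃ U : Set (Fin j → ℝ), IsOpen U ∧ K ⊆ U ∧ U ⊆ M ∧
      ∃ κ₀ > 0, ∀ κ : ℝ, |κ| < κ₀ → ∀ p ∈ overTorus l U,
        periodise X (p, κ) = X (p, κ) ∧ AnalyticAt ℝ X (p, κ) := by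
  obtain ⟨U, hU, hKU, hUM, κ₀, hκ₀, hXa, hXp⟩ := hX K hKM hK
  refine ⟨U, hU, hKU, hUM, κ₀, hκ₀, fun κ hκ p hp => ⟨?_, hXa _ ⟨hp, abs_lt.1 hκ⟩⟩⟩
  have h := hXp (fun i => ⌊p.1 i⌋) (fun i => Int.fract (p.1 i)) p.2 (mem_overTorus.1 hp) κ
    (abs_lt.1 hκ)
  have h1 : ((fun i => Int.fract (p.1 i)) + fun i => ((⌊p.1 i⌋ : ℤ) : ℝ)) = p.1 := by
    ext i
    simp
  rw [h1] at h
  exact h.symm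

theorem IsAnalyticFamily.eventually_periodise_eq (hX : IsAnalyticFamily M X) {p : Phase l j}
    (hp : p ∈ overTorus l M) :
    periodise X =ᶠ[𝓝 (p, 0)] X ∧ AnalyticAt ℝ X (p, 0) := by
  obtain ⟨U, hU, hpU, -, κ₀, hκ₀, H⟩ := hX.exists_periodise_eq isCompact_singleton
    (singleton_subset_iff.2 (mem_overTorus.1 hp))
  have hp' : p ∈ overTorus l U := mem_overTorus.2 (singleton_subset_iff.1 hpU)
  refine ⟨?_, (H 0 (by simpa using hκ₀) p hp').2⟩
  have h1 : ∀ᶠ κ : ℝ in 𝓝 0, |κ| < κ₀ := by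
    simpa [ball, dist_zero_right] using! ball_mem_nhds (0 : ℝ) hκ₀
  filter_upwards [prod_mem_nhds ((isOpen_overTorus hU).mem_nhds hp') h1] with q hq
  exact (H q.2 hq.2 q.1 hq.1).1

theorem IsAnalyticFamily.isPeriodicAnalytic_periodise (hX : IsAnalyticFamily M X) :
    IsPeriodicAnalytic M (periodise X) :=
  ⟨periodise_add X, fun _ hp => (hX.eventually_periodise_eq hp).2.congr
    (hX.eventually_periodise_eq hp).1.symm⟩

theorem IsAnalyticFamily.prodMk {F : Type*} [NormedAddCommGroup F] [NormedSpace ℝ F]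
    {Y : Phase l j × ℝ → F} (hX : IsAnalyticFamily M X) (hY : IsAnalyticFamily M Y) :
    IsAnalyticFamily M fun q => (X q, Y q) := by
  intro K hKM hK
  obtain ⟨U, hU, hKU, hUM, κ₀, hκ₀, hXa, hXp⟩ := hX K hKM hK
  obtain ⟨U', hU', hKU', -, κ₀', hκ₀', hYa, hYp⟩ := hY K hKM hK
  have h1 : Ioo (-(min κ₀ κ₀')) (min κ₀ κ₀') ⊆ Ioo (-κ₀) κ₀ :=
    Ioo_subset_Ioo (neg_le_neg (min_le_left _ _)) (min_le_left _ _)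
  have h2 : Ioo (-(min κ₀ κ₀')) (min κ₀ κ₀') ⊆ Ioo (-κ₀') κ₀' :=
    Ioo_subset_Ioo (neg_le_neg (min_le_right _ _)) (min_le_right _ _)
  refine ⟨U ∩ U', hU.inter hU', subset_inter hKU hKU', inter_subset_left.trans hUM, min κ₀ κ₀',
    lt_min hκ₀ hκ₀', fun q hq => ?_, fun k θ J hJ κ hκ => ?_⟩
  · exact (hXa q ⟨prod_mono_right inter_subset_left hq.1, h1 hq.2⟩).prod
      (hYa q ⟨prod_mono_right inter_subset_right hq.1, h2 hq.2⟩)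
  · simp only [hXp k θ J hJ.1 κ (h1 hκ), hYp k θ J hJ.2 κ (h2 hκ)]

end Periodisation

/-! ### Induction on the order of averaging. -/

section Iteration

variable {l j : ℕ} {M : Set (Fin j → ℝ)} {ω₀ : Fin l → ℝ} {R R' : ℕ → Phase l j × ℝ → Phase l j}
  {m n : ℕ}

/-- The averaged terms up to order `m`. -/
def averagedDrift (R : ℕ → Phase l j × ℝ → Phase l j) (m : ℕ) (x : (Fin j → ℝ) × ℝ) : Phase l j :=
  ∑ i ∈ Finset.Icc 1 m, x.2 ^ i • torusAverage (R i) x.1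

theorem decoupledMap_eq_driftMap (ω₀ : Fin l → ℝ) (R : ℕ → Phase l j × ℝ → Phase l j) (m : ℕ) :
    decoupledMap ω₀ R m = driftMap ω₀ (averagedDrift R m) (m + 1) (R (m + 1)) := by
  funext κ p
  simp [decoupledMap, driftMap, averagedDrift, Prod.ext_iff, Prod.fst_sum, Prod.snd_sum]

theorem averagedSlowMap_eq (R : ℕ → Phase l j × ℝ → Phase l j) (n : ℕ) (κ : ℝ) :
    averagedSlowMap R n κ = fun I => I + (averagedDrift R n (I, κ)).2 := by
  funext I
  simp [averagedSlowMap, averagedDrift, Prod.snd_sum]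

theorem averagedDrift_zero (R : ℕ → Phase l j × ℝ → Phase l j) (m : ℕ) (I : Fin j → ℝ) :
    averagedDrift R m (I, 0) = 0 := by
  refine Finset.sum_eq_zero fun i hi => ?_
  have : i ≠ 0 := by have := (Finset.mem_Icc.1 hi).1; omega
  simp [this]

theorem averagedDrift_succ (R : ℕ → Phase l j × ℝ → Phase l j) (m : ℕ) :
    averagedDrift R (m + 1)
      = fun x => averagedDrift R m x + x.2 ^ (m + 1) • torusAverage (R (m + 1)) x.1 := by
  funext x
  exact Finset.sum_Icc_succ_top (by omega) _

theorem analyticAt_averagedDrift (hR : ∀ i ∈ Finset.Icc 1 m, IsPeriodicAnalytic M (R i))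
    {I : Fin j → ℝ} (hI : I ∈ M) : AnalyticAt ℝ (averagedDrift R m) (I, 0) := by
  refine Finset.analyticAt_fun_sum _ fun i hi => (analyticAt_snd.pow i).smul ?_
  exact AnalyticAt.fun_comp (g := torusAverage (R i)) (f := Prod.fst)
    ((hR i hi).analyticOnNhd_torusAverage I hI) analyticAt_fst

theorem averagedDrift_congr (h : ∀ i ∈ Finset.Icc 1 m, ∀ I ∈ M,
    torusAverage (R i) I = torusAverage (R' i) I) {I : Fin j → ℝ} (hI : I ∈ M) (κ : ℝ) :
    averagedDrift R m (I, κ) = averagedDrift R' m (I, κ) :=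
  Finset.sum_congr rfl fun i hi => by simp only [h i hi I hI]

theorem decoupledMap_congr (h : ∀ i ∈ Finset.Icc 1 (m + 1), R i = R' i) :
    decoupledMap ω₀ R m = decoupledMap ω₀ R' m := by
  have h1 : averagedDrift R m = averagedDrift R' m := by
    funext x
    refine Finset.sum_congr rfl fun i hi => ?_
    rw [h i (Finset.Icc_subset_Icc_right m.le_succ hi)]
  rw [decoupledMap_eq_driftMap, decoupledMap_eq_driftMap, h1, h (m + 1) (by simp)]

/-- Averaging to all orders, for exactly periodic data. -/
theorem exists_decoupling (hM : IsOpen M) {c μ : ℝ} (hc : 0 < c) (hμ : 0 < μ)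
    (hω : ω₀ ∈ diophantineSet l c μ) {X : Phase l j × ℝ → Phase l j} (hX : IsPeriodicAnalytic M X)
    (hdet : ∀ p ∈ overTorus l M, ∀ᶠ q : Phase l j × ℝ in 𝓝 (p, 0),
      (fderiv ℝ (decoupledMap ω₀ (fun _ => X) 0 q.2) q.1).det = 1) (n : ℕ) :
    ∃ (R V : ℕ → Phase l j × ℝ → Phase l j) (Ψ : ℕ → ℝ → Phase l j → Phase l j), R 1 = X ∧
      (∀ m ∈ Finset.Icc 1 (n + 1), IsPeriodicAnalytic M (R m)) ∧
      (∀ m ∈ Finset.Icc 1 n, IsPeriodicAnalytic M (V m) ∧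
        IsLocalConjugacy M (nearIdentity m (V m)) (Ψ m) (decoupledMap ω₀ R (m - 1))
          (decoupledMap ω₀ R m)) ∧
      ∀ p ∈ overTorus l M, ∀ᶠ q : Phase l j × ℝ in 𝓝 (p, 0),
        (fderiv ℝ (decoupledMap ω₀ R n q.2) q.1).det = 1 := by
  induction n with
  | zero =>
    -- Only the entry of `R` at index 1 matters here; the other entries are placeholders.
    refine ⟨fun _ => X, fun _ => X, fun _ _ => id, rfl, fun _ _ => hX, fun m hm => ?_, hdet⟩
    simp at hm
  | succ n ih =>
    obtain ⟨R, V, Ψ, hR1, hR, hV, hdet⟩ := ih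
    rw [decoupledMap_eq_driftMap] at hdet
    obtain ⟨V', Y, Ψ', hV', hY, hconj, hdet'⟩ := exists_decoupling_step hM hc hμ hω n.succ_ne_zero
      (fun I hI => analyticAt_averagedDrift
        (fun i hi => hR i (Finset.Icc_subset_Icc_right n.le_succ hi)) hI)
      (averagedDrift_zero R n) (hR (n + 1) (by simp)) hdet
    -- The map of order m involves only the entries up to m + 1, so filling index n + 2 leaves all
    -- maps of order at most n unchanged.
    set S := Function.update R (n + 2) Y with hS
    have hSR (i : ℕ) (hi : i ≤ n + 1) : S i = R i := Function.update_of_ne (by omega) _ _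
    have hSY : S (n + 2) = Y := Function.update_self ..
    have hold (m : ℕ) (hm : m ≤ n) : decoupledMap ω₀ S m = decoupledMap ω₀ R m :=
      decoupledMap_congr fun i hi => hSR i (by have := (Finset.mem_Icc.1 hi).2; omega)
    have hnew : decoupledMap ω₀ S (n + 1) = driftMap ω₀
        (fun x => averagedDrift R n x + x.2 ^ (n + 1) • torusAverage (R (n + 1)) x.1) (n + 2) Y := by
      rw [decoupledMap_eq_driftMap, hSY, ← averagedDrift_succ]
      congr 1
      funext x
      exact Finset.sum_congr rfl fun i hi => by rw [hSR i (Finset.mem_Icc.1 hi).2]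
    refine ⟨S, Function.update V (n + 1) V', Function.update Ψ (n + 1) Ψ', ?_, ?_, ?_, ?_⟩
    · rw [hSR 1 (by omega), hR1]
    · intro m hm
      rw [Finset.mem_Icc] at hm
      rcases hm.2.lt_or_eq with h | rfl
      · rw [hSR m (by omega)]
        exact hR m (Finset.mem_Icc.2 ⟨hm.1, by omega⟩)
      · rwa [hSY]
    · intro m hm
      rw [Finset.mem_Icc] at hm
      rcases hm.2.lt_or_eq with h | rfl
      · rw [Function.update_of_ne h.ne, Function.update_of_ne h.ne, hold m (by omega),
          hold (m - 1) (by omega)]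
        exact hV m (Finset.mem_Icc.2 ⟨hm.1, by omega⟩)
      · rw [Function.update_self, Function.update_self, hnew, Nat.add_sub_cancel, hold n le_rfl,
          decoupledMap_eq_driftMap]
        exact ⟨hV', hconj⟩
    · rwa [hnew]

end Iteration

/-! ### Assembly of the theorem. -/

theorem mainTheorem4 (l j : ℕ) (M : Set (Fin j → ℝ)) (hM : IsOpen M)
    (c μ : ℝ) (hc : 0 < c) (hμ : 0 < μ)
    (ω₀ : Fin l → ℝ) (hω₀ : ω₀ ∈ diophantineSet l c μ)
    (F : Phase l j × ℝ → (Fin l → ℝ)) (G : Phase l j × ℝ → (Fin j → ℝ))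
    (hF : IsAnalyticFamily M F) (hG : IsAnalyticFamily M G)
    (hvol : ∀ K ⊆ M, IsCompact K → ∃ κ₀ > 0, ∀ κ : ℝ, |κ| < κ₀ →
      IsVolumePreservingOn (slowFastMap ω₀ F G κ) (overTorus l K))
    (n : ℕ) :
    ∃ R V : ℕ → Phase l j × ℝ → Phase l j,
      R 1 = (fun q => (F q, G q)) ∧
      (∀ m ∈ Finset.Icc 1 (n + 1), IsAnalyticFamily M (R m)) ∧
      (∀ m ∈ Finset.Icc 1 n, IsAnalyticFamily M (V m)) ∧
      (∀ m ∈ Finset.Icc 1 n, AnalyticOnNhd ℝ (torusAverage (R m)) M) ∧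
      decoupledMap ω₀ R 0 = slowFastMap ω₀ F G ∧
      (∀ m ∈ Finset.Icc 1 n,
        IsVolumePreservingConjugacy M (nearIdentity m (V m))
          (decoupledMap ω₀ R (m - 1)) (decoupledMap ω₀ R m)) ∧
      IsVolumePreservingUpTo M n (averagedSlowMap R n) := by
  set Z : Phase l j × ℝ → Phase l j := fun q => (F q, G q) with hZdef
  have hZ : IsAnalyticFamily M Z := hF.prodMk hG
  have h0 (R : ℕ → Phase l j × ℝ → Phase l j) (hR : R 1 = Z) :
      decoupledMap ω₀ R 0 = slowFastMap ω₀ F G := by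
    funext κ p
    simp [decoupledMap, slowFastMap, hR, hZdef]
  have h0' (R : ℕ → Phase l j × ℝ → Phase l j) (κ : ℝ) (p : Phase l j)
      (hR : R 1 (p, κ) = Z (p, κ)) :
      decoupledMap ω₀ R 0 κ p = slowFastMap ω₀ F G κ p := by
    simp [decoupledMap, slowFastMap, hR, hZdef]
  have hdet : ∀ p ∈ overTorus l M, ∀ᶠ q : Phase l j × ℝ in 𝓝 (p, 0),
      (fderiv ℝ (decoupledMap ω₀ (fun _ => periodise Z) 0 q.2) q.1).det = 1 := by
    intro p hp
    -- A compact neighbourhood of the slow component turns volume preservation over compact sets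
    -- into a statement near (p, 0).
    obtain ⟨K, hK, hpK, hKM⟩ := exists_compact_subset hM (mem_overTorus.1 hp)
    obtain ⟨κ₀, hκ₀, H⟩ := hvol K hKM hK
    have e1 : ∀ᶠ κ : ℝ in 𝓝 0, |κ| < κ₀ := by
      simpa [ball, dist_zero_right] using! ball_mem_nhds (0 : ℝ) hκ₀
    have e2 : overTorus l (interior K) ∈ 𝓝 p :=
      (isOpen_overTorus isOpen_interior).mem_nhds (mem_overTorus.2 hpK)
    filter_upwards [prod_mem_nhds e2 e1, (hZ.eventually_periodise_eq hp).1.eventuallyEq_nhds]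
      with q hq hq'
    have e3 : decoupledMap ω₀ (fun _ => periodise Z) 0 q.2 =ᶠ[𝓝 q.1] slowFastMap ω₀ F G q.2 :=
      ((Continuous.tendsto' (f := fun p => (p, q.2)) (by fun_prop) q.1 q rfl).eventually hq').mono
        fun p hp => h0' _ _ _ hp
    rw [e3.fderiv_eq]
    exact H q.2 hq.2 q.1 (prod_mono_right interior_subset hq.1)
  obtain ⟨R', V, Ψ, hR1, hR, hV, hdetn⟩ := exists_decoupling hM hc hμ hω₀
    hZ.isPeriodicAnalytic_periodise hdet n
  -- The averaging was run on the periodised data; the original (F, G) is put back at index 1. The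
  -- two agree near 𝕋ˡ × M × {0}.
  set R := Function.update R' 1 Z with hRdef
  have hR1' : R 1 = Z := Function.update_self ..
  have hRne (i : ℕ) (hi : i ≠ 1) : R i = R' i := Function.update_of_ne hi _ _
  have hav (i : ℕ) (I) (hI : I ∈ M) : torusAverage (R i) I = torusAverage (R' i) I := by
    rcases eq_or_ne i 1 with rfl | hi
    · rw [hR1', hR1]
      refine integral_congr_ae (Eventually.of_forall fun θ => ?_)
      exact (hZ.eventually_periodise_eq (p := (θ, I)) (mem_overTorus.2 hI)).1.eq_of_nhds.symm
    · rw [hRne i hi]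
  -- For m ≥ 1 the entry at index 1 enters only through its average at κ = 0, so equality holds for
  -- every κ. The map of order 0 uses the entry itself and agrees only for small κ.
  have hdm (m : ℕ) (hm : m ≠ 0) (κ : ℝ) (p) (hp : p ∈ overTorus l M) :
      decoupledMap ω₀ R m κ p = decoupledMap ω₀ R' m κ p := by
    simp only [decoupledMap_eq_driftMap, driftMap, hRne (m + 1) (by omega),
      averagedDrift_congr (M := M) (fun i _ => hav i) (mem_overTorus.1 hp)]
  refine ⟨R, V, hR1', fun m hm => ?_, fun m hm => (hV m hm).1.isAnalyticFamily hM, fun m hm => ?_,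
    h0 R hR1', fun m hm => ?_, ?_⟩
  · rcases eq_or_ne m 1 with rfl | h
    · rwa [hR1']
    · rw [hRne m h]
      exact (hR m hm).isAnalyticFamily hM
  · exact ((hR m (Finset.Icc_subset_Icc_right n.le_succ hm)).analyticOnNhd_torusAverage).congr hM
      fun I hI => (hav m I hI).symm
  · have hm0 : m ≠ 0 := by have := (Finset.mem_Icc.1 hm).1; omega
    intro K hKM hK
    -- `W` replaces `M` so that Φ maps points over `K` to where the periodised and original data
    -- coincide. This is needed when m = 1.
    obtain ⟨W, hW, hKW, hWM, κ₁, hκ₁, H₁⟩ := hZ.exists_periodise_eq hK hKM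
    obtain ⟨U, hU, hKU, hUW, κ₂, hκ₂, H₂⟩ :=
      ((hV m hm).2.mono hWM).isVolumePreservingConjugacy hW K hKW hK
    refine ⟨U, hU, hKU, hUW.trans hWM, min κ₁ κ₂, lt_min hκ₁ hκ₂, fun κ hκ => ?_⟩
    obtain ⟨k1, k2, k3, k4, k5, k6⟩ := H₂ κ (hκ.trans_le (min_le_right _ _))
    refine ⟨k1, k2, k3, fun p hp => prod_mono_right hWM (k4 hp), k5, fun p hp => ?_⟩
    obtain ⟨g1, g2, g3⟩ := k6 p hp
    rw [hdm m hm0 κ p (prod_mono_right hKM hp)]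
    refine ⟨g1, g2, ?_⟩
    rw [← g3]
    have g4 : nearIdentity m (V m) κ p ∈ overTorus l W := prod_mono_right hUW g1
    rcases eq_or_ne (m - 1) 0 with h | h
    · rw [h, h0' R κ _ (by rw [hR1']), h0' R' κ]
      rw [hR1]
      exact (H₁ κ (hκ.trans_le (min_le_left _ _)) _ g4).1
    · exact hdm _ h κ _ (prod_mono_right hWM g4)
  · refine isVolumePreservingUpTo_of_isBigO fun I hI => ?_
    rw [decoupledMap_eq_driftMap] at hdetn
    refine (isBigO_det_fderiv_sub_one n.succ_ne_zero (fun I hI => analyticAt_averagedDrift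
      (fun i hi => hR i (Finset.Icc_subset_Icc_right n.le_succ hi)) hI)
      (hR (n + 1) (by simp)).analyticAt hdetn hI).congr' ?_ EventuallyEq.rfl
    have e1 : ∀ᶠ q : (Fin j → ℝ) × ℝ in 𝓝 (I, 0), q.1 ∈ M :=
      continuousAt_fst.eventually_mem (hM.mem_nhds hI)
    filter_upwards [e1] with q hq
    congr 2
    refine Filter.EventuallyEq.fderiv_eq ?_
    filter_upwards [hM.mem_nhds hq] with I' hI'
    simp only [averagedSlowMap_eq, averagedDrift_congr (M := M) (fun i _ => hav i) hI']

end
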